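/- **Definitions.** A semi-uniform space $(X,\mathcal U)$ is a set $X$ with a proper filter $\mathcal U$ on $X\times X$ such that every $U\in\mathcal U$ contains the diagonal and every $U^{-1}=\{(y,x):(x,y)\in U\}$, $U\in\mathcal U$, contains a member of $\mathcal U$. A map $f:X\to X'$ of semi-uniform spaces is semi-uniformly continuous if $(f\times f)^{-1}(U')\in\mathcal U$ for all $U'\in\mathcal U'$. The product of $(X,\mathcal U)$ and $(Y,\mathcal V)$ is $X\times Y$ with the filter $\mathcal U\times\mathcal V$ generated by the sets $U\times V=\{((x,y),(x',y')) : (x,x')\in U,\ (y,y')\in V\}$, $U\in\mathcal U$, $V\in\mathcal V$. The set $\mathcal U$ is ordered by reverse inclusion ($U\le V$ iff $V\subseteq U$), so a maximal element is an element with no proper subset in $\mathcal U$. For $U\in\mathcal U$ let $X^U$ be the simplicial set with $n$-simplices the tuples $(x_0,\dots,x_n)$ with $(x_i,x_j)\in U$ for all $i<j$, where faces delete an entry and degeneracies repeat one. For a module $G$ over a commutative ring $R$ let $H_q(X^U;G)$ be the homology of $C_*(X^U)\otimes_{\mathbb Z}G$ (zero for $q<0$), and let $H^{VR}_q(X;G)=\varprojlim_{U\in\mathcal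 U}H_q(X^U;G)$. It is functorial in $X$ (for semi-uniformly continuous maps) and in $G$. **Theorem.** 1. Let $(X,\mathcal U)$ and $(Y,\mathcal V)$ be semi-uniform spaces and let $U^*$, $V^*$ be maximal in $\mathcal U$, $\mathcal V$ for the order above. Then $U^*\times V^*$ is maximal in $\mathcal U\times\mathcal V$. 2. Let $R$ be a principal ideal domain. For all semi-uniform spaces $(X,\mathcal U)$, $(Y,\mathcal V)$ such that $\mathcal U$ and $\mathcal V$ have maximal elements, all $R$-modules $G,G'$ with $\mathrm{Tor}_1^R(G,G')=0$ and all $q\in\mathbb Z$, there is a short exact sequence of $R$-modules $$0\to\bigoplus_{i+j=q}H_i^{VR}(X;G)\otimes_R H_j^{VR}(Y;G')\to H_q^{VR}(X\times Y;G\otimes_R G')\to\bigoplus_{i+j=q-1}\mathrm{Tor}_1^R\bigl(H_i^{VR}(X;G),H_j^{VR}(Y;G')\bigr)\to 0,$$ natural in $X$, $Y$ (for semi-uniformly continuous maps) and in $G$, $G'$, and each of these sequences splits. 3. The splitting is in general not canonical: there are a principal ideal domain $R$ and $R$-modules $G,G'$ with $\mathrm{Tor}_1^R(G,G')=0$ such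 that, for every natural family of short exact sequences as in 2, there is no choice of right splittings (for these $G,G'$ and all $X,Y,q$) that is natural in $X$ and $Y$. -/

import Mathlib

open CategoryTheory Limits MonoidalCategory

universe u

noncomputable section

/-! ### Semi-uniform spaces -/

/-- A semi-uniform space: a set with a (proper) filter on `carrier × carrier` all of whose members
contain the diagonal, and such that the inverse of each member contains a member. -/
structure SemiUniformSpace : Type (u + 1) where
  carrier : Type u
  entourages : Filter (carrier × carrier)
  proper : entourages.NeBot
  refl : ∀ U ∈ entourages, ∀ x, (x, x) ∈ U
  symm : ∀ U ∈ entourages, ∃ V ∈ entourages, V ⊆ {p | (p.2, p.1) ∈ U}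

namespace SemiUniformSpace

/-- The subset of `(α × β) × (α × β)` that corresponds to `U × V ⊆ (α × α) × (β × β)`. -/
def boxRel {α β : Type u} (U : Set (α × α)) (V : Set (β × β)) : Set ((α × β) × (α × β)) :=
  {p | (p.1.1, p.2.1) ∈ U ∧ (p.1.2, p.2.2) ∈ V}

/-- The filter generated by the sets `U × V` with `U` in `F` and `V` in `F'`
(see `mem_boxFilter`). -/
def boxFilter {α β : Type u} (F : Filter (α × α)) (F' : Filter (β × β)) :
    Filter ((α × β) × (α × β)) :=
  (F.comap fun p => (p.1.1, p.2.1)) ⊓ (F'.comap fun p => (p.1.2, p.2.2))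

theorem mem_boxFilter {α β : Type u} {F : Filter (α × α)} {F' : Filter (β × β)}
    {W : Set ((α × β) × (α × β))} :
    W ∈ boxFilter F F' ↔ ∃ U ∈ F, ∃ V ∈ F', boxRel U V ⊆ W := by
  constructor
  · intro h
    obtain ⟨A, ⟨U, hU, hUA⟩, B, ⟨V, hV, hVB⟩, rfl⟩ := Filter.mem_inf_iff.1 h
    exact ⟨U, hU, V, hV, fun p hp => ⟨hUA hp.1, hVB hp.2⟩⟩
  · rintro ⟨U, hU, V, hV, h⟩
    exact Filter.mem_of_superset (Filter.inter_mem_inf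
      (Filter.preimage_mem_comap hU) (Filter.preimage_mem_comap hV)) h

/-- The product of two semi-uniform spaces. -/
def prod (X Y : SemiUniformSpace.{u}) : SemiUniformSpace.{u} where
  carrier := X.carrier × Y.carrier
  entourages := boxFilter X.entourages Y.entourages
  proper := by
    refine Filter.neBot_iff.2 fun h => ?_
    have h0 : (∅ : Set ((X.carrier × Y.carrier) × (X.carrier × Y.carrier))) ∈
        boxFilter X.entourages Y.entourages := by rw [h]; trivial
    obtain ⟨U, hU, V, hV, hW⟩ := mem_boxFilter.1 h0
    obtain ⟨p, hp⟩ := X.proper.nonempty_of_mem hU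
    obtain ⟨r, hr⟩ := Y.proper.nonempty_of_mem hV
    exact @hW ((p.1, r.1), (p.2, r.2)) ⟨hp, hr⟩
  refl := by
    intro W hW x
    obtain ⟨U, hU, V, hV, h⟩ := mem_boxFilter.1 hW
    exact h ⟨X.refl U hU _, Y.refl V hV _⟩
  symm := by
    intro W hW
    obtain ⟨U, hU, V, hV, h⟩ := mem_boxFilter.1 hW
    obtain ⟨U', hU', hUU⟩ := X.symm U hU
    obtain ⟨V', hV', hVV⟩ := Y.symm V hV
    exact ⟨boxRel U' V', mem_boxFilter.2 ⟨U', hU', V', hV', subset_rfl⟩,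
      fun p hp => h ⟨hUU hp.1, hVV hp.2⟩⟩

/-- `U` is extremal among the entourages of `X`: it is minimal for inclusion, that is, maximal in
the order in which smaller sets are later. -/
def IsExtremal (X : SemiUniformSpace.{u}) (U : Set (X.carrier × X.carrier)) : Prop :=
  Minimal (fun V => V ∈ X.entourages) U

/-- The semi-uniform structure of `X` has an extremal element. -/
class HasExtremal (X : SemiUniformSpace.{u}) : Prop where
  exists_extremal : ∃ U, X.IsExtremal U

/-- Semi-uniformly continuous maps. -/
structure Map (X Y : SemiUniformSpace.{u}) where
  toFun : X.carrier → Y.carrier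
  preimage_mem : ∀ V ∈ Y.entourages, {p | (toFun p.1, toFun p.2) ∈ V} ∈ X.entourages

/-- The product of two semi-uniformly continuous maps. -/
def Map.prod {X X' Y Y' : SemiUniformSpace.{u}} (f : Map X X') (g : Map Y Y') :
    Map (X.prod Y) (X'.prod Y') where
  toFun p := (f.toFun p.1, g.toFun p.2)
  preimage_mem := by
    intro W hW
    obtain ⟨U, hU, V, hV, h⟩ := mem_boxFilter.1 hW
    exact mem_boxFilter.2 ⟨_, f.preimage_mem U hU, _, g.preimage_mem V hV,
      fun p hp => h ⟨hp.1, hp.2⟩⟩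

/-! ### The Vietoris–Rips complex of a pair -/

/-- The simplicial set whose `n`-simplices are the `(x₀, …, xₙ)` with `(xᵢ, xⱼ) ∈ U` for `i < j`;
faces delete an entry and degeneracies repeat one. -/
def ripsComplex {α : Type u} (U : Set (α × α)) (hU : ∀ x, (x, x) ∈ U) : SSet.{u} where
  obj n := {x : Fin (n.unop.len + 1) → α // ∀ i j, i < j → (x i, x j) ∈ U}
  map f := TypeCat.ofHom fun x => ⟨fun i => x.1 (f.unop.toOrderHom i), fun i j hij => by
    rcases (f.unop.toOrderHom.monotone hij.le).lt_or_eq with h | h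
    · exact x.2 _ _ h
    · change (x.1 _, x.1 _) ∈ U
      rw [h]; exact hU _⟩

/-- The simplicial map induced by a map that carries `U` into `V`. -/
def ripsMap {α β : Type u} {U : Set (α × α)} {V : Set (β × β)} (hU : ∀ x, (x, x) ∈ U)
    (hV : ∀ x, (x, x) ∈ V) (f : α → β) (hf : ∀ p ∈ U, (f p.1, f p.2) ∈ V) :
    ripsComplex U hU ⟶ ripsComplex V hV where
  app _ := TypeCat.ofHom fun x => ⟨fun i => f (x.1 i), fun i j hij => hf _ (x.2 i j hij)⟩

/-- The entourages of `X`, ordered by inclusion. -/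
abbrev Entourage (X : SemiUniformSpace.{u}) : Type u := {U // U ∈ X.entourages}

/-- The Vietoris–Rips complexes `X^U`, with the inclusions `X^V → X^U` for `V ⊆ U`. -/
def ripsSystem (X : SemiUniformSpace.{u}) : X.Entourage ⥤ SSet.{u} where
  obj U := ripsComplex U.1 (X.refl U.1 U.2)
  map {U V} h := ripsMap (X.refl U.1 U.2) (X.refl V.1 V.2) (fun x => x) (fun _ hp => leOfHom h hp)

/-! ### Vietoris–Rips homology with coefficients -/

variable {R : Type u} [CommRing R]

/-- Simplicial homology in degree `q : ℤ`, as a functor of the coefficient module and of the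
simplicial set. The chains in degree `n ≥ 0` are the direct sum of copies of the coefficient
module over the `n`-simplices; there are none in negative degrees. -/
def simplicialHomology (R : Type u) [CommRing R] :
    ℤ → (ModuleCat.{u} R ⥤ SSet.{u} ⥤ ModuleCat.{u} R)
  | Int.ofNat n => SSet.chainComplexFunctor (ModuleCat.{u} R) ⋙
      (Functor.whiskeringRight _ _ _).obj (HomologicalComplex.homologyFunctor _ _ n)
  | Int.negSucc _ => (Functor.const _).obj ((Functor.const _).obj (ModuleCat.of R PUnit))

/-- The inverse system of the `H_q(X^U; G)`. -/
def homologySystem (X : SemiUniformSpace.{u}) (G : ModuleCat.{u} R) (q : ℤ) :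
    X.Entourage ⥤ ModuleCat.{u} R :=
  X.ripsSystem ⋙ ((simplicialHomology R q).obj G)

/-- The Vietoris–Rips homology `H_q^{VR}(X; G)`, the inverse limit of the `H_q(X^U; G)`. -/
def vrHomology (X : SemiUniformSpace.{u}) (G : ModuleCat.{u} R) (q : ℤ) : ModuleCat.{u} R :=
  limit (X.homologySystem G q)

/-- Pulling back entourages along a map. -/
def Map.pullback {X Y : SemiUniformSpace.{u}} (f : Map X Y) : Y.Entourage ⥤ X.Entourage where
  obj V := ⟨{p | (f.toFun p.1, f.toFun p.2) ∈ V.1}, f.preimage_mem V.1 V.2⟩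
  map h := homOfLE fun _ hp => leOfHom h hp

/-- The maps `X^{f⁻¹V} → Y^V`. -/
def Map.ripsTrans {X Y : SemiUniformSpace.{u}} (f : Map X Y) :
    f.pullback ⋙ X.ripsSystem ⟶ Y.ripsSystem where
  app V := ripsMap (X.refl _ (f.pullback.obj V).2) (Y.refl V.1 V.2) f.toFun (fun _ hp => hp)
  naturality _ _ _ := rfl

/-- The map on Vietoris–Rips homology induced by a map of spaces and a map of coefficients:
the limit over the entourages `V` of `Y` of
`lim_U H_q(X^U; G) → H_q(X^{f⁻¹V}; G) → H_q(Y^V; G) → H_q(Y^V; G')`. -/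
def vrMap {X Y : SemiUniformSpace.{u}} (f : Map X Y) {G G' : ModuleCat.{u} R} (φ : G ⟶ G')
    (q : ℤ) : X.vrHomology G q ⟶ Y.vrHomology G' q :=
  limit.pre (X.homologySystem G q) f.pullback ≫
    limMap (Functor.whiskerRight f.ripsTrans ((simplicialHomology R q).obj G) ≫
      Functor.whiskerLeft Y.ripsSystem ((simplicialHomology R q).map φ))

end SemiUniformSpace

/-! ### The terms of the Künneth sequence -/

namespace Kunneth

open SemiUniformSpace

variable {R : Type u} [CommRing R]

/-- `Tor₁` over `R`. -/
abbrev tor₁ (M N : ModuleCat.{u} R) : ModuleCat.{u} R :=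
  ((Tor (ModuleCat.{u} R) 1).obj M).obj N

/-- The map induced on `Tor₁` by a pair of maps. -/
abbrev tor₁Map {M M' N N' : ModuleCat.{u} R} (a : M ⟶ M') (b : N ⟶ N') :
    tor₁ M N ⟶ tor₁ M' N' :=
  ((Tor (ModuleCat.{u} R) 1).map a).app N ≫ ((Tor (ModuleCat.{u} R) 1).obj M').map b

/-- The pairs `(i, j)` of integers with `i + j = q`. -/
abbrev Pairs (q : ℤ) : Type := {p : ℤ × ℤ // p.1 + p.2 = q}

/-- `⨁_{i+j=q} H_i^{VR}(X; G) ⊗ H_j^{VR}(Y; G')` -/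
def tensorTerm (X Y : SemiUniformSpace.{u}) (G G' : ModuleCat.{u} R) (q : ℤ) : ModuleCat.{u} R :=
  ∐ fun p : Pairs q => X.vrHomology G p.1.1 ⊗ Y.vrHomology G' p.1.2

/-- `⨁_{i+j=q} Tor₁(H_i^{VR}(X; G), H_j^{VR}(Y; G'))` -/
def torTerm (X Y : SemiUniformSpace.{u}) (G G' : ModuleCat.{u} R) (q : ℤ) : ModuleCat.{u} R :=
  ∐ fun p : Pairs q => tor₁ (X.vrHomology G p.1.1) (Y.vrHomology G' p.1.2)

section maps

variable {X X' Y Y' : SemiUniformSpace.{u}} (f : Map X X') (g : Map Y Y')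
  {G G₁ G' G₁' : ModuleCat.{u} R} (φ : G ⟶ G₁) (ψ : G' ⟶ G₁') (q : ℤ)

/-- The map induced on the tensor terms. -/
def tensorTermMap : tensorTerm X Y G G' q ⟶ tensorTerm X' Y' G₁ G₁' q :=
  Limits.Sigma.map fun p : Pairs q => vrMap f φ p.1.1 ⊗ₘ vrMap g ψ p.1.2

/-- The map induced on the torsion terms. -/
def torTermMap : torTerm X Y G G' q ⟶ torTerm X' Y' G₁ G₁' q :=
  Limits.Sigma.map fun p : Pairs q => tor₁Map (vrMap f φ p.1.1) (vrMap g ψ p.1.2)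

end maps

/-- A family of sequences
`0 → ⨁_{i+j=q} H_i(X; G) ⊗ H_j(Y; G') → H_q(X × Y; G ⊗ G') →
  ⨁_{i+j=q-1} Tor₁(H_i(X; G), H_j(Y; G')) → 0`
of `R`-modules, one for all semi-uniform spaces `X`, `Y` with extremal entourages, all `R`-modules
`G`, `G'` with `Tor₁(G, G') = 0` and all integers `q`, short exact, and natural in `X`, `Y`,
`G` and `G'`. -/
structure NaturalSequence (R : Type u) [CommRing R] where
  ι : ∀ (X Y : SemiUniformSpace.{u}) [X.HasExtremal] [Y.HasExtremal] (G G' : ModuleCat.{u} R),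
    IsZero (tor₁ G G') → ∀ q : ℤ, tensorTerm X Y G G' q ⟶ (X.prod Y).vrHomology (G ⊗ G') q
  π : ∀ (X Y : SemiUniformSpace.{u}) [X.HasExtremal] [Y.HasExtremal] (G G' : ModuleCat.{u} R),
    IsZero (tor₁ G G') → ∀ q : ℤ, (X.prod Y).vrHomology (G ⊗ G') q ⟶ torTerm X Y G G' (q - 1)
  zero : ∀ (X Y : SemiUniformSpace.{u}) [X.HasExtremal] [Y.HasExtremal] (G G' : ModuleCat.{u} R)
    (h : IsZero (tor₁ G G')) (q : ℤ), ι X Y G G' h q ≫ π X Y G G' h q = 0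
  shortExact : ∀ (X Y : SemiUniformSpace.{u}) [X.HasExtremal] [Y.HasExtremal]
    (G G' : ModuleCat.{u} R) (h : IsZero (tor₁ G G')) (q : ℤ),
    (ShortComplex.mk (ι X Y G G' h q) (π X Y G G' h q) (zero X Y G G' h q)).ShortExact
  ι_natural : ∀ {X X' Y Y' : SemiUniformSpace.{u}} [X.HasExtremal] [Y.HasExtremal]
    [X'.HasExtremal] [Y'.HasExtremal] (f : Map X X') (g : Map Y Y')
    {G G₁ G' G₁' : ModuleCat.{u} R} (φ : G ⟶ G₁) (ψ : G' ⟶ G₁')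
    (h : IsZero (tor₁ G G')) (h₁ : IsZero (tor₁ G₁ G₁')) (q : ℤ),
    ι X Y G G' h q ≫ vrMap (f.prod g) (φ ⊗ₘ ψ) q =
      tensorTermMap f g φ ψ q ≫ ι X' Y' G₁ G₁' h₁ q
  π_natural : ∀ {X X' Y Y' : SemiUniformSpace.{u}} [X.HasExtremal] [Y.HasExtremal]
    [X'.HasExtremal] [Y'.HasExtremal] (f : Map X X') (g : Map Y Y')
    {G G₁ G' G₁' : ModuleCat.{u} R} (φ : G ⟶ G₁) (ψ : G' ⟶ G₁')
    (h : IsZero (tor₁ G G')) (h₁ : IsZero (tor₁ G₁ G₁')) (q : ℤ),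
    π X Y G G' h q ≫ torTermMap f g φ ψ (q - 1) =
      vrMap (f.prod g) (φ ⊗ₘ ψ) q ≫ π X' Y' G₁ G₁' h₁ q

namespace NaturalSequence

/-- The sequence for `X`, `Y`, `G`, `G'` in degree `q`. -/
abbrev seq (K : NaturalSequence R) (X Y : SemiUniformSpace.{u}) [X.HasExtremal] [Y.HasExtremal]
    (G G' : ModuleCat.{u} R) (h : IsZero (tor₁ G G')) (q : ℤ) : ShortComplex (ModuleCat.{u} R) :=
  ShortComplex.mk (K.ι X Y G G' h q) (K.π X Y G G' h q) (K.zero X Y G G' h q)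

/-- For the coefficients `G`, `G'`, right splittings of all the sequences can be chosen so that
they are natural in `X` and `Y`. -/
def SplitsNaturally (K : NaturalSequence R) (G G' : ModuleCat.{u} R) (h : IsZero (tor₁ G G')) :
    Prop :=
  ∃ s : ∀ (X Y : SemiUniformSpace.{u}) [X.HasExtremal] [Y.HasExtremal] (q : ℤ),
      torTerm X Y G G' (q - 1) ⟶ (X.prod Y).vrHomology (G ⊗ G') q,
    (∀ (X Y : SemiUniformSpace.{u}) [X.HasExtremal] [Y.HasExtremal] (q : ℤ),
      s X Y q ≫ K.π X Y G G' h q = 𝟙 _) ∧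
    ∀ {X X' Y Y' : SemiUniformSpace.{u}} [X.HasExtremal] [Y.HasExtremal]
      [X'.HasExtremal] [Y'.HasExtremal] (f : Map X X') (g : Map Y Y') (q : ℤ),
      s X Y q ≫ vrMap (f.prod g) (𝟙 (G ⊗ G')) q =
        torTermMap f g (𝟙 G) (𝟙 G') (q - 1) ≫ s X' Y' q

end NaturalSequence

end Kunneth

end

/-! Entourages are closed under intersection, so a maximal one is contained in all others. It is
then initial in the inverse system, and Vietoris–Rips homology is the homology of one simplicial
set. Boxes of least entourages are least, and an ordered tuple of pairs is a simplex for the box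
exactly when both coordinate tuples are simplices, so the complex of a product is the product
simplicial set. What has to be proved is a Künneth theorem for products of simplicial sets with
coefficients `G ⊗ G'`.

The chains on a product are the diagonal of a bisimplicial module whose total complex is the tensor
product of the two chain complexes. Instead of shuffle and Alexander–Whitney maps, dimension
shifting is used. The total complex and the complex of the diagonal are exact functors of the
bisimplicial module, neither has homology in positive degrees on a double décalage, every
bisimplicial module is naturally a quotient of its double décalage, and the two functors agree on
homology in degree zero. Hence they have naturally isomorphic homology (`Effacing.homIso`,
`eilenbergZilber`).

For the algebra, let `D` have projective terms, with cycles `Z` and boundaries `B`. The sequence `0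
→ Z → D → B → 0` stays exact after tensoring with any `C`, and `Z`, `B` are flat with zero
differential, so their tensor products with `C` have homology `H(C) ⊗ Z` and `H(C) ⊗ B`. Up to sign
the connecting map is induced by `B_{j+1} → Z_j` (`δ_rowEquiv`). Its cokernel is the tensor term.
Its kernel is the torsion term, because `0 → B_{j+1} → Z_j → H_j → 0` is a projective resolution
(`torEmb`). Chains with coefficients in arbitrary modules are not projective, so `D` is replaced by
a strictly functorial projective complex `repl D`. The hypothesis `Tor₁(G, G') = 0` passes to chains
and makes `C ⊗ repl D → C ⊗ D` a quasi-isomorphism. Strict functoriality gives naturality. For the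
splitting both factors are replaced, and the projections of cycles onto homology are extended to all
chains (`kRet`).

Natural splittings fail for the coefficients `ℤ` and `ℤ/2`, with a point as second factor. A
collapse of the projective plane onto the sphere carries the fundamental class modulo 2 to the
reduction of an integral class, which the second map of the sequence kills by naturality in the
coefficients. A natural section would force this image to come from an integral class of the
projective plane as well (`not_splitsNaturally`). But twice the pullback of the dual cocycle of a
face is a coboundary modulo 4. Images of integral classes therefore pair to zero with that cocycle,
while the class in question pairs to `2 ≠ 0` in `ℤ/4`. -/

set_option linter.unusedSectionVars false

noncomputable section

namespace Kunneth

/-! ### Homology of chain complexes of modules, in terms of elements -/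

section elements

variable {R : Type u} [CommRing R] (K L : ChainComplex (ModuleCat.{u} R) ℕ) (n : ℕ)

theorem next_down (n : ℕ) : (ComplexShape.down ℕ).next n = n - 1 := by
  cases n <;> simp

/-- The module of `n`-cycles. -/
def cyc : Submodule R (K.X n) := LinearMap.ker (K.d n (n - 1)).hom

variable {K n} in
theorem mem_cyc {x : K.X n} : x ∈ cyc K n ↔ K.d n (n - 1) x = 0 := Iff.rfl

variable {K n} in
theorem mem_cyc_succ {x : K.X (n + 1)} : x ∈ cyc K (n + 1) ↔ K.d (n + 1) n x = 0 := Iff.rfl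

/-- In degree zero the truncated `n - 1` is again zero, and `d 0 0` vanishes because `0` is not its
own successor. The uniform definition of `cyc` therefore needs no separate case. -/
theorem mem_cyc_zero (x : K.X 0) : x ∈ cyc K 0 := by
  rw [mem_cyc, K.shape _ _ (by simp)]; rfl

theorem d_d_apply (i j k : ℕ) (x : K.X i) : K.d j k (K.d i j x) = 0 := by
  rw [← ModuleCat.comp_apply, K.d_comp_d]; rfl

theorem d_mem_cyc (m : ℕ) (x : K.X m) : K.d m n x ∈ cyc K n := d_d_apply _ _ _ _ _

/-- The differential with values in cycles. -/
def dCyc : K.X (n + 1) →ₗ[R] cyc K n :=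
  (K.d (n + 1) n).hom.codRestrict _ fun x => d_mem_cyc K n _ x

@[simp] theorem dCyc_coe (x : K.X (n + 1)) : (dCyc K n x : K.X n) = K.d (n + 1) n x := rfl

/-- The map from cycles to abstract cycles. -/
def cycLift : ModuleCat.of R (cyc K n) ⟶ K.cycles n :=
  K.liftCycles (ModuleCat.ofHom (cyc K n).subtype) (n - 1) (next_down n)
    (by ext x; exact x.2)

theorem iCycles_cycLift (x : cyc K n) : K.iCycles n (cycLift K n x) = x := by
  rw [← ModuleCat.comp_apply, cycLift, K.liftCycles_i]; rfl

theorem iCycles_injective : Function.Injective (K.iCycles n) :=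
  (ModuleCat.mono_iff_injective _).1 inferInstance

theorem iCycles_mem (c : K.cycles n) : K.iCycles n c ∈ cyc K n := by
  rw [mem_cyc, ← ModuleCat.comp_apply, K.iCycles_d]; rfl

theorem cycLift_surjective : Function.Surjective (cycLift K n) := fun c =>
  ⟨⟨K.iCycles n c, iCycles_mem K n c⟩, iCycles_injective K n (iCycles_cycLift K n _)⟩

/-- The homology class of a cycle. -/
def cls : cyc K n →ₗ[R] K.homology n := (cycLift K n ≫ K.homologyπ n).hom

theorem cls_apply (x : cyc K n) : cls K n x = K.homologyπ n (cycLift K n x) := rfl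

theorem cls_surjective : Function.Surjective (cls K n) := by
  have h : Function.Surjective (K.homologyπ n) :=
    (ModuleCat.epi_iff_surjective _).1 inferInstance
  exact h.comp (cycLift_surjective K n)

theorem cls_eq_zero_iff {x : cyc K n} : cls K n x = 0 ↔ ∃ y, K.d (n + 1) n y = x := by
  have e := ShortComplex.exact_of_g_is_cokernel
    (ShortComplex.mk (K.toCycles (n + 1) n) (K.homologyπ n) (K.toCycles_comp_homologyπ _ _))
    (K.homologyIsCokernel (n + 1) n (by simp))
  have hi : ∀ y, K.iCycles n (K.toCycles (n + 1) n y) = K.d (n + 1) n y := fun y => by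
    rw [← ModuleCat.comp_apply, K.toCycles_i]
  constructor
  · intro h
    obtain ⟨y, hy⟩ := (ShortComplex.moduleCat_exact_iff _).1 e (cycLift K n x) h
    refine ⟨y, ?_⟩
    have hy' : K.toCycles (n + 1) n y = cycLift K n x := hy
    rw [← hi, hy', iCycles_cycLift]
  · rintro ⟨y, hy⟩
    have hy' : cycLift K n x = K.toCycles (n + 1) n y :=
      iCycles_injective K n (by rw [iCycles_cycLift, hi, hy])
    rw [cls_apply, hy', ← ModuleCat.comp_apply, K.toCycles_comp_homologyπ]; rfl

theorem cls_dCyc (y : K.X (n + 1)) : cls K n (dCyc K n y) = 0 :=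
  (cls_eq_zero_iff K n).2 ⟨y, rfl⟩

theorem ker_cls : LinearMap.ker (cls K n) = LinearMap.range (dCyc K n) := by
  ext x
  rw [LinearMap.mem_ker, cls_eq_zero_iff]
  exact ⟨fun ⟨y, hy⟩ => ⟨y, Subtype.ext hy⟩, fun ⟨y, hy⟩ => ⟨y, by rw [← hy]; rfl⟩⟩

variable {K L n}

theorem map_d_apply (f : K ⟶ L) (i j : ℕ) (x : K.X i) :
    f.f j (K.d i j x) = L.d i j (f.f i x) := by
  rw [← ModuleCat.comp_apply, ← f.comm, ModuleCat.comp_apply]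

theorem map_mem_cyc (f : K ⟶ L) {x : K.X n} (hx : x ∈ cyc K n) : f.f n x ∈ cyc L n := by
  rw [mem_cyc] at *
  rw [← map_d_apply, hx, map_zero]

/-- The map induced on cycles. -/
def cycMap (f : K ⟶ L) (n : ℕ) : cyc K n →ₗ[R] cyc L n :=
  (f.f n).hom.restrict fun _ hx => map_mem_cyc f hx

@[simp] theorem cycMap_coe (f : K ⟶ L) (x : cyc K n) : (cycMap f n x : L.X n) = f.f n x := rfl

theorem homologyMap_cls (f : K ⟶ L) (x : cyc K n) :
    HomologicalComplex.homologyMap f n (cls K n x) = cls L n (cycMap f n x) := by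
  rw [cls_apply, cls_apply, ← ModuleCat.comp_apply, HomologicalComplex.homologyπ_naturality,
    ModuleCat.comp_apply]
  congr 1
  apply iCycles_injective
  rw [← ModuleCat.comp_apply, HomologicalComplex.cyclesMap_i, ModuleCat.comp_apply,
    iCycles_cycLift, iCycles_cycLift, cycMap_coe]

/-- A linear map out of a surjective image. -/
def liftSurj {A B C : Type*} [AddCommGroup A] [Module R A] [AddCommGroup B] [Module R B]
    [AddCommGroup C] [Module R C] (p : A →ₗ[R] B) (hp : Function.Surjective p) (f : A →ₗ[R] C)
    (h : LinearMap.ker p ≤ LinearMap.ker f) : B →ₗ[R] C :=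
  (Submodule.liftQ _ f h) ∘ₗ (p.quotKerEquivOfSurjective hp).symm.toLinearMap

@[simp] theorem liftSurj_apply {A B C : Type*} [AddCommGroup A] [Module R A] [AddCommGroup B]
    [Module R B] [AddCommGroup C] [Module R C] (p : A →ₗ[R] B) (hp : Function.Surjective p)
    (f : A →ₗ[R] C) (h : LinearMap.ker p ≤ LinearMap.ker f) (a : A) :
    liftSurj p hp f h (p a) = f a := by
  have : (p.quotKerEquivOfSurjective hp).symm (p a) = Submodule.Quotient.mk a := by
    rw [LinearEquiv.symm_apply_eq]; rfl
  simp [liftSurj, this]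

/-- A linear map into a module that embeds as a submodule. -/
def liftInj {A B C : Type*} [AddCommGroup A] [Module R A] [AddCommGroup B] [Module R B]
    [AddCommGroup C] [Module R C] (i : A →ₗ[R] B) (hi : Function.Injective i) (f : C →ₗ[R] B)
    (h : ∀ c, f c ∈ LinearMap.range i) : C →ₗ[R] A :=
  (LinearEquiv.ofInjective i hi).symm.toLinearMap ∘ₗ f.codRestrict _ h

@[simp] theorem liftInj_apply {A B C : Type*} [AddCommGroup A] [Module R A] [AddCommGroup B]
    [Module R B] [AddCommGroup C] [Module R C] (i : A →ₗ[R] B) (hi : Function.Injective i)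
    (f : C →ₗ[R] B) (h : ∀ c, f c ∈ LinearMap.range i) (c : C) :
    i (liftInj i hi f h c) = f c := by
  have := LinearEquiv.apply_symm_apply (LinearEquiv.ofInjective i hi) (f.codRestrict _ h c)
  exact congrArg Subtype.val this

variable (K n) in
/-- A linear map out of homology. -/
def homDesc {M : Type*} [AddCommGroup M] [Module R M] (f : cyc K n →ₗ[R] M)
    (hf : ∀ y, f (dCyc K n y) = 0) : K.homology n →ₗ[R] M :=
  liftSurj (cls K n) (cls_surjective K n) f (by
    rw [ker_cls]; rintro _ ⟨y, rfl⟩; exact hf y)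

@[simp] theorem homDesc_cls {M : Type*} [AddCommGroup M] [Module R M] (f : cyc K n →ₗ[R] M)
    (hf : ∀ y, f (dCyc K n y) = 0) (x : cyc K n) : homDesc K n f hf (cls K n x) = f x :=
  liftSurj_apply _ _ _ _ _

theorem homology_ext {M : Type*} [AddCommGroup M] [Module R M] {f g : K.homology n →ₗ[R] M}
    (h : ∀ x, f (cls K n x) = g (cls K n x)) : f = g :=
  LinearMap.ext fun y => by obtain ⟨x, rfl⟩ := cls_surjective K n y; exact h x

/-- The connecting homomorphism in terms of elements. -/
theorem δ_cls {S : ShortComplex (ChainComplex (ModuleCat.{u} R) ℕ)} (hS : S.ShortExact)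
    (hij : (ComplexShape.down ℕ).Rel (n + 1) n)
    (x₃ : cyc S.X₃ (n + 1)) (x₂ : S.X₂.X (n + 1)) (h₂ : S.g.f _ x₂ = x₃) (x₁ : cyc S.X₁ n)
    (h₁ : S.f.f n x₁ = S.X₂.d (n + 1) n x₂) :
    hS.δ (n + 1) n hij (cls _ _ x₃) = cls _ _ x₁ := by
  -- The general formula for the connecting map is phrased with a test object. Elements are
  -- recovered as morphisms out of `R`, evaluated at `1`.
  let el {M : ModuleCat.{u} R} (m : M) : ModuleCat.of R R ⟶ M :=
    ModuleCat.ofHom (LinearMap.toSpanSingleton R M m)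
  have e1 {M : ModuleCat.{u} R} (m : M) : el m (1 : R) = m := by simp [el]
  have ext1 {M : ModuleCat.{u} R} (f g : ModuleCat.of R R ⟶ M) (h : f (1 : R) = g (1 : R)) :
      f = g := ModuleCat.hom_ext (LinearMap.ext_ring h)
  have hz : el (x₃ : S.X₃.X (n + 1)) ≫ S.X₃.d (n + 1) n = 0 :=
    ext1 _ _ (by rw [ModuleCat.comp_apply, e1]; exact x₃.2)
  have hg : el x₂ ≫ S.g.f (n + 1) = el (x₃ : S.X₃.X (n + 1)) :=
    ext1 _ _ (by rw [ModuleCat.comp_apply, e1, e1, h₂])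
  have hf : el (x₁ : S.X₁.X n) ≫ S.f.f n = el x₂ ≫ S.X₂.d (n + 1) n :=
    ext1 _ _ (by rw [ModuleCat.comp_apply, ModuleCat.comp_apply, e1, e1, h₁])
  have key := hS.δ_eq (n + 1) n hij (A := ModuleCat.of R R) _ hz _ hg _ hf
    (n - 1) (next_down n)
  have aux (T : ChainComplex (ModuleCat.{u} R) ℕ) (m : ℕ) (x : cyc T m) (k : ℕ)
      (hk : (ComplexShape.down ℕ).next m = k) (h) :
      T.liftCycles (el (x : T.X m)) k hk h (1 : R) = cycLift T m x := by
    apply iCycles_injective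
    rw [← ModuleCat.comp_apply, T.liftCycles_i, iCycles_cycLift, e1]
  have key' := congrArg (fun f => f (1 : R)) key
  change hS.δ (n + 1) n hij (S.X₃.homologyπ (n + 1) (S.X₃.liftCycles _ _ _ hz (1 : R))) =
    S.X₁.homologyπ n (S.X₁.liftCycles (el (x₁ : S.X₁.X n)) _ _ _ (1 : R)) at key'
  rwa [aux S.X₃ (n + 1) x₃ _ _ hz, aux S.X₁ n x₁] at key'

end elements

end Kunneth
end

noncomputable section

namespace Kunneth

open scoped TensorProduct

variable {R : Type u} [CommRing R]

/-! ### Total complexes of first quadrant double complexes -/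

/-- A first quadrant double complex of modules, with commuting differentials. -/
structure DoubleComplex (R : Type u) [CommRing R] where
  X : ℕ → ℕ → ModuleCat.{u} R
  dh : ∀ p q, X (p + 1) q →ₗ[R] X p q
  dv : ∀ p q, X p (q + 1) →ₗ[R] X p q
  dh_dh : ∀ p q x, dh p q (dh (p + 1) q x) = 0
  dv_dv : ∀ p q x, dv p q (dv p (q + 1) x) = 0
  dh_dv : ∀ p q x, dh p q (dv (p + 1) q x) = dv p q (dh p (q + 1) x)

namespace DoubleComplex

/-- Morphisms of double complexes. -/
structure Hom (A B : DoubleComplex R) where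
  f : ∀ p q, A.X p q →ₗ[R] B.X p q
  comm_h : ∀ p q x, f p q (A.dh p q x) = B.dh p q (f (p + 1) q x)
  comm_v : ∀ p q x, f p q (A.dv p q x) = B.dv p q (f p (q + 1) x)

variable (A B : DoubleComplex R)

/-- The pairs of natural numbers with sum `n`. -/
abbrev Idx (n : ℕ) : Type := {a : ℕ × ℕ // a.1 + a.2 = n}

/-- The terms of the total complex. -/
abbrev TotX (n : ℕ) : Type u := ∀ a : Idx n, A.X a.1.1 a.1.2

/-- The differential of the total complex. -/
def totD (n : ℕ) : A.TotX (n + 1) →ₗ[R] A.TotX n :=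
  LinearMap.pi fun a =>
    A.dh a.1.1 a.1.2 ∘ₗ LinearMap.proj (φ := fun b : Idx (n + 1) => A.X b.1.1 b.1.2)
      ⟨(a.1.1 + 1, a.1.2), by have := a.2; simp; omega⟩ +
    (-1 : R) ^ a.1.1 •
      (A.dv a.1.1 a.1.2 ∘ₗ LinearMap.proj (φ := fun b : Idx (n + 1) => A.X b.1.1 b.1.2)
        ⟨(a.1.1, a.1.2 + 1), by have := a.2; simp; omega⟩)

theorem totD_apply {n : ℕ} (x : A.TotX (n + 1)) (p q : ℕ) (h : p + q = n) :
    A.totD n x ⟨(p, q), h⟩ = A.dh p q (x ⟨(p + 1, q), by simp; omega⟩) +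
      (-1 : R) ^ p • A.dv p q (x ⟨(p, q + 1), by simp; omega⟩) := rfl

/-- The two mixed terms are equal since the differentials commute, and they carry the signs `(-1)^p`
and `(-1)^(p+1)`. -/
theorem totD_totD {n : ℕ} (x : A.TotX (n + 2)) : A.totD n (A.totD (n + 1) x) = 0 := by
  funext ⟨⟨p, q⟩, h⟩
  rw [totD_apply, totD_apply, totD_apply]
  simp only [map_add, map_smul, A.dh_dh, A.dv_dv, A.dh_dv, smul_zero, zero_add,
    add_zero, pow_succ]
  simp

/-- The total complex. -/
def tot : ChainComplex (ModuleCat.{u} R) ℕ :=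
  ChainComplex.of (fun n => ModuleCat.of R (A.TotX n)) (fun n => ModuleCat.ofHom (A.totD n))
    fun _ => ModuleCat.hom_ext (LinearMap.ext fun x => A.totD_totD x)

theorem tot_d (n : ℕ) : A.tot.d (n + 1) n = ModuleCat.ofHom (A.totD n) :=
  ChainComplex.of_d (fun n => ModuleCat.of R (A.TotX n)) (fun n => ModuleCat.ofHom (A.totD n)) n

theorem tot_d_apply (n : ℕ) (x : A.TotX (n + 1)) : A.tot.d (n + 1) n x = A.totD n x := by
  rw [tot_d]; rfl

/-- Writing the condition as `p + q + 1 = n` makes it vacuous in degree zero and avoids subtraction.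
-/
theorem mem_cyc_tot {n : ℕ} (x : A.TotX n) : (show A.tot.X n from x) ∈ cyc A.tot n ↔
    ∀ p q (h : p + q + 1 = n), A.dh p q (x ⟨(p + 1, q), by simp; omega⟩) +
      (-1 : R) ^ p • A.dv p q (x ⟨(p, q + 1), by simp; omega⟩) = 0 := by
  cases n with
  | zero => exact ⟨fun _ p q h => by omega, fun _ => mem_cyc_zero _ _⟩
  | succ n =>
    rw [mem_cyc_succ]
    change A.tot.d (n + 1) n x = 0 ↔ _
    rw [tot_d_apply]
    constructor
    · intro h p q hpq
      exact congrFun h ⟨(p, q), by omega⟩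
    · intro h
      funext ⟨⟨p, q⟩, hpq⟩
      exact h p q (by omega)

variable {A B}

/-- The map of total complexes induced by a morphism. -/
def totMap (φ : Hom A B) : A.tot ⟶ B.tot where
  f n := ModuleCat.ofHom (LinearMap.pi fun a : Idx n => φ.f a.1.1 a.1.2 ∘ₗ LinearMap.proj a)
  comm' i j hij := by
    obtain rfl : j + 1 = i := hij
    rw [tot_d, tot_d]
    refine ModuleCat.hom_ext (LinearMap.ext fun x => funext fun ⟨⟨p, q⟩, h⟩ => ?_)
    change B.totD j (fun a => φ.f a.1.1 a.1.2 (x a)) ⟨(p, q), h⟩ = φ.f p q (A.totD j x ⟨(p, q), h⟩)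
    erw [totD_apply, totD_apply, map_add, map_smul, φ.comm_h, φ.comm_v]

/-- A degreewise short exact sequence of double complexes yields a short exact sequence of
total complexes. -/
theorem tot_shortExact {A B C : DoubleComplex R} (φ : Hom A B) (ψ : Hom B C)
    (inj : ∀ p q, Function.Injective (φ.f p q)) (ex : ∀ p q, Function.Exact (φ.f p q) (ψ.f p q))
    (surj : ∀ p q, Function.Surjective (ψ.f p q)) :
    ∃ w : totMap φ ≫ totMap ψ = 0, (ShortComplex.mk (totMap φ) (totMap ψ) w).ShortExact := by
  have w : totMap φ ≫ totMap ψ = 0 := by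
    refine HomologicalComplex.hom_ext _ _ fun n =>
      ModuleCat.hom_ext (LinearMap.ext fun x => funext fun a => ?_)
    exact (ex _ _).apply_apply_eq_zero (x a)
  refine ⟨w, HomologicalComplex.shortExact_of_degreewise_shortExact _ fun n => ?_⟩
  apply ModuleCat.shortComplex_shortExact
  · intro y
    constructor
    · intro h
      have h' : ∀ a : Idx n, ∃ z, φ.f a.1.1 a.1.2 z = (show B.TotX n from y) a := fun a =>
        (ex _ _ _).1 (congrFun h a)
      choose z hz using h'
      exact ⟨z, funext hz⟩
    · rintro ⟨z, rfl⟩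
      funext a
      exact (ex _ _).apply_apply_eq_zero _
  · intro x y h
    funext a
    exact inj _ _ (congrFun h a)
  · intro y
    choose z hz using fun a : Idx n => surj a.1.1 a.1.2 ((show C.TotX n from y) a)
    exact ⟨z, funext hz⟩

end DoubleComplex

open DoubleComplex

/-! ### Tensor products of chain complexes -/

section tensor

variable (C D : ChainComplex (ModuleCat.{u} R) ℕ)

theorem d_comp_d_hom (i j k : ℕ) : (C.d j k).hom ∘ₗ (C.d i j).hom = 0 :=
  LinearMap.ext fun x => d_d_apply C i j k x

/-- The double complex of tensor products. -/
def tensorDouble : DoubleComplex R where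
  X p q := ModuleCat.of R (C.X p ⊗[R] D.X q)
  dh p q := (C.d (p + 1) p).hom.rTensor (D.X q)
  dv p q := (D.d (q + 1) q).hom.lTensor (C.X p)
  dh_dh p q x := by
    rw [← LinearMap.comp_apply, ← LinearMap.rTensor_comp, d_comp_d_hom]; simp
  dv_dv p q x := by
    rw [← LinearMap.comp_apply, ← LinearMap.lTensor_comp, d_comp_d_hom]; simp
  dh_dv p q x := by
    rw [← LinearMap.comp_apply, ← LinearMap.comp_apply, LinearMap.rTensor_comp_lTensor,
      LinearMap.lTensor_comp_rTensor]

/-- The tensor product of chain complexes. -/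
abbrev tens : ChainComplex (ModuleCat.{u} R) ℕ := (tensorDouble C D).tot

variable {C D} {C' D' C'' D'' : ChainComplex (ModuleCat.{u} R) ℕ}

/-- The morphism of double complexes induced by chain maps. -/
def tensorDoubleMap (f : C ⟶ C') (g : D ⟶ D') :
    DoubleComplex.Hom (tensorDouble C D) (tensorDouble C' D') where
  f p q := TensorProduct.map (f.f p).hom (g.f q).hom
  comm_h p q x := by
    change (TensorProduct.map _ _ ∘ₗ LinearMap.rTensor _ _) x =
      (LinearMap.rTensor _ _ ∘ₗ TensorProduct.map _ _) x
    rw [LinearMap.map_comp_rTensor, LinearMap.rTensor_comp_map, ← ModuleCat.hom_comp,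
      ← ModuleCat.hom_comp, f.comm]
  comm_v p q x := by
    change (TensorProduct.map _ _ ∘ₗ LinearMap.lTensor _ _) x =
      (LinearMap.lTensor _ _ ∘ₗ TensorProduct.map _ _) x
    rw [LinearMap.map_comp_lTensor, LinearMap.lTensor_comp_map, ← ModuleCat.hom_comp,
      ← ModuleCat.hom_comp, g.comm]

/-- The map of tensor products induced by chain maps. -/
abbrev tensMap (f : C ⟶ C') (g : D ⟶ D') : tens C D ⟶ tens C' D' := totMap (tensorDoubleMap f g)

theorem tensMap_comp (f : C ⟶ C') (g : D ⟶ D') (f' : C' ⟶ C'') (g' : D' ⟶ D'') :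
    tensMap (f ≫ f') (g ≫ g') = tensMap f g ≫ tensMap f' g' := by
  refine HomologicalComplex.hom_ext _ _ fun n =>
    ModuleCat.hom_ext (LinearMap.ext fun x => funext fun a => ?_)
  exact LinearMap.congr_fun (TensorProduct.map_comp _ _ _ _) (x a)

/-- The tensor product of a chain complex with a module. -/
def rtens (C : ChainComplex (ModuleCat.{u} R) ℕ) (M : ModuleCat.{u} R) :
    ChainComplex (ModuleCat.{u} R) ℕ :=
  ChainComplex.of (fun n => ModuleCat.of R (C.X n ⊗[R] M))
    (fun n => ModuleCat.ofHom ((C.d (n + 1) n).hom.rTensor M)) fun n => by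
      rw [← ModuleCat.ofHom_comp, ← LinearMap.rTensor_comp, d_comp_d_hom]; ext; simp

theorem rtens_d (M : ModuleCat.{u} R) (n : ℕ) : (rtens C M).d (n + 1) n =
    ModuleCat.ofHom ((C.d (n + 1) n).hom.rTensor M) :=
  ChainComplex.of_d (fun n => ModuleCat.of R (C.X n ⊗[R] M))
    (fun n => ModuleCat.ofHom ((C.d (n + 1) n).hom.rTensor M)) n

theorem mem_cyc_rtens (M : ModuleCat.{u} R) {n : ℕ} (x : C.X n ⊗[R] M) :
    (show (rtens C M).X n from x) ∈ cyc (rtens C M) n ↔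
      (C.d n (n - 1)).hom.rTensor M x = 0 := by
  cases n with
  | zero =>
    refine ⟨fun _ => ?_, fun _ => mem_cyc_zero _ _⟩
    rw [C.shape _ _ (by simp)]
    simp
  | succ n => rw [mem_cyc_succ]; change (rtens C M).d (n + 1) n x = 0 ↔ _; rw [rtens_d]; rfl

/-- The map `C ⊗ M ⟶ C' ⊗ M'`. -/
def rtensMap (f : C ⟶ C') {M M' : ModuleCat.{u} R} (g : M ⟶ M') : rtens C M ⟶ rtens C' M' where
  f n := ModuleCat.ofHom (TensorProduct.map (f.f n).hom g.hom)
  comm' i j hij := by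
    obtain rfl : j + 1 = i := hij
    rw [rtens_d, rtens_d]
    refine ModuleCat.hom_ext ?_
    change LinearMap.rTensor _ _ ∘ₗ TensorProduct.map _ _ =
      TensorProduct.map _ _ ∘ₗ LinearMap.rTensor _ _
    rw [LinearMap.map_comp_rTensor, LinearMap.rTensor_comp_map, ← ModuleCat.hom_comp,
      ← ModuleCat.hom_comp, f.comm]

/-- The chain map `c ↦ c ⊗ m`. -/
def tmulRight (M : ModuleCat.{u} R) (m : M) : C ⟶ rtens C M where
  f n := ModuleCat.ofHom ((TensorProduct.mk R (C.X n) M).flip m)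
  comm' i j hij := by
    obtain rfl : j + 1 = i := hij
    rw [rtens_d]
    rfl

variable (C) in
/-- The natural map `H_n(C) ⊗ M → H_n(C ⊗ M)`. -/
def homTens (M : ModuleCat.{u} R) (n : ℕ) : C.homology n ⊗[R] M →ₗ[R] (rtens C M).homology n :=
  TensorProduct.lift (LinearMap.mk₂ R
    (fun h m => HomologicalComplex.homologyMap (tmulRight M m) n h)
    (fun _ _ _ => map_add _ _ _) (fun _ _ _ => map_smul _ _ _)
    (fun h m m' => by
      obtain ⟨x, rfl⟩ := cls_surjective C n h
      rw [homologyMap_cls, homologyMap_cls, homologyMap_cls, ← map_add]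
      congr 1
      exact Subtype.ext (TensorProduct.tmul_add _ _ _))
    (fun c h m => by
      obtain ⟨x, rfl⟩ := cls_surjective C n h
      rw [homologyMap_cls, homologyMap_cls, ← map_smul]
      congr 1
      exact Subtype.ext (TensorProduct.tmul_smul _ _ _)))

theorem rTensor_cyc_mem (M : ModuleCat.{u} R) {n : ℕ} (w : cyc C n ⊗[R] M) :
    (show (rtens C M).X n from (cyc C n).subtype.rTensor M w) ∈ cyc (rtens C M) n := by
  rw [mem_cyc_rtens, ← LinearMap.comp_apply, ← LinearMap.rTensor_comp]
  have : (C.d n (n - 1)).hom ∘ₗ (cyc C n).subtype = 0 := LinearMap.ext fun x => x.2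
  simp [this]

/-- Every element of `H_n(C) ⊗ M` lifts to `Z_n ⊗ M`, and there the comparison map is visible on
representatives. Both halves of the bijectivity below rest on this. -/
theorem homTens_cls (M : ModuleCat.{u} R) {n : ℕ} (w : cyc C n ⊗[R] M) :
    homTens C M n ((cls C n).rTensor M w) =
      cls (rtens C M) n ⟨(cyc C n).subtype.rTensor M w, rTensor_cyc_mem M w⟩ := by
  induction w with
  | zero =>
    rw [map_zero, map_zero, eq_comm, cls_eq_zero_iff]
    exact ⟨0, by rw [map_zero]; exact (map_zero ((cyc C n).subtype.rTensor M)).symm⟩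
  | tmul z m =>
    change HomologicalComplex.homologyMap (tmulRight M m) n (cls C n z) = _
    rw [homologyMap_cls]; rfl
  | add w w' h h' =>
    rw [map_add, map_add, h, h', ← map_add]
    congr 1
    apply Subtype.ext
    exact (map_add ((cyc C n).subtype.rTensor M) w w').symm

/-- Flatness identifies `Z_n ⊗ M` with the cycles of `C ⊗ M`; right exactness of the tensor product
then compares the quotients by boundaries. -/
theorem homTens_bijective (M : ModuleCat.{u} R) [Module.Flat R M] (n : ℕ) :
    Function.Bijective (homTens C M n) := by
  have e1 : Function.Exact (cyc C n).subtype (C.d n (n - 1)).hom :=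
    LinearMap.exact_subtype_ker_map _
  have e2 : Function.Exact (dCyc C n) (cls C n) := fun x => by
    rw [← LinearMap.mem_ker, ker_cls]; rfl
  have i1 : Function.Injective ((cyc C n).subtype.rTensor M) :=
    Module.Flat.rTensor_preserves_injective_linearMap _ (Submodule.subtype_injective _)
  have s1 : Function.Surjective ((cls C n).rTensor M) :=
    LinearMap.rTensor_surjective _ (cls_surjective C n)
  constructor
  · rw [injective_iff_map_eq_zero]
    intro h hh
    obtain ⟨w, rfl⟩ := s1 h
    rw [homTens_cls, cls_eq_zero_iff] at hh
    obtain ⟨y, hy⟩ := hh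
    rw [rtens_d] at hy
    -- The equation is known only in `C_n ⊗ M`; injectivity of `Z_n ⊗ M → C_n ⊗ M` pulls it back.
    have : w = (dCyc C n).rTensor M (show C.X (n + 1) ⊗[R] M from y) := by
      apply i1
      change _ = (LinearMap.rTensor M _ ∘ₗ LinearMap.rTensor M _) _
      rw [← LinearMap.rTensor_comp]
      exact hy.symm
    rw [this]
    exact (rTensor_exact M e2 (cls_surjective C n)).apply_apply_eq_zero _
  · intro y
    obtain ⟨⟨x, hx⟩, rfl⟩ := cls_surjective _ _ y
    obtain ⟨w, hw⟩ := (Module.Flat.rTensor_exact M e1 x).1 ((mem_cyc_rtens M x).1 hx)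
    refine ⟨(cls C n).rTensor M w, ?_⟩
    rw [homTens_cls]
    congr 1
    exact Subtype.ext hw

theorem homTens_natural (f : C ⟶ C') {M M' : ModuleCat.{u} R} (g : M ⟶ M') (n : ℕ)
    (h : C.homology n ⊗[R] M) :
    HomologicalComplex.homologyMap (rtensMap f g) n (homTens C M n h) =
      homTens C' M' n (TensorProduct.map (HomologicalComplex.homologyMap f n).hom g.hom h) := by
  induction h with
  | zero => simp
  | add x y hx hy => simp only [map_add, hx, hy]
  | tmul x m =>
    obtain ⟨z, rfl⟩ := cls_surjective C n x
    change HomologicalComplex.homologyMap (rtensMap f g) n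
        (HomologicalComplex.homologyMap (tmulRight (C := C) M m) n (cls C n z)) =
      HomologicalComplex.homologyMap (tmulRight (C := C') M' (g m)) n
        (HomologicalComplex.homologyMap f n (cls C n z))
    rw [homologyMap_cls, homologyMap_cls, homologyMap_cls, homologyMap_cls]
    rfl

end tensor

end Kunneth
end

noncomputable section

namespace Kunneth

open scoped TensorProduct

variable {R : Type u} [CommRing R]

/-! ### `Tor₁` in terms of a two-term resolution -/

section embed

variable (K : ChainComplex (ModuleCat.{u} R) ℕ) {n : ℕ} (h : K.d (n + 1) n = 0)

/-- The homology of a complex in a degree where all boundaries vanish consists of cycles. -/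
def homEmb : K.homology n →ₗ[R] K.X n :=
  homDesc K n (cyc K n).subtype fun y => by
    rw [Submodule.subtype_apply, dCyc_coe, h]; rfl

theorem homEmb_cls (x : cyc K n) : homEmb K h (cls K n x) = x := homDesc_cls _ _ _

theorem homEmb_injective : Function.Injective (homEmb K h) := by
  intro a b hab
  obtain ⟨x, rfl⟩ := cls_surjective K n a
  obtain ⟨y, rfl⟩ := cls_surjective K n b
  rw [homEmb_cls, homEmb_cls] at hab
  rw [Subtype.ext hab]

theorem range_homEmb : LinearMap.range (homEmb K h) = cyc K n := by
  ext x
  constructor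
  · rintro ⟨y, rfl⟩
    obtain ⟨y, rfl⟩ := cls_surjective K n y
    rw [homEmb_cls]
    exact y.2
  · intro hx
    exact ⟨cls K n ⟨x, hx⟩, homEmb_cls _ _ _⟩

theorem homEmb_homologyMap {L : ChainComplex (ModuleCat.{u} R) ℕ} (h' : L.d (n + 1) n = 0)
    (f : K ⟶ L) (x : K.homology n) :
    homEmb L h' (HomologicalComplex.homologyMap f n x) = f.f n (homEmb K h x) := by
  obtain ⟨x, rfl⟩ := cls_surjective K n x
  rw [homologyMap_cls, homEmb_cls, homEmb_cls]
  rfl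

end embed

section twoTerm

variable (S S' : ShortComplex (ModuleCat.{u} R))

/-- The terms of `twoTerm`. -/
def twoTermX : ℕ → ModuleCat.{u} R
  | 0 => S.X₂
  | 1 => S.X₁
  | _ + 2 => ModuleCat.of R PUnit

/-- The differentials of `twoTerm`. -/
def twoTermD : ∀ n, twoTermX S (n + 1) ⟶ twoTermX S n
  | 0 => S.f
  | _ + 1 => 0

/-- The chain complex `S.X₁ ⟶ S.X₂` in degrees one and zero. -/
def twoTerm : ChainComplex (ModuleCat.{u} R) ℕ :=
  ChainComplex.of (twoTermX S) (twoTermD S) fun n => by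
    cases n <;> exact zero_comp

theorem twoTerm_d (n : ℕ) : (twoTerm S).d (n + 1) n = twoTermD S n :=
  ChainComplex.of_d (twoTermX S) (twoTermD S) n

variable {S S'}

/-- The chain map induced by a morphism of short complexes. -/
def twoTermMap (φ : S ⟶ S') : twoTerm S ⟶ twoTerm S' where
  f
    | 0 => φ.τ₂
    | 1 => φ.τ₁
    | _ + 2 => 0
  comm' i j hij := by
    obtain rfl : j + 1 = i := hij
    rw [twoTerm_d, twoTerm_d]
    match j with
    | 0 => exact φ.comm₁₂
    | _ + 1 => exact comp_zero.trans zero_comp.symm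

theorem twoTerm_d_comp_g : (twoTerm S).d 1 0 ≫ (show (twoTerm S).X 0 ⟶ S.X₃ from S.g) = 0 := by
  rw [twoTerm_d]; exact S.zero

variable (S) in
/-- The augmentation of `twoTerm S`. -/
def twoTermπ : twoTerm S ⟶ (ChainComplex.single₀ _).obj S.X₃ :=
  (ChainComplex.toSingle₀Equiv (twoTerm S) S.X₃).symm ⟨S.g, twoTerm_d_comp_g⟩

theorem twoTermπ_f_zero : (twoTermπ S).f 0 = S.g :=
  ChainComplex.toSingle₀Equiv_symm_apply_f_zero (C := twoTerm S) S.g twoTerm_d_comp_g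

/-- The projective resolution of `S.X₃` given by a short exact sequence. -/
def twoTermResolution (hS : S.ShortExact) (h₁ : Projective S.X₁) (h₂ : Projective S.X₂) :
    ProjectiveResolution S.X₃ where
  complex := twoTerm S
  projective n := by
    match n with
    | 0 => exact h₂
    | 1 => exact h₁
    | n + 2 =>
      exact (ModuleCat.isZero_of_subsingleton (ModuleCat.of R PUnit.{u + 1})).projective
  π := twoTermπ S
  quasiIso := ⟨fun n => by
    cases n with
    | zero =>
      have hz : (twoTerm S).d 0 0 = 0 := (twoTerm S).shape _ _ (by simp)
      rw [ChainComplex.quasiIsoAt₀_iff, ShortComplex.quasiIso_iff_of_zeros' _ hz rfl rfl]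
      constructor
      · rw [ShortComplex.moduleCat_exact_iff]
        intro x hx
        obtain ⟨y, hy⟩ := (ShortComplex.moduleCat_exact_iff _).1 hS.exact x (by
          change (twoTermπ S).f 0 x = 0 at hx
          rwa [twoTermπ_f_zero] at hx)
        refine ⟨y, ?_⟩
        change (twoTerm S).d 1 0 y = x
        rw [twoTerm_d]
        exact hy
      · change Epi ((twoTermπ S).f 0)
        rw [twoTermπ_f_zero]
        exact hS.epi_g
    | succ n =>
      rw [quasiIsoAt_iff_exactAt' (hL := ChainComplex.exactAt_succ_single_obj ..),
        HomologicalComplex.exactAt_iff_isZero_homology]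
      apply @ModuleCat.isZero_of_subsingleton _ _ _ ⟨fun a b => ?_⟩
      obtain ⟨x, rfl⟩ := cls_surjective _ _ a
      obtain ⟨y, rfl⟩ := cls_surjective _ _ b
      congr 1
      apply Subtype.ext
      cases n with
      | zero =>
        -- A cycle in degree one lies in the kernel of `S.f`, which is injective.
        have hx := x.2
        have hy := y.2
        rw [mem_cyc_succ, twoTerm_d] at hx hy
        exact hS.moduleCat_injective_f (hx.trans hy.symm)
      | succ n => exact @Subsingleton.elim PUnit _ _ _⟩

variable (M : ModuleCat.{u} R)

/-- The complex `M ⊗ S.X₁ ⟶ M ⊗ S.X₂`. -/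
abbrev twoTermTens (S : ShortComplex (ModuleCat.{u} R)) : ChainComplex (ModuleCat.{u} R) ℕ :=
  (((tensoringLeft (ModuleCat.{u} R)).obj M).mapHomologicalComplex _).obj (twoTerm S)

/-- With no boundaries in degree one, the homology there is a submodule of `M ⊗ S.X₁`, so torsion
classes can be handled as elements. -/
theorem twoTermTens_d_two (S : ShortComplex (ModuleCat.{u} R)) :
    (twoTermTens M S).d (1 + 1) 1 = 0 := by
  change M ◁ ((twoTerm S).d (1 + 1) 1) = 0
  rw [twoTerm_d]
  exact MonoidalPreadditive.whiskerLeft_zero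

/-- The embedding of `Tor₁(M, S.X₃)` in `M ⊗ S.X₁`. -/
def torEmb (hS : S.ShortExact) (h₁ : Projective S.X₁) (h₂ : Projective S.X₂) :
    tor₁ M S.X₃ →ₗ[R] M ⊗[R] S.X₁ :=
  homEmb (twoTermTens M S) (twoTermTens_d_two M S) ∘ₗ
    ((twoTermResolution hS h₁ h₂).isoLeftDerivedObj
      ((tensoringLeft (ModuleCat.{u} R)).obj M) 1).hom.hom

variable (hS : S.ShortExact) (h₁ : Projective S.X₁) (h₂ : Projective S.X₂)

theorem torEmb_injective : Function.Injective (torEmb M hS h₁ h₂) :=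
  (homEmb_injective _ (twoTermTens_d_two M S)).comp
    ((ModuleCat.mono_iff_injective _).1 inferInstance)

theorem range_torEmb :
    LinearMap.range (torEmb M hS h₁ h₂) = LinearMap.ker (S.f.hom.lTensor M) := by
  have hs : Function.Surjective ((twoTermResolution hS h₁ h₂).isoLeftDerivedObj
      ((tensoringLeft (ModuleCat.{u} R)).obj M) 1).hom :=
    (ModuleCat.epi_iff_surjective _).1 inferInstance
  ext x
  have key : x ∈ LinearMap.range (homEmb (twoTermTens M S) (twoTermTens_d_two M S)) ↔
      S.f.hom.lTensor M x = 0 := by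
    rw [range_homEmb]
    change (M ◁ ((twoTerm S).d 1 0)).hom x = 0 ↔ _
    rw [twoTerm_d]
    rfl
  rw [LinearMap.mem_ker, ← key]
  constructor
  · rintro ⟨y, rfl⟩; exact ⟨_, rfl⟩
  · rintro ⟨y, rfl⟩
    obtain ⟨z, rfl⟩ := hs y
    exact ⟨z, rfl⟩

/-- Naturality in the second variable is the comparison of resolutions along `twoTermMap`, and in
the first it is the action of a natural transformation on derived functors. Both are computed by one
chain map of two-term complexes. -/
theorem torEmb_natural (hS' : S'.ShortExact) (h₁' : Projective S'.X₁) (h₂' : Projective S'.X₂)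
    (φ : S ⟶ S') {M M' : ModuleCat.{u} R} (f : M ⟶ M') (t : tor₁ M S.X₃) :
    torEmb M' hS' h₁' h₂' (tor₁Map f φ.τ₃ t) =
      TensorProduct.map f.hom φ.τ₁.hom (torEmb M hS h₁ h₂ t) := by
  have e1 := (twoTermResolution hS h₁ h₂).leftDerived_app_eq ((tensoringLeft _).map f) 1
  have e2 := ProjectiveResolution.isoLeftDerivedObj_hom_naturality φ.τ₃
    (twoTermResolution hS h₁ h₂) (twoTermResolution hS' h₁' h₂') (twoTermMap φ) (by
      change φ.τ₂ ≫ (twoTermπ S').f 0 = (twoTermπ S).f 0 ≫ φ.τ₃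
      rw [twoTermπ_f_zero, twoTermπ_f_zero]
      exact φ.comm₂₃) ((tensoringLeft (ModuleCat.{u} R)).obj M') 1
  have e3 : tor₁Map f φ.τ₃ ≫ ((twoTermResolution hS' h₁' h₂').isoLeftDerivedObj
      ((tensoringLeft (ModuleCat.{u} R)).obj M') 1).hom =
      ((twoTermResolution hS h₁ h₂).isoLeftDerivedObj
      ((tensoringLeft (ModuleCat.{u} R)).obj M) 1).hom ≫
      HomologicalComplex.homologyMap ((NatTrans.mapHomologicalComplex
        ((tensoringLeft _).map f) _).app (twoTerm S) ≫
        (((tensoringLeft (ModuleCat.{u} R)).obj M').mapHomologicalComplex _).map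
          (twoTermMap φ)) 1 := by
    rw [HomologicalComplex.homologyMap_comp]
    change ((NatTrans.leftDerived ((tensoringLeft _).map f) 1).app S.X₃ ≫
      (((tensoringLeft (ModuleCat.{u} R)).obj M').leftDerived 1).map φ.τ₃) ≫ _ = _
    rw [Category.assoc, e2, e1]
    simp only [Category.assoc, Iso.inv_hom_id_assoc]
    rfl
  have e4 := congrArg (fun g => g.hom t) e3
  change homEmb _ (twoTermTens_d_two M' S') ((tor₁Map f φ.τ₃ ≫
    ((twoTermResolution hS' h₁' h₂').isoLeftDerivedObj _ 1).hom).hom t) = _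
  rw [e4]
  refine (homEmb_homologyMap _ (twoTermTens_d_two M S) (twoTermTens_d_two M' S') _ _).trans ?_
  change (M' ◁ φ.τ₁).hom ((f ▷ S.X₁).hom _) = _
  change (LinearMap.lTensor _ _ ∘ₗ LinearMap.rTensor _ _) _ = _
  rw [LinearMap.lTensor_comp_rTensor]
  rfl

/-- `Tor₁(M, S.X₃)` vanishes if and only if `M ⊗ S.X₁ → M ⊗ S.X₂` is injective. -/
theorem isZero_tor₁_iff (hS : S.ShortExact) (h₁ : Projective S.X₁) (h₂ : Projective S.X₂) :
    IsZero (tor₁ M S.X₃) ↔ Function.Injective (S.f.hom.lTensor M) := by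
  rw [← LinearMap.ker_eq_bot, ← range_torEmb M hS h₁ h₂]
  constructor
  · intro h
    have := ModuleCat.subsingleton_of_isZero h
    rw [LinearMap.range_eq_bot]
    exact LinearMap.ext fun x => by rw [Subsingleton.elim x 0, map_zero, map_zero]
  · intro h
    apply @ModuleCat.isZero_of_subsingleton _ _ _ ⟨fun a b => torEmb_injective M hS h₁ h₂ ?_⟩
    rw [LinearMap.range_eq_bot] at h
    rw [h]; rfl

end twoTerm

end Kunneth
end

noncomputable section

namespace Kunneth

open scoped TensorProduct

variable {R : Type u} [CommRing R]

/-! ### Submodules of projective modules over a principal ideal domain -/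

section hereditary

variable [IsDomain R] [IsPrincipalIdealRing R]

/-- Over a principal ideal domain, quotients of injective modules are injective. -/
theorem injective_of_surjective {J Q : Type u} [AddCommGroup J] [Module R J] [AddCommGroup Q]
    [Module R Q] (hJ : Module.Baer R J) (f : J →ₗ[R] Q) (hf : Function.Surjective f) :
    Module.Baer R Q := by
  intro I g
  obtain ⟨a, rfl⟩ := (IsPrincipalIdealRing.principal I).principal
  have ha : a ∈ Submodule.span R {a} := Submodule.mem_span_singleton_self a
  obtain ⟨y, hy⟩ := hf (g ⟨a, ha⟩)
  by_cases h0 : a = 0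
  · refine ⟨0, fun x hx => ?_⟩
    have : (⟨x, hx⟩ : Submodule.span R {a}) = 0 := by
      subst h0
      simpa using hx
    rw [this, map_zero]; rfl
  -- For `a ≠ 0` the ideal is free on `a`. The map sending `a` to the preimage `y` of `g a` extends
  -- to `R` because `J` is injective, and its composite with `f` extends `g`.
  · let e := LinearEquiv.toSpanNonzeroSingleton R R a h0
    obtain ⟨k, hk⟩ := hJ (Submodule.span R {a}) (LinearMap.toSpanSingleton R J y ∘ₗ e.symm)
    refine ⟨f ∘ₗ k, fun x hx => ?_⟩
    obtain ⟨r, rfl⟩ := Submodule.mem_span_singleton.1 hx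
    have e1 : e r = ⟨r • a, hx⟩ := rfl
    rw [LinearMap.comp_apply, hk _ hx, ← e1]
    change f (LinearMap.toSpanSingleton R J y (e.symm (e r))) = _
    rw [e.symm_apply_apply, LinearMap.toSpanSingleton_apply, map_smul, hy, ← map_smul]
    rfl

/-- Over a principal ideal domain, submodules of projective modules are projective. -/
theorem projective_of_injective {N P : Type u} [AddCommGroup N] [Module R N] [AddCommGroup P]
    [Module R P] [Module.Projective R P] (i : N →ₗ[R] P) (hi : Function.Injective i) :
    Module.Projective R N := by
  refine Module.Projective.of_lifting_property'' fun f hf => ?_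
  -- To split `f`, its free source is embedded in an injective `J`. The quotient of `J` by the image
  -- of `ker f` is again injective and receives `N`. The map from `N` extends to `P`, and the
  -- extension lifts to `J` because `P` is projective.
  obtain ⟨J, hJ, j, hj⟩ : ∃ (J : ModuleCat.{u} R) (_ : Module.Baer R J)
      (j : (N →₀ R) →ₗ[R] J), Function.Injective j :=
    ⟨Injective.under (ModuleCat.of R (N →₀ R)),
      Module.Baer.of_injective ((Module.injective_iff_injective_object R _).2
        (Injective.injective_under (ModuleCat.of R (N →₀ R)))),
      (Injective.ι (ModuleCat.of R (N →₀ R))).hom,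
      (ModuleCat.mono_iff_injective _).1 inferInstance⟩
  let K : Submodule R J := (LinearMap.ker f).map j
  have hQ := injective_of_surjective hJ K.mkQ K.mkQ_surjective
  let g : N →ₗ[R] J ⧸ K := liftSurj f hf (K.mkQ ∘ₗ j) (by
    intro x hx
    rw [LinearMap.mem_ker, LinearMap.comp_apply, Submodule.mkQ_apply,
      Submodule.Quotient.mk_eq_zero]
    exact ⟨x, hx, rfl⟩)
  obtain ⟨g', hg'⟩ := Module.Baer.extension_property hQ i hi g
  obtain ⟨l, hl⟩ := Module.projective_lifting_property K.mkQ g' K.mkQ_surjective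
  -- Modulo `j (ker f)` the lift agrees with `j`, so on `N` it takes values in the image of `j`, and
  -- more precisely in `j` of preimages under `f`. Dividing by `j` yields the section.
  have key : ∀ n x, f x = n → ∃ k, f k = 0 ∧ l (i n) = j (x + k) := by
    rintro n x rfl
    have h1 : K.mkQ (l (i (f x))) = K.mkQ (j x) := by
      rw [← LinearMap.comp_apply, hl, ← LinearMap.comp_apply, hg']
      exact liftSurj_apply _ _ _ _ _
    have h2 : l (i (f x)) - j x ∈ K := by
      rw [← Submodule.Quotient.mk_eq_zero, Submodule.Quotient.mk_sub, sub_eq_zero]; exact h1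
    obtain ⟨k, hk, hk'⟩ := h2
    exact ⟨k, hk, by rw [map_add, hk']; abel⟩
  refine ⟨liftInj j hj (l ∘ₗ i) fun n => ?_, LinearMap.ext fun n => ?_⟩
  · obtain ⟨x, hx⟩ := hf n
    obtain ⟨k, -, hk⟩ := key n x hx
    exact ⟨_, hk.symm⟩
  · obtain ⟨x, hx⟩ := hf n
    obtain ⟨k, hk0, hk⟩ := key n x hx
    have : liftInj j hj (l ∘ₗ i) (fun n => by
        obtain ⟨x, hx⟩ := hf n
        obtain ⟨k, -, hk⟩ := key n x hx
        exact ⟨_, hk.symm⟩) n = x + k := hj (by rw [liftInj_apply]; exact hk)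
    rw [LinearMap.comp_apply, this, map_add, hk0, add_zero, hx]; rfl

instance (P : Type u) [AddCommGroup P] [Module R P] [Module.Projective R P]
    (N : Submodule R P) : Module.Projective R N :=
  projective_of_injective N.subtype N.subtype_injective

end hereditary

open DoubleComplex

/-! ### Tensor products with a complex with zero differentials -/

section graded

/-- The chain complex with given terms and zero differentials. -/
def gr (Z : ℕ → ModuleCat.{u} R) : ChainComplex (ModuleCat.{u} R) ℕ where
  X := Z
  d _ _ := 0

variable {Z Z' : ℕ → ModuleCat.{u} R} {C C' : ChainComplex (ModuleCat.{u} R) ℕ} {n : ℕ}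

/-- The map of complexes with zero differentials induced by a family of maps. -/
def grMap (g : ∀ j, Z j ⟶ Z' j) : gr Z ⟶ gr Z' where
  f := g
  comm' _ _ _ := comp_zero.trans zero_comp.symm

theorem totD_gr (x : (tensorDouble C (gr Z)).TotX (n + 1)) (p q : ℕ) (h : p + q = n) :
    (tensorDouble C (gr Z)).totD n x ⟨(p, q), h⟩ =
      (C.d (p + 1) p).hom.rTensor (Z q) (x ⟨(p + 1, q), by simp; omega⟩) := by
  have hv : (tensorDouble C (gr Z)).dv p q = 0 := LinearMap.lTensor_zero _
  rw [totD_apply, hv, LinearMap.zero_apply, smul_zero, add_zero]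
  rfl

theorem mem_cyc_gr (x : (tensorDouble C (gr Z)).TotX n) :
    (show (tens C (gr Z)).X n from x) ∈ cyc (tens C (gr Z)) n ↔
      ∀ a : Idx n, (C.d a.1.1 (a.1.1 - 1)).hom.rTensor (Z a.1.2) (x a) = 0 := by
  have key : ∀ p q (h : p + q + 1 = n),
      (tensorDouble C (gr Z)).dh p q (x ⟨(p + 1, q), by simp; omega⟩) +
      (-1 : R) ^ p • (tensorDouble C (gr Z)).dv p q (x ⟨(p, q + 1), by simp; omega⟩) =
      (C.d (p + 1) p).hom.rTensor (Z q) (x ⟨(p + 1, q), by simp; omega⟩) := fun p q h => by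
    have hv : (tensorDouble C (gr Z)).dv p q = 0 := LinearMap.lTensor_zero _
    rw [hv, LinearMap.zero_apply, smul_zero, add_zero]
    rfl
  refine (mem_cyc_tot _ x).trans ⟨fun h => ?_, fun h p q hpq => ?_⟩
  · rintro ⟨⟨p, q⟩, hpq⟩
    cases p with
    | zero =>
      have : (C.d 0 (0 - 1)).hom = 0 := by rw [C.shape _ _ (by simp)]; rfl
      exact LinearMap.congr_fun ((congrArg (LinearMap.rTensor (Z q)) this).trans
        (LinearMap.rTensor_zero _)) _
    | succ p => 
      have hpq' : p + q + 1 = n := by rw [← hpq]; change p + q + 1 = p + 1 + q; omega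
      exact (key p q hpq').symm.trans (h p q hpq')
  · exact (key p q hpq).trans (h ⟨(p + 1, q), by simp; omega⟩)

/-- The components of a cycle of `C ⊗ Z`, where `Z` has zero differentials. -/
def rowCyc (C : ChainComplex (ModuleCat.{u} R) ℕ) (Z : ℕ → ModuleCat.{u} R) (a : Idx n) :
    cyc (tens C (gr Z)) n →ₗ[R] cyc (rtens C (Z a.1.2)) a.1.1 where
  toFun x := ⟨(x.1 : (tensorDouble C (gr Z)).TotX n) a,
    (mem_cyc_rtens _ _).2 ((mem_cyc_gr x.1).1 x.2 a)⟩
  map_add' _ _ := rfl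
  map_smul' _ _ := rfl

theorem cls_rowCyc_dCyc (a : Idx n) (y : (tens C (gr Z)).X (n + 1)) :
    cls (rtens C (Z a.1.2)) a.1.1 (rowCyc C Z a (dCyc (tens C (gr Z)) n y)) = 0 := by
  refine (cls_eq_zero_iff _ _).2 ?_
  obtain ⟨⟨p, q⟩, h⟩ := a
  refine ⟨(y : (tensorDouble C (gr Z)).TotX (n + 1))
    ⟨(p + 1, q), by simp at h ⊢; omega⟩, ?_⟩
  refine (ConcreteCategory.congr_hom (rtens_d (Z q) p) _).trans ?_
  refine (totD_gr y p q h).symm.trans ?_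
  exact (congrFun (tot_d_apply (tensorDouble C (gr Z)) n y) ⟨(p, q), h⟩).symm

/-- The components of the homology of `C ⊗ Z`, where `Z` has zero differentials. -/
def rowMap (C : ChainComplex (ModuleCat.{u} R) ℕ) (Z : ℕ → ModuleCat.{u} R) (n : ℕ) :
    (tens C (gr Z)).homology n →ₗ[R] ∀ a : Idx n, (rtens C (Z a.1.2)).homology a.1.1 :=
  LinearMap.pi fun a => homDesc _ _ (cls (rtens C (Z a.1.2)) a.1.1 ∘ₗ rowCyc C Z a)
    (cls_rowCyc_dCyc a)

theorem rowMap_cls (x : cyc (tens C (gr Z)) n) (a : Idx n) :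
    rowMap C Z n (cls (tens C (gr Z)) n x) a =
      cls (rtens C (Z a.1.2)) a.1.1 (rowCyc C Z a x) :=
  homDesc_cls _ (cls_rowCyc_dCyc a) _

/-- Without a vertical differential the total complex is the direct sum of the complexes `C ⊗ Z_j`,
shifted by `j`. -/
theorem rowMap_bijective (C : ChainComplex (ModuleCat.{u} R) ℕ) (Z : ℕ → ModuleCat.{u} R)
    (n : ℕ) : Function.Bijective (rowMap C Z n) := by
  constructor
  · rw [injective_iff_map_eq_zero]
    intro y hy
    obtain ⟨x, rfl⟩ := cls_surjective _ _ y
    have h1 : ∀ a : Idx n, ∃ w : C.X (a.1.1 + 1) ⊗[R] Z a.1.2,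
        (C.d (a.1.1 + 1) a.1.1).hom.rTensor (Z a.1.2) w =
          (x.1 : (tensorDouble C (gr Z)).TotX n) a := fun a => by
      obtain ⟨w, hw⟩ := (cls_eq_zero_iff _ _).1 ((rowMap_cls x a).symm.trans (congrFun hy a))
      exact ⟨w, (ConcreteCategory.congr_hom (rtens_d (Z a.1.2) a.1.1) w).symm.trans hw⟩
    choose w hw using h1
    rw [cls_eq_zero_iff]
    -- A component with first index zero does not affect the boundary: no horizontal differential
    -- leaves it, and the vertical one is zero.
    let v : (tensorDouble C (gr Z)).TotX (n + 1) := fun a => match a with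
      | ⟨(0, _), _⟩ => 0
      | ⟨(p + 1, q), h⟩ => w ⟨(p, q), by simp at h ⊢; omega⟩
    refine ⟨v, ?_⟩
    refine (tot_d_apply _ n v).trans ?_
    funext ⟨⟨p, q⟩, h⟩
    exact (totD_gr v p q h).trans (hw ⟨(p, q), h⟩)
  · intro y
    choose x hx using fun a => cls_surjective _ _ (y a)
    let x' : (tensorDouble C (gr Z)).TotX n := fun a => (x a : (rtens C (Z a.1.2)).X a.1.1)
    refine ⟨cls _ _ ⟨x', (mem_cyc_gr x').2 fun a => (mem_cyc_rtens _ _).1 (x a).2⟩, ?_⟩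
    funext a
    exact (rowMap_cls _ a).trans (hx a)

theorem rowMap_natural (f : C ⟶ C') (g : ∀ j, Z j ⟶ Z' j)
    (x : (tens C (gr Z)).homology n) (a : Idx n) :
    rowMap C' Z' n (HomologicalComplex.homologyMap (tensMap f (grMap g)) n x) a =
      HomologicalComplex.homologyMap (rtensMap f (g a.1.2)) a.1.1 (rowMap C Z n x a) := by
  obtain ⟨x, rfl⟩ := cls_surjective _ _ x
  refine (congrFun (congrArg (rowMap C' Z' n) (homologyMap_cls _ x)) a).trans ?_
  refine (rowMap_cls _ a).trans ?_
  rw [rowMap_cls, homologyMap_cls]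
  rfl

variable [∀ j, Module.Flat R (Z j)] [∀ j, Module.Flat R (Z' j)]

/-- `H_n(C ⊗ Z) = ⨁ H_i(C) ⊗ Z_j` if `Z` has flat terms and zero differentials. -/
def rowEquiv (C : ChainComplex (ModuleCat.{u} R) ℕ) (Z : ℕ → ModuleCat.{u} R)
    [∀ j, Module.Flat R (Z j)] (n : ℕ) :
    (∀ a : Idx n, C.homology a.1.1 ⊗[R] Z a.1.2) ≃ₗ[R] (tens C (gr Z)).homology n :=
  (LinearEquiv.piCongrRight fun a : Idx n =>
    LinearEquiv.ofBijective (homTens C (Z a.1.2) a.1.1) (homTens_bijective _ _)).trans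
  (LinearEquiv.ofBijective (rowMap C Z n) (rowMap_bijective C Z n)).symm

theorem rowMap_rowEquiv (y : ∀ a : Idx n, C.homology a.1.1 ⊗[R] Z a.1.2) (a : Idx n) :
    rowMap C Z n (rowEquiv C Z n y) a = homTens C (Z a.1.2) a.1.1 (y a) :=
  congrFun (LinearEquiv.apply_symm_apply
    (LinearEquiv.ofBijective (rowMap C Z n) (rowMap_bijective C Z n)) _) a

theorem rowEquiv_natural (f : C ⟶ C') (g : ∀ j, Z j ⟶ Z' j)
    (y : ∀ a : Idx n, C.homology a.1.1 ⊗[R] Z a.1.2) :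
    HomologicalComplex.homologyMap (tensMap f (grMap g)) n (rowEquiv C Z n y) =
      rowEquiv C' Z' n fun a =>
        TensorProduct.map (HomologicalComplex.homologyMap f a.1.1).hom (g a.1.2).hom (y a) := by
  apply (rowMap_bijective C' Z' n).1
  funext a
  rw [rowMap_natural, rowMap_rowEquiv, rowMap_rowEquiv, homTens_natural]

end graded

end Kunneth
end

noncomputable section

namespace Kunneth

open scoped TensorProduct
open DoubleComplex HomologicalComplex

variable {R : Type u} [CommRing R]

/-! ### The algebraic Künneth sequence -/

theorem rTensor_lTensor_apply {M N P Q : Type*} [AddCommGroup M] [AddCommGroup N] [AddCommGroup P]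
    [AddCommGroup Q] [Module R M] [Module R N] [Module R P] [Module R Q] (f : M →ₗ[R] N)
    (g : P →ₗ[R] Q) (x : M ⊗[R] P) :
    f.rTensor Q (g.lTensor M x) = g.lTensor N (f.rTensor P x) := by
  rw [← LinearMap.comp_apply, ← LinearMap.comp_apply, LinearMap.rTensor_comp_lTensor,
    LinearMap.lTensor_comp_rTensor]

theorem map_lTensor_apply {M M' A A' B B' : Type*} [AddCommGroup M] [Module R M]
    [AddCommGroup M'] [Module R M'] [AddCommGroup A] [Module R A] [AddCommGroup A'] [Module R A']
    [AddCommGroup B] [Module R B] [AddCommGroup B'] [Module R B'] (f : M →ₗ[R] M')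
    (b : B →ₗ[R] B') (p : A →ₗ[R] B) (p' : A' →ₗ[R] B') (a : A →ₗ[R] A')
    (h : b ∘ₗ p = p' ∘ₗ a) (x : M ⊗[R] A) :
    TensorProduct.map f b (p.lTensor M x) = p'.lTensor M' (TensorProduct.map f a x) := by
  rw [← LinearMap.comp_apply, ← LinearMap.comp_apply, LinearMap.map_comp_lTensor,
    LinearMap.lTensor_comp_map, h]

theorem map_lTensor_of_comp_eq {A P B Q Z : Type*} [AddCommGroup A] [Module R A]
    [AddCommGroup P] [Module R P] [AddCommGroup B] [Module R B] [AddCommGroup Q] [Module R Q]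
    [AddCommGroup Z] [Module R Z] (p : A →ₗ[R] P) (q : B →ₗ[R] Q) (i : Z →ₗ[R] B) (c : Z →ₗ[R] Q)
    (h : q ∘ₗ i = c) (b : A ⊗[R] Z) :
    TensorProduct.map p q (i.lTensor A b) = c.lTensor P (p.rTensor Z b) := by
  rw [← LinearMap.comp_apply, ← LinearMap.comp_apply, LinearMap.map_comp_lTensor,
    LinearMap.lTensor_comp_rTensor, h]

/-! ### Cycles, boundaries and homology of the second factor -/

section cycles

variable (D : ChainComplex (ModuleCat.{u} R) ℕ)

/-- The modules of cycles. -/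
def zc (j : ℕ) : ModuleCat.{u} R := ModuleCat.of R (cyc D j)

/-- The images of the differentials, indexed by their sources. -/
def bd (j : ℕ) : ModuleCat.{u} R := ModuleCat.of R (LinearMap.range (D.d j (j - 1)).hom)

/-- The inclusion of boundaries in cycles. -/
def bdInc (j : ℕ) : bd D (j + 1) ⟶ zc D j :=
  ModuleCat.ofHom (Submodule.inclusion (show LinearMap.range (D.d (j + 1) j).hom ≤ cyc D j by
    rintro _ ⟨y, rfl⟩; exact d_mem_cyc D j _ y))

/-- The projection of cycles onto homology. -/
def zcCls (j : ℕ) : zc D j ⟶ D.homology j := ModuleCat.ofHom (cls D j)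

theorem bdInc_exact (j : ℕ) : Function.Exact (bdInc D j).hom (zcCls D j).hom := fun x => by
  refine (cls_eq_zero_iff D j).trans ⟨?_, ?_⟩
  · rintro ⟨y, hy⟩
    exact ⟨⟨_, ⟨y, rfl⟩⟩, Subtype.ext hy⟩
  · rintro ⟨⟨_, ⟨y, rfl⟩⟩, rfl⟩
    exact ⟨y, rfl⟩

theorem zcCls_surjective (j : ℕ) : Function.Surjective (zcCls D j) := cls_surjective D j

theorem bdInc_injective (j : ℕ) : Function.Injective (bdInc D j) :=
  fun _ _ h => Subtype.ext (congrArg (fun z : zc D j => (z : cyc D j).1) h)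

/-- Boundaries, cycles and homology. -/
def homSeq (j : ℕ) : ShortComplex (ModuleCat.{u} R) :=
  ShortComplex.mk (bdInc D j) (zcCls D j)
    (ModuleCat.hom_ext (LinearMap.ext fun x => (bdInc_exact D j).apply_apply_eq_zero x))

theorem homSeq_shortExact (j : ℕ) : (homSeq D j).ShortExact :=
  ModuleCat.shortComplex_shortExact _ (bdInc_exact D j) (bdInc_injective D j)
    (zcCls_surjective D j)

/-- The inclusion of the cycles. -/
def incZc : gr (zc D) ⟶ D where
  f j := ModuleCat.ofHom (cyc D j).subtype
  comm' i j hij := by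
    obtain rfl : j + 1 = i := hij
    refine ModuleCat.hom_ext (LinearMap.ext fun x => ?_)
    exact mem_cyc_succ.1 x.2

/-- The projection to the boundaries. -/
def prjBd : D ⟶ gr (bd D) where
  f j := ModuleCat.ofHom (D.d j (j - 1)).hom.rangeRestrict
  comm' i j hij := by
    obtain rfl : j + 1 = i := hij
    refine ModuleCat.hom_ext (LinearMap.ext fun x => ?_)
    exact (Subtype.ext (d_d_apply D (j + 1) j (j - 1) x)).symm

variable {D} {D' : ChainComplex (ModuleCat.{u} R) ℕ} (g : D ⟶ D')

/-- The map induced on cycles. -/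
def zcMap (j : ℕ) : zc D j ⟶ zc D' j := ModuleCat.ofHom (cycMap g j)

/-- The map induced on boundaries. -/
def bdMap (j : ℕ) : bd D j ⟶ bd D' j :=
  ModuleCat.ofHom ((g.f (j - 1)).hom.restrict (by
    rintro _ ⟨y, rfl⟩
    exact ⟨g.f j y, (map_d_apply g _ _ y).symm⟩))

theorem incZc_natural : grMap (zcMap g) ≫ incZc D' = incZc D ≫ g := rfl

theorem prjBd_natural : prjBd D ≫ grMap (bdMap g) = g ≫ prjBd D' :=
  HomologicalComplex.hom_ext _ _ fun j => ModuleCat.hom_ext (LinearMap.ext fun x =>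
    Subtype.ext (map_d_apply g j (j - 1) x))

/-- The map of sequences induced by a chain map. -/
def homSeqMap (j : ℕ) : homSeq D j ⟶ homSeq D' j where
  τ₁ := bdMap g (j + 1)
  τ₂ := zcMap g j
  τ₃ := homologyMap g j
  comm₁₂ := rfl
  comm₂₃ := (ModuleCat.hom_ext (LinearMap.ext fun x => homologyMap_cls g x)).symm

/-- Images are indexed by the source of the differential, so index zero belongs to `d 0 0 = 0`.
Consequently terms with second index zero carry no torsion. -/
theorem bd_zero_eq (x : bd D 0) : x = 0 := by
  obtain ⟨_, ⟨y, rfl⟩⟩ := x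
  refine Subtype.ext ?_
  change D.d 0 (0 - 1) y = 0
  rw [D.shape _ _ (by simp)]; rfl

end cycles

/-! ### The long exact sequence for a second factor with projective terms -/

section projective

variable [IsDomain R] [IsPrincipalIdealRing R] (C D : ChainComplex (ModuleCat.{u} R) ℕ)

instance projective_zc [h : ∀ j, Module.Projective R (D.X j)] (j : ℕ) :
    Module.Projective R (zc D j) := inferInstanceAs (Module.Projective R (cyc D j))

instance projective_bd [h : ∀ j, Module.Projective R (D.X j)] (j : ℕ) :
    Module.Projective R (bd D j) :=
  inferInstanceAs (Module.Projective R (LinearMap.range (D.d j (j - 1)).hom))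

variable [∀ j, Module.Projective R (D.X j)]

/-- A section of the projection to the boundaries. -/
theorem exists_section (j : ℕ) : ∃ s : bd D j →ₗ[R] D.X j, ∀ x, D.d j (j - 1) (s x) = x.1 := by
  obtain ⟨s, hs⟩ := Module.projective_lifting_property
    (show D.X j →ₗ[R] bd D j from (D.d j (j - 1)).hom.rangeRestrict) LinearMap.id
    (LinearMap.surjective_rangeRestrict _)
  exact ⟨s, fun x => congrArg Subtype.val (LinearMap.congr_fun hs x)⟩

/-- A retraction onto the cycles. -/
theorem exists_retraction (j : ℕ) : ∃ r : D.X j →ₗ[R] cyc D j, ∀ x : cyc D j, r x = x := by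
  obtain ⟨s, hs⟩ := exists_section D j
  refine ⟨(LinearMap.id - s ∘ₗ (D.d j (j - 1)).hom.rangeRestrict).codRestrict _ fun x => ?_,
    fun x => ?_⟩
  · refine Subtype.ext ?_
    change x.1 - s _ = x.1
    have : (D.d j (j - 1)).hom.rangeRestrict (x : D.X j) = 0 := Subtype.ext x.2
    exact (congrArg (fun z => x.1 - s z) this).trans
      ((congrArg (x.1 - ·) (map_zero s)).trans (sub_zero _))
  · change D.d j (j - 1) (x - s _) = 0
    rw [map_sub, hs]
    exact sub_self _

/-- Boundaries are projective, so the sequence of cycles and boundaries splits in each degree.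
Tensoring therefore preserves injectivity without any assumption on `C`. -/
theorem cycSeq_shortExact : ∃ w : tensMap (𝟙 C) (incZc D) ≫ tensMap (𝟙 C) (prjBd D) = 0,
    (ShortComplex.mk (tensMap (𝟙 C) (incZc D)) (tensMap (𝟙 C) (prjBd D)) w).ShortExact := by
  apply tot_shortExact
  · intro p q
    obtain ⟨r, hr⟩ := exists_retraction D q
    have h1 : r ∘ₗ (cyc D q).subtype = LinearMap.id := LinearMap.ext hr
    have h2 : r.lTensor (C.X p) ∘ₗ (cyc D q).subtype.lTensor (C.X p) = LinearMap.id := by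
      rw [← LinearMap.lTensor_comp, h1, LinearMap.lTensor_id]
    exact Function.LeftInverse.injective (g := r.lTensor (C.X p)) (LinearMap.congr_fun h2)
  · intro p q
    have h1 : Function.Exact (cyc D q).subtype (D.d q (q - 1)).hom.rangeRestrict := fun x => by
      refine (Subtype.ext_iff.trans (LinearMap.exact_subtype_ker_map (D.d q (q - 1)).hom x))
    exact lTensor_exact (C.X p) h1 (LinearMap.surjective_rangeRestrict _)
  · intro p q
    exact LinearMap.lTensor_surjective (C.X p)
      (LinearMap.surjective_rangeRestrict (D.d q (q - 1)).hom)

variable {C} in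
/-- The map `⨁ H_i(C) ⊗ B_{j+1} → ⨁ H_i(C) ⊗ Z_j`, with signs. -/
def bdShift {n : ℕ} (y : ∀ a : Idx (n + 1), C.homology a.1.1 ⊗[R] bd D a.1.2) :
    ∀ a : Idx n, C.homology a.1.1 ⊗[R] zc D a.1.2 := fun a =>
  (-1 : R) ^ a.1.1 • (bdInc D a.1.2).hom.lTensor (C.homology a.1.1)
    (y ⟨(a.1.1, a.1.2 + 1), by have := a.2; simp; omega⟩)

/-- A cycle of `C ⊗ B` is lifted to `C ⊗ D` by sections of the differentials of `D`. The horizontal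
part of the boundary of the lift vanishes, since sections act on the other factor. The vertical part
undoes the section and leaves the inclusion of boundaries, with the sign of the total complex. -/
theorem δ_rowEquiv {n : ℕ} (w) (hS : (ShortComplex.mk (tensMap (𝟙 C) (incZc D))
      (tensMap (𝟙 C) (prjBd D)) w).ShortExact)
    (hij : (ComplexShape.down ℕ).Rel (n + 1) n)
    (y : ∀ a : Idx (n + 1), C.homology a.1.1 ⊗[R] bd D a.1.2) :
    hS.δ (n + 1) n hij (rowEquiv C (bd D) (n + 1) y) = rowEquiv C (zc D) n (bdShift D y) := by
  choose s hs using exists_section D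
  obtain ⟨b, hb⟩ := cls_surjective _ _ (rowEquiv C (bd D) (n + 1) y)
  have hb0 := (mem_cyc_gr b.1).1 b.2
  let b' : (tensorDouble C (gr (bd D))).TotX (n + 1) := b.1
  let x₂ : (tensorDouble C D).TotX (n + 1) := fun a => (s a.1.2).lTensor (C.X a.1.1) (b' a)
  let x₁ : (tensorDouble C (gr (zc D))).TotX n := fun a =>
    (-1 : R) ^ a.1.1 • (bdInc D a.1.2).hom.lTensor (C.X a.1.1)
      (b' ⟨(a.1.1, a.1.2 + 1), by have := a.2; simp; omega⟩)
  have hx₁ : (show (tens C (gr (zc D))).X n from x₁) ∈ cyc (tens C (gr (zc D))) n := by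
    refine (mem_cyc_gr x₁).2 fun ⟨⟨p, q⟩, h⟩ => ?_
    refine (map_smul ((C.d p (p - 1)).hom.rTensor (zc D q)) _ _).trans ?_
    refine (congrArg _ ((rTensor_lTensor_apply _ _ _).trans
      ((congrArg ((bdInc D q).hom.lTensor _) (hb0 ⟨(p, q + 1), by simp; omega⟩)).trans
      (map_zero _)))).trans (smul_zero _)
  have key : hS.δ (n + 1) n hij (cls _ _ b) = cls _ _ ⟨x₁, hx₁⟩ := by
    refine δ_cls hS hij b x₂ ?_ _ ?_
    · funext a
      change TensorProduct.map LinearMap.id _ ((s a.1.2).lTensor (C.X a.1.1) (b' a)) = b' a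
      refine (LinearMap.congr_fun (LinearMap.lTensor_comp (C.X a.1.1) _ _).symm (b' a)).trans ?_
      have : (D.d a.1.2 (a.1.2 - 1)).hom.rangeRestrict ∘ₗ s a.1.2 = LinearMap.id :=
        LinearMap.ext fun x => Subtype.ext (hs _ x)
      refine (LinearMap.congr_fun (congrArg (LinearMap.lTensor (C.X a.1.1)) this) _).trans ?_
      exact LinearMap.congr_fun (LinearMap.lTensor_id _ _) _
    · refine Eq.trans ?_ (tot_d_apply (tensorDouble C D) n x₂).symm
      funext ⟨⟨p, q⟩, h⟩
      refine Eq.trans ?_ (totD_apply (tensorDouble C D) x₂ p q h).symm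
      have e1 : (tensorDouble C D).dh p q (x₂ ⟨(p + 1, q), by simp; omega⟩) = 0 := by
        refine (rTensor_lTensor_apply _ _ _).trans ?_
        exact (congrArg ((s q).lTensor _) (hb0 ⟨(p + 1, q), by simp; omega⟩)).trans (map_zero _)
      have e2 : (tensorDouble C D).dv p q (x₂ ⟨(p, q + 1), by simp; omega⟩) =
          (cyc D q).subtype.lTensor (C.X p) ((bdInc D q).hom.lTensor (C.X p)
            (b' ⟨(p, q + 1), by simp; omega⟩)) := by
        refine (LinearMap.congr_fun (LinearMap.lTensor_comp (C.X p) _ _).symm _).trans ?_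
        refine Eq.trans ?_ (LinearMap.congr_fun (LinearMap.lTensor_comp (C.X p) _ _) _)
        refine LinearMap.congr_fun (congrArg (LinearMap.lTensor (C.X p)) ?_) _
        exact LinearMap.ext fun x => hs _ x
      rw [e1, e2, zero_add]
      exact map_smul ((cyc D q).subtype.lTensor (C.X p)) _ _
  rw [← hb, key]
  -- Both sides are compared row by row, where the claim is naturality of `homTens` along the
  -- inclusion of boundaries.
  apply (rowMap_bijective C (zc D) n).1
  funext ⟨⟨p, q⟩, h⟩
  refine (rowMap_cls _ _).trans ?_
  refine Eq.trans ?_ (rowMap_rowEquiv _ _).symm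
  have h1 := rowMap_rowEquiv y ⟨(p, q + 1), by simp; omega⟩
  rw [← hb] at h1
  have h2 := (rowMap_cls _ _).symm.trans h1
  change _ = homTens C (zc D q) p ((-1 : R) ^ p • (bdInc D q).hom.lTensor (C.homology p)
    (y ⟨(p, q + 1), by simp; omega⟩))
  have h3 := homTens_natural (𝟙 C) (bdInc D q) p (y ⟨(p, q + 1), by simp; omega⟩)
  rw [homologyMap_id] at h3
  rw [map_smul]
  refine Eq.trans ?_ (congrArg ((-1 : R) ^ p • ·) h3)
  refine Eq.trans ?_ (congrArg
    (fun t => (-1 : R) ^ p • homologyMap (rtensMap (𝟙 C) (bdInc D q)) p t)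
    h2)
  refine Eq.trans ?_ (congrArg (fun t => (-1 : R) ^ p • t) (homologyMap_cls _ _).symm)
  rw [← map_smul]
  rfl

end projective

end Kunneth
end

noncomputable section

namespace Kunneth

open scoped TensorProduct
open DoubleComplex HomologicalComplex

variable {R : Type u} [CommRing R]

/-! ### The two maps of the Künneth sequence, their exactness and naturality -/

section projective

variable (C D : ChainComplex (ModuleCat.{u} R) ℕ)

/-- The pairs of natural numbers with sum `n - 1`. -/
abbrev Idx' (n : ℕ) : Type := {a : ℕ × ℕ // a.1 + a.2 + 1 = n}

/-- The source of the Künneth sequence. -/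
abbrev TensTerm (n : ℕ) : Type u := ∀ a : Idx n, C.homology a.1.1 ⊗[R] D.homology a.1.2

/-- The target of the Künneth sequence. -/
abbrev TorTerm (n : ℕ) : Type u :=
  ∀ a : Idx' n, tor₁ (C.homology a.1.1) (D.homology a.1.2)

/-- The projection `⨁ H_i(C) ⊗ Z_j → ⨁ H_i(C) ⊗ H_j(D)`. -/
def clsPi (n : ℕ) : (∀ a : Idx n, C.homology a.1.1 ⊗[R] zc D a.1.2) →ₗ[R] TensTerm C D n :=
  LinearMap.pi fun a => (zcCls D a.1.2).hom.lTensor (C.homology a.1.1) ∘ₗ LinearMap.proj a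

theorem clsPi_surjective (n : ℕ) : Function.Surjective (clsPi C D n) := fun y => by
  choose x hx using fun a => LinearMap.lTensor_surjective (C.homology a.1.1)
    (zcCls_surjective D a.1.2) (y a)
  exact ⟨x, funext hx⟩

theorem bdShift_of_clsPi_eq_zero {n : ℕ} (x) (hx : clsPi C D n x = 0) :
    ∃ z, bdShift D z = x := by
  have h1 : ∀ a : Idx n, ∃ w, (bdInc D a.1.2).hom.lTensor (C.homology a.1.1) w = x a := fun a =>
    (lTensor_exact _ (bdInc_exact D a.1.2) (zcCls_surjective D a.1.2) _).1 (congrFun hx a)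
  choose w hw using h1
  -- Components with second index zero are not read by `bdShift`. The sign inserted in the others
  -- cancels the sign there, since `(-1)^p` squares to one.
  refine ⟨fun a => match a with
    | ⟨(_, 0), _⟩ => 0
    | ⟨(p, q + 1), h⟩ => (-1 : R) ^ p • w ⟨(p, q), by simp at h ⊢; omega⟩, ?_⟩
  funext ⟨⟨p, q⟩, h⟩
  change (-1 : R) ^ p • (bdInc D q).hom.lTensor (C.homology p)
    ((-1 : R) ^ p • w ⟨(p, q), h⟩) = _
  rw [map_smul, smul_smul, ← pow_add, Even.neg_one_pow ⟨p, rfl⟩, one_smul]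
  exact hw ⟨(p, q), h⟩

theorem clsPi_bdShift {n : ℕ} (z : ∀ a : Idx (n + 1), C.homology a.1.1 ⊗[R] bd D a.1.2) :
    clsPi C D n (bdShift D z) = 0 := by
  funext ⟨⟨p, q⟩, h⟩
  change (zcCls D q).hom.lTensor (C.homology p) ((-1 : R) ^ p •
    (bdInc D q).hom.lTensor (C.homology p) (z ⟨(p, q + 1), _⟩)) = 0
  rw [map_smul]
  exact (congrArg ((-1 : R) ^ p • ·) ((lTensor_exact _ (bdInc_exact D q)
    (zcCls_surjective D q)).apply_apply_eq_zero _)).trans (smul_zero _)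

variable [IsDomain R] [IsPrincipalIdealRing R] [∀ j, Module.Projective R (D.X j)]

/-- The map `⨁ H_i(C) ⊗ Z_j → H_n(C ⊗ D)`. -/
def zcHom (n : ℕ) : (∀ a : Idx n, C.homology a.1.1 ⊗[R] zc D a.1.2) →ₗ[R]
    (tens C D).homology n :=
  (homologyMap (tensMap (𝟙 C) (incZc D)) n).hom ∘ₗ (rowEquiv C (zc D) n).toLinearMap

theorem exact_inc_prj (n : ℕ) : Function.Exact (homologyMap (tensMap (𝟙 C) (incZc D)) n)
    (homologyMap (tensMap (𝟙 C) (prjBd D)) n) := by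
  obtain ⟨w, hS⟩ := cycSeq_shortExact C D
  exact (ShortComplex.ShortExact.moduleCat_exact_iff_function_exact _).1 (hS.homology_exact₂ n)

theorem zcHom_bdShift {n : ℕ} (z) : zcHom C D n (bdShift D z) = 0 := by
  obtain ⟨w, hS⟩ := cycSeq_shortExact C D
  change homologyMap (tensMap (𝟙 C) (incZc D)) n (rowEquiv C (zc D) n (bdShift D z)) = 0
  rw [← δ_rowEquiv C D w hS rfl]
  exact congrArg (fun f => f.hom (rowEquiv C (bd D) (n + 1) z)) (hS.δ_comp (n + 1) n rfl)

/-- Both kernels are the image of `bdShift`: one by the long exact homology sequence, the other by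
right exactness of the tensor product. This is the identification of the cokernel of the connecting
map with the tensor term. -/
theorem ker_zcHom (n : ℕ) : LinearMap.ker (zcHom C D n) = LinearMap.ker (clsPi C D n) := by
  ext x
  rw [LinearMap.mem_ker, LinearMap.mem_ker]
  constructor
  · intro h
    obtain ⟨w, hS⟩ := cycSeq_shortExact C D
    obtain ⟨y, hy⟩ := ((ShortComplex.ShortExact.moduleCat_exact_iff_function_exact _).1
      (hS.homology_exact₁ (n + 1) n rfl) _).1 h
    obtain ⟨z, rfl⟩ := (rowEquiv C (bd D) (n + 1)).surjective y
    have := (δ_rowEquiv C D w hS rfl z).symm.trans hy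
    rw [← (rowEquiv C (zc D) n).injective this, clsPi_bdShift]
  · intro h
    obtain ⟨z, rfl⟩ := bdShift_of_clsPi_eq_zero C D x h
    exact zcHom_bdShift C D z

/-- The map `⨁ H_i(C) ⊗ H_j(D) → H_n(C ⊗ D)`. -/
def kι (n : ℕ) : TensTerm C D n →ₗ[R] (tens C D).homology n :=
  liftSurj (clsPi C D n) (clsPi_surjective C D n) (zcHom C D n) (ker_zcHom C D n).ge

theorem kι_clsPi (n : ℕ) (x) : kι C D n (clsPi C D n x) = zcHom C D n x :=
  liftSurj_apply _ _ _ _ _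

theorem kι_injective (n : ℕ) : Function.Injective (kι C D n) := by
  rw [injective_iff_map_eq_zero]
  intro y hy
  obtain ⟨x, rfl⟩ := clsPi_surjective C D n y
  rw [kι_clsPi] at hy
  exact (ker_zcHom C D n).le hy

/-- The map `H_n(C ⊗ D) → ⨁ H_i(C) ⊗ B_{j+1}`. -/
def prjHom (n : ℕ) : (tens C D).homology n →ₗ[R]
    ∀ a : Idx n, C.homology a.1.1 ⊗[R] bd D a.1.2 :=
  (rowEquiv C (bd D) n).symm.toLinearMap ∘ₗ (homologyMap (tensMap (𝟙 C) (prjBd D)) n).hom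

/-- With `exists_prjHom`, this identifies the image of `prjHom` in positive degrees with the kernel
of the connecting map. -/
theorem bdShift_prjHom {n : ℕ} (x : (tens C D).homology (n + 1)) :
    bdShift D (prjHom C D (n + 1) x) = 0 := by
  obtain ⟨w, hS⟩ := cycSeq_shortExact C D
  apply (rowEquiv C (zc D) n).injective
  rw [← δ_rowEquiv C D w hS rfl, map_zero]
  refine (congrArg (hS.δ (n + 1) n rfl) (LinearEquiv.apply_symm_apply _ _)).trans ?_
  exact congrArg (fun f => f.hom x) (hS.comp_δ (n + 1) n rfl)

theorem exists_prjHom {n : ℕ} (y) (hy : bdShift D y = 0) :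
    ∃ x : (tens C D).homology (n + 1), prjHom C D (n + 1) x = y := by
  obtain ⟨w, hS⟩ := cycSeq_shortExact C D
  have h1 : hS.δ (n + 1) n rfl (rowEquiv C (bd D) (n + 1) y) = 0 := by
    rw [δ_rowEquiv C D w hS rfl, hy, map_zero]
  obtain ⟨x, hx⟩ := ((ShortComplex.ShortExact.moduleCat_exact_iff_function_exact _).1
      (hS.homology_exact₃ (n + 1) n rfl) _).1 h1
  refine ⟨x, ?_⟩
  exact (congrArg (rowEquiv C (bd D) (n + 1)).symm hx).trans (LinearEquiv.symm_apply_apply _ _)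

/-- The embedding of `Tor₁(H_i(C), H_j(D))` in `H_i(C) ⊗ B_{j+1}`. -/
def torBd (M : ModuleCat.{u} R) (j : ℕ) : tor₁ M (D.homology j) →ₗ[R] M ⊗[R] bd D (j + 1) :=
  torEmb M (homSeq_shortExact D j)
    ((IsProjective.iff_projective _).1 (projective_bd D (j + 1)))
    ((IsProjective.iff_projective _).1 (projective_zc D j))

theorem torBd_injective (M : ModuleCat.{u} R) (j : ℕ) : Function.Injective (torBd D M j) :=
  torEmb_injective _ _ _ _

theorem range_torBd (M : ModuleCat.{u} R) (j : ℕ) :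
    LinearMap.range (torBd D M j) = LinearMap.ker ((bdInc D j).hom.lTensor M) :=
  range_torEmb _ _ _ _

/-- The signs are units, so the kernel is taken componentwise, and each component is the kernel of
`H_i ⊗ B_{j+1} → H_i ⊗ Z_j`, that is, a torsion product. -/
theorem bdShift_eq_zero_iff {n : ℕ} (y : ∀ a : Idx (n + 1), C.homology a.1.1 ⊗[R] bd D a.1.2) :
    bdShift D y = 0 ↔ ∀ p q (h : p + q = n), ∃ t, torBd D (C.homology p) q t =
      y ⟨(p, q + 1), by simp; omega⟩ := by
  constructor
  · intro h p q hpq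
    have h1 : (-1 : R) ^ p • (bdInc D q).hom.lTensor (C.homology p)
      (y ⟨(p, q + 1), by simp; omega⟩) = 0 := congrFun h ⟨(p, q), hpq⟩
    have h2 := congrArg ((-1 : R) ^ p • ·) h1
    simp only [smul_smul, ← pow_add, Even.neg_one_pow ⟨p, rfl⟩, one_smul, smul_zero] at h2
    exact (range_torBd D (C.homology p) q).ge h2
  · intro h
    funext ⟨⟨p, q⟩, hpq⟩
    have h1 := (range_torBd D (C.homology p) q).le (h p q hpq)
    exact (congrArg ((-1 : R) ^ p • ·) h1).trans (smul_zero _)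

/-- The components of a map into `⨁ Tor₁(H_i(C), H_j(D))`. -/
def kπComp (n : ℕ) (a : Idx' n) :
    (tens C D).homology n →ₗ[R] tor₁ (C.homology a.1.1) (D.homology a.1.2) :=
  liftInj (torBd D (C.homology a.1.1) a.1.2) (torBd_injective _ _ _)
    (LinearMap.proj (φ := fun a : Idx n => C.homology a.1.1 ⊗[R] bd D a.1.2)
      ⟨(a.1.1, a.1.2 + 1), a.2⟩ ∘ₗ prjHom C D n) (by
      obtain ⟨⟨p, q⟩, rfl⟩ := a
      intro x
      exact (bdShift_eq_zero_iff C D _).1 (bdShift_prjHom C D x) p q rfl)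

/-- The map `H_n(C ⊗ D) → ⨁ Tor₁(H_i(C), H_j(D))`. -/
def kπ (n : ℕ) : (tens C D).homology n →ₗ[R] TorTerm C D n :=
  LinearMap.pi (kπComp C D n)

theorem torBd_kπ (n : ℕ) (x) (a : Idx' n) : torBd D (C.homology a.1.1) a.1.2 (kπ C D n x a) =
    prjHom C D n x ⟨(a.1.1, a.1.2 + 1), a.2⟩ :=
  liftInj_apply _ (torBd_injective _ _ _) _ _ _

theorem kπ_surjective (n : ℕ) : Function.Surjective (kπ C D n) := fun t => by
  cases n with
  | zero => exact ⟨0, funext fun a => by have := a.2; omega⟩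
  | succ n =>
    obtain ⟨x, hx⟩ := exists_prjHom C D (n := n) (fun a => match a with
      | ⟨(_, 0), _⟩ => 0
      | ⟨(p, q + 1), h⟩ => torBd D (C.homology p) q (t ⟨(p, q), h⟩))
      ((bdShift_eq_zero_iff C D _).2 fun p q h => ⟨_, rfl⟩)
    refine ⟨x, funext fun ⟨⟨p, q⟩, h⟩ => torBd_injective D (C.homology p) q ?_⟩
    exact (torBd_kπ C D _ x ⟨⟨p, q⟩, h⟩).trans (congrFun hx ⟨(p, q + 1), h⟩)

/-- The components of `prjHom` that `kπ` forgets have second index zero and lie in a tensor product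
with the zero module `bd D 0`. -/
theorem kπ_eq_zero_iff (n : ℕ) (x) : kπ C D n x = 0 ↔ prjHom C D n x = 0 := by
  constructor
  · intro h
    funext ⟨⟨p, q⟩, hpq⟩
    cases q with
    | zero =>
      have : Subsingleton (bd D 0) := ⟨fun x y => (bd_zero_eq x).trans (bd_zero_eq y).symm⟩
      exact Subsingleton.elim (α := C.homology p ⊗[R] bd D 0) _ _
    | succ q =>
      exact ((torBd_kπ C D n x ⟨(p, q), hpq⟩).symm.trans
        (congrArg (torBd D (C.homology p) q) (congrFun h ⟨(p, q), hpq⟩))).trans (map_zero _)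
  · intro h
    funext ⟨⟨p, q⟩, hpq⟩
    apply torBd_injective D (C.homology p) q
    exact ((torBd_kπ C D n x ⟨(p, q), hpq⟩).trans
      (congrFun h ⟨(p, q + 1), hpq⟩)).trans (map_zero _).symm

theorem kunneth_exact (n : ℕ) : Function.Exact (kι C D n) (kπ C D n) := fun x => by
  have h1 : prjHom C D n x = 0 ↔ homologyMap (tensMap (𝟙 C) (prjBd D)) n x = 0 :=
    (rowEquiv C (bd D) n).symm.map_eq_zero_iff
  rw [kπ_eq_zero_iff, h1, exact_inc_prj C D n x]
  constructor
  · rintro ⟨y, rfl⟩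
    obtain ⟨z, rfl⟩ := (rowEquiv C (zc D) n).surjective y
    exact ⟨_, kι_clsPi C D n z⟩
  · rintro ⟨y, rfl⟩
    obtain ⟨z, rfl⟩ := clsPi_surjective C D n y
    exact ⟨_, (kι_clsPi C D n z).symm⟩

variable {C D} {C' D' : ChainComplex (ModuleCat.{u} R) ℕ} [∀ j, Module.Projective R (D'.X j)]

/-- The map induced by chain maps on the sources of the Künneth sequences. -/
def tensTermMap (f : C ⟶ C') (g : D ⟶ D') (n : ℕ) : TensTerm C D n →ₗ[R] TensTerm C' D' n :=
  LinearMap.pi fun a => TensorProduct.map (homologyMap f a.1.1).hom (homologyMap g a.1.2).hom ∘ₗ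
    LinearMap.proj a

/-- The map induced by chain maps on the targets of the Künneth sequences. -/
def torTermMap' (f : C ⟶ C') (g : D ⟶ D') (n : ℕ) : TorTerm C D n →ₗ[R] TorTerm C' D' n :=
  LinearMap.pi fun a => (tor₁Map (homologyMap f a.1.1) (homologyMap g a.1.2)).hom ∘ₗ
    LinearMap.proj a

theorem torBd_natural (g : D ⟶ D') (j : ℕ) {M M' : ModuleCat.{u} R} (f : M ⟶ M')
    (t : tor₁ M (D.homology j)) : torBd D' M' j (tor₁Map f (homologyMap g j) t) =
      TensorProduct.map f.hom (bdMap g (j + 1)).hom (torBd D M j t) :=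
  torEmb_natural (homSeq_shortExact D j)
    ((IsProjective.iff_projective _).1 (projective_bd D (j + 1)))
    ((IsProjective.iff_projective _).1 (projective_zc D j))
    (homSeq_shortExact D' j)
    ((IsProjective.iff_projective _).1 (projective_bd D' (j + 1)))
    ((IsProjective.iff_projective _).1 (projective_zc D' j)) (homSeqMap g j) f t

/-- Since `clsPi` is surjective, it suffices to check on `H(C) ⊗ Z`, where the map is induced by the
natural chain map `incZc`. -/
theorem kι_natural (f : C ⟶ C') (g : D ⟶ D') (n : ℕ) (y : TensTerm C D n) :
    homologyMap (tensMap f g) n (kι C D n y) = kι C' D' n (tensTermMap f g n y) := by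
  obtain ⟨x, rfl⟩ := clsPi_surjective C D n y
  have h1 : tensTermMap f g n (clsPi C D n x) = clsPi C' D' n fun a =>
      TensorProduct.map (homologyMap f a.1.1).hom (zcMap g a.1.2).hom (x a) := by
    funext a
    exact map_lTensor_apply _ _ _ _ _ (LinearMap.ext fun z => homologyMap_cls g z) _
  rw [h1, kι_clsPi, kι_clsPi]
  have h2 : tensMap (𝟙 C) (incZc D) ≫ tensMap f g =
      tensMap f (grMap (zcMap g)) ≫ tensMap (𝟙 C') (incZc D') := by
    rw [← tensMap_comp, ← tensMap_comp, Category.id_comp, Category.comp_id, incZc_natural]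
  have h3 := rowEquiv_natural f (zcMap g) x
  change homologyMap (tensMap f g) n (homologyMap (tensMap (𝟙 C) (incZc D)) n
    (rowEquiv C (zc D) n x)) = homologyMap (tensMap (𝟙 C') (incZc D')) n (rowEquiv _ _ _ _)
  rw [← h3, ← ModuleCat.comp_apply, ← ModuleCat.comp_apply, ← homologyMap_comp,
    ← homologyMap_comp, h2]

/-- Dually, the check is made after the injective maps `torBd`, where the map is induced by the
natural chain map `prjBd`. -/
theorem kπ_natural (f : C ⟶ C') (g : D ⟶ D') (n : ℕ) (x : (tens C D).homology n) :
    kπ C' D' n (homologyMap (tensMap f g) n x) = torTermMap' f g n (kπ C D n x) := by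
  have h2 : tensMap f g ≫ tensMap (𝟙 C') (prjBd D') =
      tensMap (𝟙 C) (prjBd D) ≫ tensMap f (grMap (bdMap g)) := by
    rw [← tensMap_comp, ← tensMap_comp, Category.id_comp, Category.comp_id, prjBd_natural]
  have h3 : prjHom C' D' n (homologyMap (tensMap f g) n x) = fun a =>
      TensorProduct.map (homologyMap f a.1.1).hom (bdMap g a.1.2).hom (prjHom C D n x a) := by
    apply (rowEquiv C' (bd D') n).injective
    rw [← rowEquiv_natural f (bdMap g)]
    change rowEquiv C' (bd D') n ((rowEquiv C' (bd D') n).symm _) =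
      homologyMap (tensMap f (grMap (bdMap g))) n
        (rowEquiv C (bd D) n ((rowEquiv C (bd D) n).symm _))
    rw [LinearEquiv.apply_symm_apply, LinearEquiv.apply_symm_apply]
    change homologyMap (tensMap (𝟙 C') (prjBd D')) n (homologyMap (tensMap f g) n x) =
      homologyMap (tensMap f (grMap (bdMap g))) n (homologyMap (tensMap (𝟙 C) (prjBd D)) n x)
    rw [← ModuleCat.comp_apply, ← ModuleCat.comp_apply, ← homologyMap_comp,
      ← homologyMap_comp, h2]
  funext a
  apply torBd_injective D' (C'.homology a.1.1) a.1.2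
  refine (torBd_kπ C' D' n _ a).trans ?_
  refine Eq.trans ?_ (torBd_natural g a.1.2 (homologyMap f a.1.1) (kπ C D n x a)).symm
  rw [h3]
  exact congrArg (TensorProduct.map (homologyMap f a.1.1).hom (bdMap g (a.1.2 + 1)).hom)
    (torBd_kπ C D n x a).symm

end projective

end Kunneth
end

noncomputable section

namespace Kunneth

open scoped TensorProduct
open DoubleComplex HomologicalComplex

variable {R : Type u} [CommRing R]

/-! ### Splitting the Künneth sequence of complexes of projective modules -/

section splitting

variable {C D : ChainComplex (ModuleCat.{u} R) ℕ}

theorem extension_d {i : ℕ} {p : C.X i →ₗ[R] C.homology i}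
    (hp : ∀ z : cyc C i, p z = cls C i z) : p ∘ₗ (C.d (i + 1) i).hom = 0 :=
  LinearMap.ext fun z => (hp (dCyc C i z)).trans (cls_dCyc C i z)

/-- A map `H_i(C ⊗ M) → H_i(C) ⊗ M` from an extension of the projection of cycles to homology. -/
theorem rTensor_of_homTens {i : ℕ} {p : C.X i →ₗ[R] C.homology i}
    (hp : ∀ z : cyc C i, p z = cls C i z) (M : ModuleCat.{u} R) (b : cyc (rtens C M) i)
    (x : C.homology i ⊗[R] M) (h : cls (rtens C M) i b = homTens C M i x) :
    p.rTensor M (b : (rtens C M).X i) = x := by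
  let P : (rtens C M).homology i →ₗ[R] C.homology i ⊗[R] M :=
    homDesc _ _ ((p.rTensor M : _ →ₗ[R] C.homology i ⊗[R] M) ∘ₗ
      (cyc (rtens C M) i).subtype) fun y => by
      refine (congrArg (p.rTensor M) (ConcreteCategory.congr_hom (rtens_d M i) y)).trans ?_
      refine (LinearMap.congr_fun (LinearMap.rTensor_comp M p (C.d (i + 1) i).hom).symm _).trans ?_
      rw [extension_d hp, LinearMap.rTensor_zero]
      rfl
  have h1 : P ∘ₗ homTens C M i = LinearMap.id := by
    refine TensorProduct.ext' fun z m => ?_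
    obtain ⟨z, rfl⟩ := cls_surjective C i z
    refine (congrArg P (homologyMap_cls (tmulRight M m) z)).trans ?_
    refine (homDesc_cls _ _ _).trans ?_
    exact congrArg (· ⊗ₜ m) (hp z)
  have h2 := LinearMap.congr_fun h1 x
  rw [LinearMap.comp_apply, ← h] at h2
  exact (homDesc_cls _ _ _).symm.trans h2

variable (C D)

/-- The retraction of the Künneth sequence defined by extensions of the projections of cycles to
homology. -/
def kRet (p : ∀ i, C.X i →ₗ[R] C.homology i) (hp : ∀ i (z : cyc C i), p i z = cls C i z)
    (q : ∀ i, D.X i →ₗ[R] D.homology i) (hq : ∀ i (z : cyc D i), q i z = cls D i z) (n : ℕ) :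
    (tens C D).homology n →ₗ[R] TensTerm C D n :=
  homDesc _ _ ((LinearMap.pi fun a : Idx n => TensorProduct.map (p a.1.1) (q a.1.2) ∘ₗ
    LinearMap.proj (φ := fun a : Idx n => C.X a.1.1 ⊗[R] D.X a.1.2) a) ∘ₗ
      (cyc (tens C D) n).subtype) fun y => by
    funext ⟨⟨i, j⟩, h⟩
    refine (congrArg (TensorProduct.map (p i) (q j)) (congrFun (tot_d_apply (tensorDouble C D) n y)
      ⟨(i, j), h⟩)).trans ?_
    refine (congrArg (TensorProduct.map (p i) (q j)) (totD_apply (tensorDouble C D) y i j h)).trans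
      ((map_add _ _ _).trans ?_)
    -- Both `p` and `q` vanish on boundaries because there they agree with the class map, so `p ⊗ q`
    -- kills each half of the total differential.
    have e1 : TensorProduct.map (p i) (q j) ∘ₗ (C.d (i + 1) i).hom.rTensor (D.X j) = 0 := by
      rw [LinearMap.map_comp_rTensor, extension_d (hp i), TensorProduct.map_zero_left]
    have e2 : TensorProduct.map (p i) (q j) ∘ₗ (D.d (j + 1) j).hom.lTensor (C.X i) = 0 := by
      rw [LinearMap.map_comp_lTensor, extension_d (hq j), TensorProduct.map_zero_right]
    refine (congrArg₂ (· + ·) (LinearMap.congr_fun e1 _)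
      ((map_smul (TensorProduct.map (p i) (q j)) _ _).trans
      (congrArg ((-1 : R) ^ i • ·) (LinearMap.congr_fun e2 _)))).trans ?_
    exact (zero_add _).trans (smul_zero _)

theorem kRet_cls (p : ∀ i, C.X i →ₗ[R] C.homology i) (hp : ∀ i (z : cyc C i), p i z = cls C i z)
    (q : ∀ i, D.X i →ₗ[R] D.homology i) (hq : ∀ i (z : cyc D i), q i z = cls D i z) (n : ℕ)
    (x : cyc (tens C D) n) (a : Idx n) : kRet C D p hp q hq n (cls _ _ x) a =
      TensorProduct.map (p a.1.1) (q a.1.2) ((x.1 : (tensorDouble C D).TotX n) a) := by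
  rw [kRet, homDesc_cls]
  rfl

variable [IsDomain R] [IsPrincipalIdealRing R] [∀ j, Module.Projective R (D.X j)]

/-- The class is represented by an element of `C ⊗ Z`. On it `p ⊗ q` is `p ⊗ 1` followed by the
class map in the second factor, and `p ⊗ 1` inverts `homTens` by `rTensor_of_homTens`. -/
theorem kRet_kι (p : ∀ i, C.X i →ₗ[R] C.homology i) (hp : ∀ i (z : cyc C i), p i z = cls C i z)
    (q : ∀ i, D.X i →ₗ[R] D.homology i) (hq : ∀ i (z : cyc D i), q i z = cls D i z) (n : ℕ)
    (y : TensTerm C D n) : kRet C D p hp q hq n (kι C D n y) = y := by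
  obtain ⟨x, rfl⟩ := clsPi_surjective C D n y
  rw [kι_clsPi]
  obtain ⟨b, hb⟩ := cls_surjective _ _ (rowEquiv C (zc D) n x)
  have h1 : zcHom C D n x = cls _ _ (cycMap (tensMap (𝟙 C) (incZc D)) n b) := by
    rw [← homologyMap_cls, hb]; rfl
  rw [h1]
  funext ⟨⟨i, j⟩, h⟩
  refine (kRet_cls C D p hp q hq n _ ⟨(i, j), h⟩).trans ?_
  let a : Idx n := ⟨(i, j), h⟩
  have h2 : cls (rtens C (zc D j)) i (rowCyc C (zc D) a b) = homTens C (zc D j) i (x a) :=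
    (rowMap_cls b a).symm.trans ((congrFun (congrArg (rowMap C (zc D) n) hb) a).trans
      (rowMap_rowEquiv x a))
  have h3 := rTensor_of_homTens (hp i) (zc D j) _ _ h2
  refine Eq.trans ?_ (congrArg ((zcCls D j).hom.lTensor (C.homology i)) h3)
  exact map_lTensor_of_comp_eq (p i) (q j) (cyc D j).subtype (zcCls D j).hom
    (LinearMap.ext (hq j)) _

theorem exists_extension (j : ℕ) :
    ∃ q : D.X j →ₗ[R] D.homology j, ∀ z : cyc D j, q z = cls D j z := by
  obtain ⟨r, hr⟩ := exists_retraction D j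
  exact ⟨cls D j ∘ₗ r, fun z => congrArg (cls D j) (hr z)⟩

/-- The retraction depends on chosen complements of the cycles in both complexes, so no naturality
is claimed; projectivity of `C` is needed for its extensions. -/
theorem exists_retraction_kι [∀ j, Module.Projective R (C.X j)] (n : ℕ) :
    ∃ l : (tens C D).homology n →ₗ[R] TensTerm C D n, ∀ y, l (kι C D n y) = y := by
  choose p hp using exists_extension C
  choose q hq using exists_extension D
  exact ⟨kRet C D p hp q hq n, kRet_kι C D p hp q hq n⟩

end splitting

/-! ### Functorial replacements by complexes of projective modules -/

section replacement

/-- In positive degrees this is the long exact sequence. In degree zero, where no term follows,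
surjectivity comes from surjectivity on chains, all of which are cycles. -/
theorem homologyMap_bijective_of_acyclic {S : ShortComplex (ChainComplex (ModuleCat.{u} R) ℕ)}
    (hS : S.ShortExact) (h : ∀ n, Subsingleton (S.X₁.homology n)) (n : ℕ) :
    Function.Bijective (homologyMap S.g n) := by
  constructor
  · rw [injective_iff_map_eq_zero]
    intro x hx
    obtain ⟨y, rfl⟩ := ((ShortComplex.ShortExact.moduleCat_exact_iff_function_exact _).1
      (hS.homology_exact₂ n) x).1 hx
    rw [Subsingleton.elim y 0]
    exact map_zero _
  · cases n with
    | zero =>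
      intro y
      obtain ⟨z, rfl⟩ := cls_surjective _ _ y
      have : Epi S.g := hS.epi_g
      obtain ⟨x, hx⟩ := (ModuleCat.epi_iff_surjective (S.g.f 0)).1 inferInstance z
      refine ⟨cls _ _ ⟨x, mem_cyc_zero _ _⟩, ?_⟩
      rw [homologyMap_cls]
      congr 1
      exact Subtype.ext hx
    | succ n =>
      intro y
      exact ((ShortComplex.ShortExact.moduleCat_exact_iff_function_exact _).1
        (hS.homology_exact₃ (n + 1) n rfl) y).1 (Subsingleton.elim _ _)

/-- The kernel of a chain map. -/
def kerCx {E D : ChainComplex (ModuleCat.{u} R) ℕ} (q : E ⟶ D) : ChainComplex (ModuleCat.{u} R) ℕ :=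
  ChainComplex.of (fun n => ModuleCat.of R (LinearMap.ker (q.f n).hom))
    (fun n => ModuleCat.ofHom ((E.d (n + 1) n).hom.restrict fun x hx =>
      (map_d_apply q (n + 1) n x).trans ((congrArg _ hx).trans (map_zero _))))
    fun _ => ModuleCat.hom_ext (LinearMap.ext fun x => Subtype.ext (d_d_apply E _ _ _ x.1))

theorem kerCx_d {E D : ChainComplex (ModuleCat.{u} R) ℕ} (q : E ⟶ D) (n : ℕ)
    (x : LinearMap.ker (q.f n.succ).hom) :
    ((kerCx q).d (n + 1) n x : LinearMap.ker (q.f n).hom).1 = E.d (n + 1) n x.1 := by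
  have := ChainComplex.of_d (fun n => ModuleCat.of R (LinearMap.ker (q.f n).hom))
    (fun n => ModuleCat.ofHom ((E.d (n + 1) n).hom.restrict fun x hx =>
      (map_d_apply q (n + 1) n x).trans ((congrArg _ hx).trans (map_zero _)))) n
  exact congrArg (fun f => (f.hom x : LinearMap.ker (q.f n).hom).1) this

/-- The inclusion of the kernel of a chain map. -/
def kerInc {E D : ChainComplex (ModuleCat.{u} R) ℕ} (q : E ⟶ D) : kerCx q ⟶ E where
  f n := ModuleCat.ofHom (LinearMap.ker (q.f n).hom).subtype
  comm' i j hij := by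
    obtain rfl : j + 1 = i := hij
    exact ModuleCat.hom_ext (LinearMap.ext fun x => (kerCx_d q j x).symm)

variable (D : ChainComplex (ModuleCat.{u} R) ℕ)

/-- Evaluation of formal linear combinations. -/
abbrev ev (M : ModuleCat.{u} R) : (M →₀ R) →ₗ[R] M := Finsupp.linearCombination R id

/-- The terms of the functorial replacement. -/
def replX (n : ℕ) : Submodule R ((D.X n →₀ R) × (D.X (n - 1) →₀ R)) where
  -- The second entry is a formal lift of the boundary of the first, and the differential will be
  -- `(x, y) ↦ (y, 0)`. As `n - 1` truncates, degree zero needs the extra clause that the second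
  -- entry vanish.
  carrier := {x | ev _ x.2 = D.d n (n - 1) (ev _ x.1) ∧ (n = 0 → x.2 = 0)}
  add_mem' := fun {x y} hx hy => ⟨by
    rw [Prod.snd_add, Prod.fst_add, map_add, map_add, map_add, hx.1, hy.1], fun h => by
    rw [Prod.snd_add, hx.2 h, hy.2 h, add_zero]⟩
  zero_mem' := ⟨by simp, fun _ => rfl⟩
  smul_mem' := fun c x hx => ⟨by
    rw [Prod.smul_snd, Prod.smul_fst, map_smul, map_smul, map_smul, hx.1], fun h => by
    rw [Prod.smul_snd, hx.2 h, smul_zero]⟩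

/-- The differential of the functorial replacement. -/
def replD (n : ℕ) : replX D (n + 1) →ₗ[R] replX D n :=
  ((LinearMap.inl R (D.X n →₀ R) (D.X (n - 1) →₀ R) ∘ₗ
    LinearMap.snd R (D.X (n + 1) →₀ R) (D.X n →₀ R)).restrict fun x hx => by
      refine ⟨?_, fun _ => rfl⟩
      change ev (D.X (n - 1)) 0 = D.d n (n - 1) (ev (D.X n) x.2)
      have h1 : ev (D.X n) x.2 = D.d (n + 1) n (ev (D.X (n + 1)) x.1) := hx.1
      rw [h1, d_d_apply, map_zero])

/-- A functorial complex of projective modules with a surjective quasi-isomorphism to `D`. -/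
def repl : ChainComplex (ModuleCat.{u} R) ℕ :=
  ChainComplex.of (fun n => ModuleCat.of R (replX D n)) (fun n => ModuleCat.ofHom (replD D n))
    fun _ => rfl

theorem repl_d (n : ℕ) : (repl D).d (n + 1) n = ModuleCat.ofHom (replD D n) :=
  ChainComplex.of_d (fun n => ModuleCat.of R (replX D n)) (fun n => ModuleCat.ofHom (replD D n)) n

/-- The quasi-isomorphism from the functorial replacement. -/
def replMap : repl D ⟶ D where
  f n := ModuleCat.ofHom (ev (D.X n) ∘ₗ LinearMap.fst R _ _ ∘ₗ (replX D n).subtype)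
  comm' i j hij := by
    obtain rfl : j + 1 = i := hij
    rw [repl_d]
    exact ModuleCat.hom_ext (LinearMap.ext fun x => x.2.1.symm)

theorem replMap_surjective (n : ℕ) : Function.Surjective ((replMap D).f n) := fun x => by
  refine ⟨⟨(Finsupp.single x 1, if n = 0 then 0 else Finsupp.single (D.d n (n - 1) x) 1),
    ?_, fun h => if_pos h⟩, ?_⟩
  · by_cases h : n = 0
    · subst h
      simp
    · simp [h]
  · exact (Finsupp.linearCombination_single R (1 : R) x).trans (one_smul R x)

/-- The kernel consists of pairs with both entries of evaluation zero and differential `(x, y) ↦ (y,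
0)`. A cycle has the form `(x, 0)`, and it is the boundary of `(0, x)`. -/
theorem repl_acyclic (n : ℕ) : Subsingleton ((kerCx (replMap D)).homology n) := by
  refine ⟨fun a b => ?_⟩
  rw [← sub_eq_zero]
  obtain ⟨z, hz⟩ := cls_surjective _ _ (a - b)
  rw [← hz, cls_eq_zero_iff]
  obtain ⟨⟨⟨⟨x, y⟩, hxy⟩, h0⟩, hc⟩ := z
  have hy : y = 0 := by
    cases n with
    | zero => exact hxy.2 rfl
    | succ n =>
      have h1 := mem_cyc_succ.1 hc
      have h2 := (kerCx_d (replMap D) n ⟨⟨⟨x, y⟩, hxy⟩, h0⟩).symm.trans (congrArg Subtype.val h1)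
      have h3 := (ConcreteCategory.congr_hom (repl_d D n) _).symm.trans h2
      exact congrArg (fun w : replX D n => w.1.1) h3
  subst hy
  have hw : ((0, x) : (D.X (n + 1) →₀ R) × (D.X n →₀ R)) ∈ replX D (n + 1) := by
    refine ⟨?_, fun h => by omega⟩
    rw [map_zero, map_zero]
    exact h0
  have hw0 : (⟨(0, x), hw⟩ : replX D (n + 1)) ∈ LinearMap.ker ((replMap D).f (n + 1)).hom :=
    map_zero (ev (D.X (n + 1)))
  refine ⟨⟨⟨(0, x), hw⟩, hw0⟩, ?_⟩
  refine Subtype.ext ((kerCx_d (replMap D) n ⟨⟨(0, x), hw⟩, hw0⟩).trans ?_)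
  exact ConcreteCategory.congr_hom (repl_d D n) _

variable {D} {D' : ChainComplex (ModuleCat.{u} R) ℕ}

theorem ev_mapDomain {M N : ModuleCat.{u} R} (f : M ⟶ N) (x : M →₀ R) :
    ev N (Finsupp.lmapDomain R R f x) = f (ev M x) := by
  change (ev N ∘ₗ Finsupp.lmapDomain R R f) x = (f.hom ∘ₗ ev M) x
  congr 1
  ext m
  simp

/-- The functorial replacement on maps. -/
def replFun (g : D ⟶ D') : repl D ⟶ repl D' where
  f n := ModuleCat.ofHom (((Finsupp.lmapDomain R R (g.f n)).prodMap
      (Finsupp.lmapDomain R R (g.f (n - 1)))).restrict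
    (p := replX D n) (q := replX D' n) fun x hx => by
      refine ⟨?_, fun h => ?_⟩
      · refine (ev_mapDomain _ _).trans ?_
        refine Eq.trans ?_ (congrArg (D'.d n (n - 1)) (ev_mapDomain _ _)).symm
        exact (congrArg (g.f (n - 1)) hx.1).trans (map_d_apply g n (n - 1) _)
      · exact (congrArg (Finsupp.lmapDomain R R (g.f (n - 1))) (hx.2 h)).trans (map_zero _))
  comm' i j hij := by
    obtain rfl : j + 1 = i := hij
    rw [repl_d, repl_d]
    refine ModuleCat.hom_ext (LinearMap.ext fun x => Subtype.ext ?_)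
    exact Prod.ext rfl (map_zero (Finsupp.lmapDomain R R (g.f (j - 1)))).symm

/-- The square commutes strictly, with no choice of lifts up to homotopy. This reduces naturality of
the general sequence to that of the projective case. -/
theorem replFun_replMap (g : D ⟶ D') : replFun g ≫ replMap D' = replMap D ≫ g :=
  HomologicalComplex.hom_ext _ _ fun _ => ModuleCat.hom_ext (LinearMap.ext fun _ =>
    ev_mapDomain _ _)

theorem replSeq_shortExact (D : ChainComplex (ModuleCat.{u} R) ℕ) :
    ∃ w : kerInc (replMap D) ≫ replMap D = 0,
      (ShortComplex.mk (kerInc (replMap D)) (replMap D) w).ShortExact := by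
  have w : kerInc (replMap D) ≫ replMap D = 0 :=
    HomologicalComplex.hom_ext _ _ fun n => ModuleCat.hom_ext (LinearMap.ext fun x => x.2)
  refine ⟨w, HomologicalComplex.shortExact_of_degreewise_shortExact _ fun n => ?_⟩
  exact ModuleCat.shortComplex_shortExact _ (LinearMap.exact_subtype_ker_map _)
    (Submodule.subtype_injective _) (replMap_surjective D n)

theorem homologyMap_replMap_bijective (D : ChainComplex (ModuleCat.{u} R) ℕ) (n : ℕ) :
    Function.Bijective (homologyMap (replMap D) n) := by
  obtain ⟨w, hS⟩ := replSeq_shortExact D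
  exact homologyMap_bijective_of_acyclic hS (repl_acyclic D) n

variable [IsDomain R] [IsPrincipalIdealRing R]

instance projective_repl (D : ChainComplex (ModuleCat.{u} R) ℕ) (n : ℕ) :
    Module.Projective R ((repl D).X n) := inferInstanceAs (Module.Projective R (replX D n))

instance projective_kerCx (D : ChainComplex (ModuleCat.{u} R) ℕ) (n : ℕ) :
    Module.Projective R ((kerCx (replMap D)).X n) :=
  inferInstanceAs (Module.Projective R (LinearMap.ker ((replMap D).f n).hom))

end replacement

/-! ### The Künneth sequence of complexes with vanishing torsion products -/

section general

variable {C D : ChainComplex (ModuleCat.{u} R) ℕ}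

theorem tensTermMap_bijective {C' D' : ChainComplex (ModuleCat.{u} R) ℕ} (f : C ⟶ C') (g : D ⟶ D')
    (hf : ∀ n, Function.Bijective (homologyMap f n))
    (hg : ∀ n, Function.Bijective (homologyMap g n)) (n : ℕ) :
    Function.Bijective (tensTermMap f g n) := by
  have h (a : Idx n) := (TensorProduct.congr (LinearEquiv.ofBijective _ (hf a.1.1))
    (LinearEquiv.ofBijective _ (hg a.1.2))).bijective
  exact (Function.Bijective.piMap h)

theorem torTermMap'_bijective {C' D' : ChainComplex (ModuleCat.{u} R) ℕ} (f : C ⟶ C') (g : D ⟶ D')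
    (hf : ∀ n, Function.Bijective (homologyMap f n))
    (hg : ∀ n, Function.Bijective (homologyMap g n)) (n : ℕ) :
    Function.Bijective (torTermMap' f g n) := by
  have h (a : Idx' n) : Function.Bijective
      (tor₁Map (homologyMap f a.1.1) (homologyMap g a.1.2)) := by
    have h1 : IsIso (homologyMap f a.1.1) := (ConcreteCategory.isIso_iff_bijective _).2 (hf _)
    have h2 : IsIso (homologyMap g a.1.2) := (ConcreteCategory.isIso_iff_bijective _).2 (hg _)
    exact (ConcreteCategory.isIso_iff_bijective _).1 inferInstance
  exact (Function.Bijective.piMap h)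

variable (C D) [IsDomain R] [IsPrincipalIdealRing R]

/-- Both outer terms of the Künneth sequence vanish. -/
theorem tens_acyclic [∀ j, Module.Projective R (D.X j)] (h : ∀ n, Subsingleton (D.homology n))
    (n : ℕ) : Subsingleton ((tens C D).homology n) := by
  refine ⟨fun a b => ?_⟩
  rw [← sub_eq_zero]
  have h1 : kπ C D n (a - b) = 0 := by
    funext c
    have h0 : IsZero (D.homology c.1.2) := @ModuleCat.isZero_of_subsingleton _ _ _ (h _)
    have : Projective (D.homology c.1.2) := Projective.of_iso h0.isoZero.symm inferInstance
    have : IsZero (tor₁ (C.homology c.1.1) (D.homology c.1.2)) :=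
      isZero_Tor_succ_of_projective _ _ _ 0
    exact (ModuleCat.subsingleton_of_isZero this).elim _ _
  obtain ⟨y, hy⟩ := (kunneth_exact C D n _).1 h1
  have h2 : y = 0 := by
    funext c
    have := h c.1.2
    exact Subsingleton.elim _ _
  rw [← hy, h2, map_zero]

/-- Here the vanishing of torsion does its work. In each degree `repl D` and the kernel of `replMap
D` form a projective presentation of the term of `D`, so tensoring with `C` keeps the sequence exact
on the left; the kernel stays acyclic by `tens_acyclic`. -/
theorem homologyMap_tens_replMap_bijective (hT : ∀ i j, IsZero (tor₁ (C.X i) (D.X j))) (n : ℕ) :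
    Function.Bijective (homologyMap (tensMap (𝟙 C) (replMap D)) n) := by
  obtain ⟨w, hS⟩ := tot_shortExact (tensorDoubleMap (𝟙 C) (kerInc (replMap D)))
    (tensorDoubleMap (𝟙 C) (replMap D))
    (fun p q => (isZero_tor₁_iff (C.X p) (S := ShortComplex.mk ((kerInc (replMap D)).f q)
      ((replMap D).f q) (ModuleCat.hom_ext (LinearMap.ext fun x => x.2)))
      (ModuleCat.shortComplex_shortExact _ (LinearMap.exact_subtype_ker_map _)
        (Submodule.subtype_injective _) (replMap_surjective D q))
      ((IsProjective.iff_projective _).1 (projective_kerCx D q))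
      ((IsProjective.iff_projective _).1 (projective_repl D q))).1 (hT p q))
    (fun p q => lTensor_exact (C.X p) (LinearMap.exact_subtype_ker_map ((replMap D).f q).hom)
      (replMap_surjective D q))
    (fun p q => LinearMap.lTensor_surjective (C.X p) (replMap_surjective D q))
  exact homologyMap_bijective_of_acyclic hS
    (tens_acyclic C (kerCx (replMap D)) (repl_acyclic D)) n

end general

end Kunneth
end

noncomputable section

namespace Kunneth

open scoped TensorProduct
open DoubleComplex HomologicalComplex

variable {R : Type u} [CommRing R]

/-! ### Transport of the Künneth sequence and its splitting along the replacement -/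

section general

variable {C D C' D' C'' D'' : ChainComplex (ModuleCat.{u} R) ℕ}

theorem tensTermMap_comp (f : C ⟶ C') (g : D ⟶ D') (f' : C' ⟶ C'') (g' : D' ⟶ D'') (n : ℕ)
    (x : TensTerm C D n) :
    tensTermMap f' g' n (tensTermMap f g n x) = tensTermMap (f ≫ f') (g ≫ g') n x := by
  funext a
  refine (LinearMap.congr_fun (TensorProduct.map_comp _ _ _ _).symm (x a)).trans ?_
  rw [← ModuleCat.hom_comp, ← ModuleCat.hom_comp, ← homologyMap_comp, ← homologyMap_comp]
  rfl

theorem tor₁Map_comp {M N M' N' M'' N'' : ModuleCat.{u} R} (f : M ⟶ M') (g : N ⟶ N')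
    (f' : M' ⟶ M'') (g' : N' ⟶ N'') :
    tor₁Map f g ≫ tor₁Map f' g' = tor₁Map (f ≫ f') (g ≫ g') := by
  rw [tor₁Map, tor₁Map, tor₁Map, Functor.map_comp, Functor.map_comp, NatTrans.comp_app,
    Category.assoc, Category.assoc]
  refine congrArg _ ?_
  rw [← NatTrans.naturality_assoc]

theorem torTermMap'_comp (f : C ⟶ C') (g : D ⟶ D') (f' : C' ⟶ C'') (g' : D' ⟶ D'') (n : ℕ)
    (x : TorTerm C D n) :
    torTermMap' f' g' n (torTermMap' f g n x) = torTermMap' (f ≫ f') (g ≫ g') n x := by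
  funext a
  have := tor₁Map_comp (homologyMap f a.1.1) (homologyMap g a.1.2)
    (homologyMap f' a.1.1) (homologyMap g' a.1.2)
  rw [← homologyMap_comp, ← homologyMap_comp] at this
  exact ConcreteCategory.congr_hom this (x a)

theorem homologyMap_id_bijective (C : ChainComplex (ModuleCat.{u} R) ℕ) (n : ℕ) :
    Function.Bijective (homologyMap (𝟙 C) n) := by
  rw [homologyMap_id]
  exact Function.bijective_id

/-- The map on homology of tensor products, applied twice. -/
theorem homologyMap_tensMap_comp (f : C ⟶ C') (g : D ⟶ D') (f' : C' ⟶ C'') (g' : D' ⟶ D'') (n : ℕ)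
    (x : (tens C D).homology n) : homologyMap (tensMap f' g') n (homologyMap (tensMap f g) n x) =
      homologyMap (tensMap (f ≫ f') (g ≫ g')) n x := by
  rw [tensMap_comp, homologyMap_comp, ModuleCat.comp_apply]

variable (C D) [IsDomain R] [IsPrincipalIdealRing R]
  (hT : ∀ i j, IsZero (tor₁ (C.X i) (D.X j)))

/-- `H_n(C ⊗ Q) = H_n(C ⊗ D)`, where `Q` is the functorial replacement of `D`. -/
def replTens (n : ℕ) : (tens C (repl D)).homology n ≃ₗ[R] (tens C D).homology n :=
  LinearEquiv.ofBijective (homologyMap (tensMap (𝟙 C) (replMap D)) n).hom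
    (homologyMap_tens_replMap_bijective C D hT n)

/-- The sources of the Künneth sequences of `D` and of its replacement. -/
def replTensTerm (n : ℕ) : TensTerm C (repl D) n ≃ₗ[R] TensTerm C D n :=
  LinearEquiv.ofBijective (tensTermMap (𝟙 C) (replMap D) n)
    (tensTermMap_bijective _ _ (homologyMap_id_bijective C) (homologyMap_replMap_bijective D) n)

/-- The targets of the Künneth sequences of `D` and of its replacement. -/
def replTorTerm (n : ℕ) : TorTerm C (repl D) n ≃ₗ[R] TorTerm C D n :=
  LinearEquiv.ofBijective (torTermMap' (𝟙 C) (replMap D) n)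
    (torTermMap'_bijective _ _ (homologyMap_id_bijective C) (homologyMap_replMap_bijective D) n)

/-- The map `⨁ H_i(C) ⊗ H_j(D) → H_n(C ⊗ D)`. -/
def gι (n : ℕ) : TensTerm C D n →ₗ[R] (tens C D).homology n :=
  (replTens C D hT n).toLinearMap ∘ₗ kι C (repl D) n ∘ₗ (replTensTerm C D n).symm.toLinearMap

/-- The map `H_n(C ⊗ D) → ⨁ Tor₁(H_i(C), H_j(D))`. -/
def gπ (n : ℕ) : (tens C D).homology n →ₗ[R] TorTerm C D n :=
  (replTorTerm C D n).toLinearMap ∘ₗ kπ C (repl D) n ∘ₗ (replTens C D hT n).symm.toLinearMap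

theorem gι_replTensTerm (n : ℕ) (x) :
    gι C D hT n (replTensTerm C D n x) = replTens C D hT n (kι C (repl D) n x) := by
  simp [gι]

theorem gπ_replTens (n : ℕ) (x) :
    gπ C D hT n (replTens C D hT n x) = replTorTerm C D n (kπ C (repl D) n x) := by
  simp [gπ]

theorem gι_injective (n : ℕ) : Function.Injective (gι C D hT n) :=
  (replTens C D hT n).injective.comp ((kι_injective _ _ n).comp
    (replTensTerm C D n).symm.injective)

theorem gπ_surjective (n : ℕ) : Function.Surjective (gπ C D hT n) :=
  (replTorTerm C D n).surjective.comp ((kπ_surjective _ _ n).comp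
    (replTens C D hT n).symm.surjective)

theorem general_exact (n : ℕ) : Function.Exact (gι C D hT n) (gπ C D hT n) := fun x => by
  obtain ⟨x, rfl⟩ := (replTens C D hT n).surjective x
  rw [gπ_replTens, LinearEquiv.map_eq_zero_iff, kunneth_exact C (repl D) n x]
  constructor
  · rintro ⟨y, rfl⟩
    exact ⟨_, gι_replTensTerm C D hT n y⟩
  · rintro ⟨y, hy⟩
    obtain ⟨y, rfl⟩ := (replTensTerm C D n).surjective y
    rw [gι_replTensTerm] at hy
    exact ⟨y, (replTens C D hT n).injective hy⟩

variable {C D} (hT' : ∀ i j, IsZero (tor₁ (C'.X i) (D'.X j))) (f : C ⟶ C') (g : D ⟶ D') (n : ℕ)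

theorem gι_natural (y : TensTerm C D n) :
    homologyMap (tensMap f g) n (gι C D hT n y) = gι C' D' hT' n (tensTermMap f g n y) := by
  obtain ⟨y, rfl⟩ := (replTensTerm C D n).surjective y
  have h1 : tensTermMap f g n (replTensTerm C D n y) =
      replTensTerm C' D' n (tensTermMap f (replFun g) n y) := by
    refine (tensTermMap_comp _ _ _ _ n y).trans ?_
    refine Eq.trans ?_ (tensTermMap_comp _ _ _ _ n y).symm
    rw [replFun_replMap, Category.id_comp, Category.comp_id]
  rw [h1, gι_replTensTerm, gι_replTensTerm, ← kι_natural]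
  refine (homologyMap_tensMap_comp _ _ _ _ n _).trans ?_
  refine Eq.trans ?_ (homologyMap_tensMap_comp _ _ _ _ n _).symm
  rw [replFun_replMap, Category.id_comp, Category.comp_id]

theorem gπ_natural (x : (tens C D).homology n) :
    gπ C' D' hT' n (homologyMap (tensMap f g) n x) = torTermMap' f g n (gπ C D hT n x) := by
  obtain ⟨x, rfl⟩ := (replTens C D hT n).surjective x
  have h1 : homologyMap (tensMap f g) n (replTens C D hT n x) =
      replTens C' D' hT' n (homologyMap (tensMap f (replFun g)) n x) := by
    refine (homologyMap_tensMap_comp _ _ _ _ n _).trans ?_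
    refine Eq.trans ?_ (homologyMap_tensMap_comp _ _ _ _ n _).symm
    rw [replFun_replMap, Category.id_comp, Category.comp_id]
  rw [h1, gπ_replTens, gπ_replTens, kπ_natural]
  refine (torTermMap'_comp _ _ _ _ n _).trans ?_
  refine Eq.trans ?_ (torTermMap'_comp _ _ _ _ n _).symm
  rw [replFun_replMap, Category.id_comp, Category.comp_id]

/-- This is the five lemma for the Künneth sequences. It allows the first factor to be replaced too,
which only the splitting requires. -/
theorem kunneth_five [∀ j, Module.Projective R (D.X j)] (f : C' ⟶ C)
    (hf : ∀ n, Function.Bijective (homologyMap f n)) (n : ℕ) :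
    Function.Bijective (homologyMap (tensMap f (𝟙 D)) n) := by
  have hι := tensTermMap_bijective f (𝟙 D) hf (homologyMap_id_bijective D) n
  have hπ := torTermMap'_bijective f (𝟙 D) hf (homologyMap_id_bijective D) n
  constructor
  · rw [injective_iff_map_eq_zero]
    intro x hx
    have h1 := kπ_natural f (𝟙 D) n x
    rw [hx, map_zero] at h1
    have h2 : kπ C' D n x = 0 := hπ.1 (h1.symm.trans (map_zero _).symm)
    obtain ⟨y, rfl⟩ := (kunneth_exact C' D n x).1 h2
    rw [kι_natural] at hx
    have h3 := kι_injective C D n (hx.trans (map_zero _).symm)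
    rw [hι.1 (h3.trans (map_zero _).symm), map_zero]
  · intro z
    obtain ⟨t, ht⟩ := hπ.2 (kπ C D n z)
    obtain ⟨x, rfl⟩ := kπ_surjective C' D n t
    rw [← kπ_natural, ← sub_eq_zero, ← map_sub] at ht
    obtain ⟨y, hy⟩ := (kunneth_exact C D n _).1 ht
    obtain ⟨y, rfl⟩ := hι.2 y
    rw [← kι_natural] at hy
    refine ⟨x - kι C' D n y, ?_⟩
    rw [map_sub, hy, sub_sub_cancel]

variable (C D) in
-- The retraction for `repl C ⊗ repl D` is carried first to `C ⊗ repl D` and then to `C ⊗ D`.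
theorem exists_retraction_gι :
    ∃ l : (tens C D).homology n →ₗ[R] TensTerm C D n, ∀ y, l (gι C D hT n y) = y := by
  obtain ⟨l, hl⟩ := exists_retraction_kι (repl C) (repl D) n
  have hb := kunneth_five (C' := repl C) (D := repl D) (replMap C)
    (homologyMap_replMap_bijective C) n
  have hι := tensTermMap_bijective (replMap C) (𝟙 (repl D)) (homologyMap_replMap_bijective C)
    (homologyMap_id_bijective _) n
  let e := LinearEquiv.ofBijective (homologyMap (tensMap (replMap C) (𝟙 (repl D))) n).hom hb
  refine ⟨(replTensTerm C D n).toLinearMap ∘ₗ tensTermMap (replMap C) (𝟙 (repl D)) n ∘ₗ l ∘ₗ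
    e.symm.toLinearMap ∘ₗ (replTens C D hT n).symm.toLinearMap, fun y => ?_⟩
  obtain ⟨y, rfl⟩ := (replTensTerm C D n).surjective y
  obtain ⟨y, rfl⟩ := hι.2 y
  rw [gι_replTensTerm, ← kι_natural]
  have h1 : e.symm (homologyMap (tensMap (replMap C) (𝟙 (repl D))) n (kι (repl C) (repl D) n y)) =
    kι (repl C) (repl D) n y := e.symm_apply_apply _
  simp only [LinearMap.comp_apply, LinearEquiv.coe_coe, LinearEquiv.symm_apply_apply, h1, hl]

end general

end Kunneth
end

noncomputable section

namespace Kunneth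

open AlgebraicTopology Opposite

/-! ### Décalage -/

section decalage

/-- The functor that adjoins a new least vertex. -/
def sh : SimplexCategory ⥤ SimplexCategory where
  obj Δ := SimplexCategory.mk (Δ.len + 1)
  map f := SimplexCategory.mkHom ⟨Fin.cases 0 fun i => (f.toOrderHom i).succ, fun i j hij => by
    cases i using Fin.cases with
    | zero => exact Fin.zero_le _
    | succ i =>
      cases j using Fin.cases with
      | zero => exact absurd hij (by simp)
      | succ j => exact Fin.succ_le_succ_iff.2 (f.toOrderHom.monotone (Fin.succ_le_succ_iff.1 hij))⟩
  map_id Δ := by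
    ext i
    cases i using Fin.cases <;> rfl
  map_comp f g := by
    ext i
    cases i using Fin.cases <;> rfl

theorem sh_δ {n : ℕ} (i : Fin (n + 2)) :
    sh.map (SimplexCategory.δ i) = SimplexCategory.δ i.succ := by
  ext j
  cases j using Fin.cases with
  | zero => simp [sh, SimplexCategory.δ]; rfl
  | succ j =>
    exact congrArg Fin.val (Fin.succ_succAbove_succ (n := n + 1) i j).symm

/-- The inclusion of the old vertices. -/
def shInc : 𝟭 SimplexCategory ⟶ sh where
  app Δ := SimplexCategory.δ (n := Δ.len) 0
  naturality Δ Δ' f := by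
    ext j
    simp [sh, SimplexCategory.δ]
    rfl

variable {𝓒 : Type*} [Category* 𝓒] (B : SimplicialObject 𝓒)

/-- The décalage of a simplicial object. -/
abbrev dec : SimplicialObject 𝓒 := sh.op ⋙ B

/-- The décalage drops the face `δ 0`, which becomes the augmentation `decε`, and the degeneracy `σ
0`, which becomes a contraction. -/
theorem dec_δ {n : ℕ} (i : Fin (n + 2)) : (dec B).δ i = B.δ (n := n + 1) i.succ :=
  congrArg (fun f => B.map (Quiver.Hom.op f)) (sh_δ i)

variable [Preadditive 𝓒]

/-- The differential of a décalage. -/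
def decD (n : ℕ) : B.obj (op (SimplexCategory.mk (n + 2))) ⟶
    B.obj (op (SimplexCategory.mk (n + 1))) :=
  ∑ i : Fin (n + 2), (-1 : ℤ) ^ (i : ℕ) • B.δ (n := n + 1) i.succ

theorem dec_d (n : ℕ) : ((alternatingFaceMapComplex 𝓒).obj (dec B)).d (n + 1) n = decD B n :=
  (AlternatingFaceMapComplex.obj_d_eq _ _).trans
    (Finset.sum_congr rfl fun i _ => congrArg ((-1 : ℤ) ^ (i : ℕ) • ·) (dec_δ B i))

/-- In the alternating sum the first remaining face cancels `σ 0`. Every other face moves past `σ 0`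
with its index lowered by one, hence with the opposite sign. -/
theorem decD_succ (n : ℕ) : B.σ (n := n + 2) 0 ≫ decD B (n + 1) =
    𝟙 _ - decD B n ≫ B.σ (n := n + 1) 0 := by
  rw [decD, decD, Fin.sum_univ_succ, Preadditive.comp_add, Preadditive.comp_sum,
    Preadditive.sum_comp, sub_eq_add_neg, ← Finset.sum_neg_distrib]
  congr 1
  · rw [Preadditive.comp_zsmul, B.δ_comp_σ_succ (i := 0)]
    simp
  · refine Finset.sum_congr rfl fun i _ => ?_
    have := B.δ_comp_σ_of_gt (n := n + 1) (i := i.succ) (j := 0) (Fin.succ_pos i)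
    rw [Preadditive.comp_zsmul, Preadditive.zsmul_comp, ← this, ← neg_smul]
    congr 1
    rw [Fin.val_succ, pow_succ]
    ring

/-- At the bottom the contraction leaves over the composite through the zero-simplices: the décalage
resolves them instead of being acyclic. -/
theorem decD_zero : B.σ (n := 1) 0 ≫ decD B 0 =
    𝟙 _ - B.δ (n := 0) 1 ≫ B.σ (n := 0) 0 := by
  have h1 := B.δ_comp_σ_of_gt (n := 0) (i := 1) (j := 0) (Fin.zero_lt_one)
  have h2 := B.δ_comp_σ_succ (n := 1) (i := 0)
  rw [decD, Fin.sum_univ_two, Preadditive.comp_add, Preadditive.comp_zsmul,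
    Preadditive.comp_zsmul, ← h1, h2]
  simp [sub_eq_add_neg]

theorem decD_δ : decD B 0 ≫ B.δ (n := 0) 1 = 0 := by
  have h1 := B.δ_comp_δ_self (n := 0) (i := 1)
  rw [decD, Fin.sum_univ_two, Preadditive.add_comp, Preadditive.zsmul_comp,
    Preadditive.zsmul_comp]
  have h2 : B.δ (n := 1) (Fin.succ 0) ≫ B.δ (n := 0) 1 =
    B.δ (n := 1) (Fin.succ 1) ≫ B.δ (n := 0) 1 := h1
  rw [h2]
  simp

end decalage

end Kunneth
end

noncomputable section

namespace Kunneth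

open HomologicalComplex

/-! ### Dimension shifting -/

section shifting

universe v v' w w'

variable {𝓐 : Type w} [Category.{v} 𝓐] [Abelian 𝓐] {𝓜 : Type w'} [Category.{v'} 𝓜] [Abelian 𝓜]

/-- The kernel of an augmentation. -/
abbrev augSeq {P : 𝓐 ⥤ 𝓐} (ε : P ⟶ 𝟭 𝓐) (A : 𝓐) : ShortComplex 𝓐 :=
  ShortComplex.mk (kernel.ι (ε.app A)) (ε.app A) (kernel.condition _)

theorem augSeq_shortExact {P : 𝓐 ⥤ 𝓐} (ε : P ⟶ 𝟭 𝓐) (A : 𝓐) [Epi (ε.app A)] :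
    (augSeq ε A).ShortExact where
  exact := ShortComplex.exact_of_f_is_kernel _ (kernelIsKernel _)
  mono_f := inferInstanceAs (Mono (kernel.ι _))
  epi_g := inferInstanceAs (Epi (ε.app A))

/-- The map of kernels of augmentations. -/
abbrev augSeqMap {P : 𝓐 ⥤ 𝓐} (ε : P ⟶ 𝟭 𝓐) {A B : 𝓐} (f : A ⟶ B) : augSeq ε A ⟶ augSeq ε B where
  τ₁ := kernel.map _ _ (P.map f) f (ε.naturality f).symm
  τ₂ := P.map f
  τ₃ := f
  comm₁₂ := by simp
  comm₂₃ := ε.naturality f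

/-- An exact functor to chain complexes for which the augmentations are effacing. -/
structure Effacing {P : 𝓐 ⥤ 𝓐} (ε : P ⟶ 𝟭 𝓐) (Φ : 𝓐 ⥤ ChainComplex 𝓜 ℕ) : Prop where
  zero : Φ.PreservesZeroMorphisms
  exact : ∀ S : ShortComplex 𝓐, S.ShortExact → (S.map Φ).ShortExact
  acyclic : ∀ A n, IsZero ((Φ.obj (P.obj A)).homology (n + 1))

variable {P : 𝓐 ⥤ 𝓐} {ε : P ⟶ 𝟭 𝓐} [∀ A, Epi (ε.app A)] {Φ Ψ : 𝓐 ⥤ ChainComplex 𝓜 ℕ}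

/-- The connecting homomorphism. -/
def Effacing.δ (hΦ : Effacing ε Φ) (A : 𝓐) (n : ℕ) :
    (Φ.obj A).homology (n + 1) ⟶ (Φ.obj (kernel (ε.app A))).homology n :=
  haveI := hΦ.zero
  (hΦ.exact _ (augSeq_shortExact ε A)).δ (n + 1) n rfl

theorem Effacing.δ_natural (hΦ : Effacing ε Φ) {A B : 𝓐} (f : A ⟶ B) (n : ℕ) :
    homologyMap (Φ.map f) (n + 1) ≫ hΦ.δ B n =
      hΦ.δ A n ≫ homologyMap (Φ.map (augSeqMap ε f).τ₁) n :=
  haveI := hΦ.zero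
  (HomologicalComplex.HomologySequence.δ_naturality (Φ.mapShortComplex.map (augSeqMap ε f))
    (hΦ.exact _ (augSeq_shortExact ε A)) (hΦ.exact _ (augSeq_shortExact ε B)) (n + 1) n rfl).symm

theorem Effacing.mono_δ (hΦ : Effacing ε Φ) (A : 𝓐) (n : ℕ) : Mono (hΦ.δ A n) :=
  haveI := hΦ.zero
  (hΦ.exact _ (augSeq_shortExact ε A)).mono_δ (n + 1) n rfl (hΦ.acyclic A n)

theorem Effacing.δ_comp (hΦ : Effacing ε Φ) (A : 𝓐) (n : ℕ) :
    hΦ.δ A n ≫ homologyMap (Φ.map (kernel.ι (ε.app A))) n = 0 :=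
  haveI := hΦ.zero
  (hΦ.exact _ (augSeq_shortExact ε A)).δ_comp (n + 1) n rfl

/-- With `mono_δ`, this exhibits homology in degree `n + 1` as the kernel of a map between homology
groups in degree `n`. Such a kernel is determined by the homology functor in degree `n`. -/
theorem Effacing.exists_lift (hΦ : Effacing ε Φ) (A : 𝓐) (n : ℕ) {X : 𝓜}
    (k : X ⟶ (Φ.obj (kernel (ε.app A))).homology n)
    (hk : k ≫ homologyMap (Φ.map (kernel.ι (ε.app A))) n = 0) : ∃ l, l ≫ hΦ.δ A n = k := by
  have := hΦ.zero
  have := hΦ.mono_δ A n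
  have e := (hΦ.exact _ (augSeq_shortExact ε A)).homology_exact₁ (n + 1) n rfl
  have : Mono (ShortComplex.mk _ _
    ((hΦ.exact _ (augSeq_shortExact ε A)).δ_comp (n + 1) n rfl)).f := hΦ.mono_δ A n
  exact ⟨e.lift k hk, e.lift_f k hk⟩

/-- The functors `Φ` and `Ψ` have naturally isomorphic homology in degree `n`. -/
def HomIso {𝓐 : Type w} [Category.{v} 𝓐] (Φ Ψ : 𝓐 ⥤ ChainComplex 𝓜 ℕ) (n : ℕ) : Prop :=
  ∃ e : ∀ A, (Φ.obj A).homology n ≅ (Ψ.obj A).homology n, ∀ {A B : 𝓐} (f : A ⟶ B),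
    homologyMap (Φ.map f) n ≫ (e B).hom = (e A).hom ≫ homologyMap (Ψ.map f) n

theorem Effacing.exists_comm (hΦ : Effacing ε Φ) (hΨ : Effacing ε Ψ) {n : ℕ}
    (e : ∀ A, (Φ.obj A).homology n ⟶ (Ψ.obj A).homology n)
    (he : ∀ {A B : 𝓐} (f : A ⟶ B),
      homologyMap (Φ.map f) n ≫ e B = e A ≫ homologyMap (Ψ.map f) n) (A : 𝓐) :
    ∃ l : (Φ.obj A).homology (n + 1) ⟶ (Ψ.obj A).homology (n + 1),
      l ≫ hΨ.δ A n = hΦ.δ A n ≫ e (kernel (ε.app A)) := by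
  apply hΨ.exists_lift
  rw [Category.assoc, ← he, ← Category.assoc, hΦ.δ_comp, zero_comp]

/-- Exact functors to chain complexes for which the same augmentations are effacing have
isomorphic homology if they have isomorphic homology in degree zero. -/
theorem Effacing.homIso (hΦ : Effacing ε Φ) (hΨ : Effacing ε Ψ) (h₀ : HomIso Φ Ψ 0) (n : ℕ) :
    HomIso Φ Ψ n := by
  induction n with
  | zero => exact h₀
  | succ n ih =>
    obtain ⟨e, he⟩ := ih
    choose l hl using hΦ.exists_comm hΨ (fun A => (e A).hom) he
    choose m hm using hΨ.exists_comm hΦ (fun A => (e A).inv) fun {A B} f => by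
      rw [Iso.comp_inv_eq, Category.assoc, he, Iso.inv_hom_id_assoc]
    -- The connecting maps are monomorphisms, so the lifts `l` and `m` are unique. Their being
    -- inverse to each other and natural follows after composing with `δ`.
    have hlm : ∀ A, l A ≫ m A = 𝟙 _ := fun A => by
      have := hΦ.mono_δ A n
      rw [← cancel_mono (hΦ.δ A n), Category.assoc, hm, ← Category.assoc, hl, Category.assoc,
        Iso.hom_inv_id, Category.comp_id, Category.id_comp]
    have hml : ∀ A, m A ≫ l A = 𝟙 _ := fun A => by
      have := hΨ.mono_δ A n
      rw [← cancel_mono (hΨ.δ A n), Category.assoc, hl, ← Category.assoc, hm, Category.assoc,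
        Iso.inv_hom_id, Category.comp_id, Category.id_comp]
    refine ⟨fun A => ⟨l A, m A, hlm A, hml A⟩, fun {A B} f => ?_⟩
    have := hΨ.mono_δ B n
    rw [← cancel_mono (hΨ.δ B n), Category.assoc, hl, Category.assoc, hΨ.δ_natural,
      ← Category.assoc, hΦ.δ_natural, ← Category.assoc, hl, Category.assoc, Category.assoc, he]

end shifting

end Kunneth
end

noncomputable section

namespace Kunneth

open AlgebraicTopology Opposite HomologicalComplex DoubleComplex

/-! ### Bisimplicial modules -/

section bisimplicial

/-- Simplicial modules. -/
abbrev SMod (R : Type u) [CommRing R] := SimplexCategoryᵒᵖ ⥤ ModuleCat.{u} R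

/-- Bisimplicial modules. -/
abbrev BMod (R : Type u) [CommRing R] := SimplexCategoryᵒᵖ ⥤ SMod R

variable {R : Type u} [CommRing R]

/-- The terms of a bisimplicial module. -/
abbrev bX (A : BMod R) (p q : ℕ) : ModuleCat.{u} R :=
  (A.obj (op (SimplexCategory.mk p))).obj (op (SimplexCategory.mk q))

/-- The alternating complex of a simplicial module. -/
abbrev alt : SMod R ⥤ ChainComplex (ModuleCat.{u} R) ℕ :=
  alternatingFaceMapComplex (ModuleCat.{u} R)

/-- The alternating complex of simplicial modules of a bisimplicial module. -/
abbrev altOuter (A : BMod R) : ChainComplex (SMod R) ℕ := (alternatingFaceMapComplex (SMod R)).obj A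

/-- The double complex of a bisimplicial module. -/
def bisDouble (A : BMod R) : DoubleComplex R where
  X p q := bX A p q
  dh p q := (((altOuter A).d (p + 1) p).app (op (SimplexCategory.mk q))).hom
  dv p q := ((alt.obj (A.obj (op (SimplexCategory.mk p)))).d (q + 1) q).hom
  dh_dh p q x := by
    have := (altOuter A).d_comp_d (p + 2) (p + 1) p
    exact ConcreteCategory.congr_hom (NatTrans.congr_app this (op (SimplexCategory.mk q))) x
  dv_dv p q x := d_d_apply _ _ _ _ _
  dh_dv p q x := map_d_apply (alt.map ((altOuter A).d (p + 1) p)) (q + 1) q x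

/-- The morphism of double complexes induced by a map of bisimplicial modules. -/
def bisDoubleMap {A B : BMod R} (f : A ⟶ B) : DoubleComplex.Hom (bisDouble A) (bisDouble B) where
  f p q := ((f.app (op (SimplexCategory.mk p))).app (op (SimplexCategory.mk q))).hom
  comm_h p q x := by
    have := ((alternatingFaceMapComplex (SMod R)).map f).comm (p + 1) p
    exact (ConcreteCategory.congr_hom
      (NatTrans.congr_app this (op (SimplexCategory.mk q))) x).symm
  comm_v p q x := map_d_apply (alt.map (f.app (op (SimplexCategory.mk p)))) (q + 1) q x

variable (R) in
/-- The total complex of a bisimplicial module. -/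
def bisTot : BMod R ⥤ ChainComplex (ModuleCat.{u} R) ℕ where
  obj A := (bisDouble A).tot
  map f := totMap (bisDoubleMap f)

variable (R) in
/-- The diagonal of a bisimplicial module. -/
def bisDiag : BMod R ⥤ SMod R where
  obj A :=
    { obj n := (A.obj n).obj n
      map f := (A.map f).app _ ≫ (A.obj _).map f
      map_id n := by simp
      map_comp f g := by simp }
  map f :=
    { app n := (f.app n).app n
      naturality m n g := by
        have h1 := NatTrans.congr_app (f.naturality g) m
        have h2 := (f.app n).naturality g
        simp only [NatTrans.comp_app] at h1
        rw [Category.assoc, h2, ← Category.assoc, h1, Category.assoc] }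

/-- The décalage functor. -/
abbrev decFun (𝓔 : Type*) [Category* 𝓔] : (SimplexCategoryᵒᵖ ⥤ 𝓔) ⥤ (SimplexCategoryᵒᵖ ⥤ 𝓔) :=
  (Functor.whiskeringLeft _ _ _).obj sh.op

/-- The augmentation of the décalage. -/
def decε (𝓔 : Type*) [Category* 𝓔] : decFun 𝓔 ⟶ 𝟭 _ where
  app A :=
    { app p := A.map (shInc.app p.unop).op
      naturality p p' g := by
        change A.map (sh.map g.unop).op ≫ _ = _ ≫ A.map g
        rw [← A.map_comp, ← A.map_comp]
        exact congrArg (fun k => A.map (Quiver.Hom.op k)) (shInc.naturality g.unop).symm }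
  naturality A B f := NatTrans.ext (funext fun p => (f.naturality (shInc.app p.unop).op).symm)

/-- The double décalage. -/
def decDec : BMod R ⥤ BMod R :=
  decFun (SMod R) ⋙ (Functor.whiskeringRight _ _ _).obj (decFun (ModuleCat.{u} R))

/-- The augmentation of the double décalage. -/
def decDecε : decDec (R := R) ⟶ 𝟭 (BMod R) where
  app A := Functor.whiskerLeft (sh.op ⋙ A) (decε (ModuleCat.{u} R)) ≫ (decε (SMod R)).app A
  naturality A B f := by
    have h1 := (decε (SMod R)).naturality f
    have h2 : decDec.map f ≫ Functor.whiskerLeft (sh.op ⋙ B) (decε (ModuleCat.{u} R)) =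
        Functor.whiskerLeft (sh.op ⋙ A) (decε (ModuleCat.{u} R)) ≫ (decFun (SMod R)).map f :=
      NatTrans.ext (funext fun p => (decε (ModuleCat.{u} R)).naturality (f.app (sh.op.obj p)))
    exact (Category.assoc _ _ _).symm.trans ((congrArg (· ≫ (decε (SMod R)).app B) h2).trans
      ((Category.assoc _ _ _).trans ((congrArg (Functor.whiskerLeft (sh.op ⋙ A)
        (decε (ModuleCat.{u} R)) ≫ ·) h1).trans (Category.assoc _ _ _).symm)))

/-- In each degree the dropped degeneracy `σ 0` is a section of the dropped face `δ 0`. -/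
theorem epi_decε {𝓔 : Type*} [Category* 𝓔] (A : SimplexCategoryᵒᵖ ⥤ 𝓔) (p : SimplexCategoryᵒᵖ) :
    Epi (((decε 𝓔).app A).app p) := by
  have h : A.map (SimplexCategory.σ (n := p.unop.len) 0).op ≫ ((decε 𝓔).app A).app p = 𝟙 _ := by
    refine (A.map_comp _ _).symm.trans ?_
    refine (congrArg (fun k => A.map (Quiver.Hom.op k))
      (SimplexCategory.δ_comp_σ_self (n := p.unop.len) (i := 0))).trans ?_
    exact A.map_id p
  exact (SplitEpi.mk _ h).epi

instance (A : BMod R) : Epi (decDecε.app A) := by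
  have h1 : Epi (Functor.whiskerLeft (sh.op ⋙ A) (decε (ModuleCat.{u} R))) := by
    have : ∀ p, Epi ((Functor.whiskerLeft (sh.op ⋙ A) (decε (ModuleCat.{u} R))).app p) := fun p =>
      haveI : ∀ q, Epi (((decε (ModuleCat.{u} R)).app (A.obj (sh.op.obj p))).app q) :=
        epi_decε (A.obj (sh.op.obj p))
      NatTrans.epi_of_epi_app ((decε (ModuleCat.{u} R)).app (A.obj (sh.op.obj p)))
    exact NatTrans.epi_of_epi_app _
  have h2 : Epi ((decε (SMod R)).app A) :=
    haveI : ∀ p, Epi (((decε (SMod R)).app A).app p) := epi_decε A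
    NatTrans.epi_of_epi_app _
  exact epi_comp' h1 h2

/-! ### Exactness -/

theorem bX_exact {S : ShortComplex (BMod R)} (hS : S.ShortExact) (p q : SimplexCategoryᵒᵖ) :
    Function.Injective ((S.f.app p).app q) ∧ Function.Exact ((S.f.app p).app q)
      ((S.g.app p).app q) ∧ Function.Surjective ((S.g.app p).app q) := by
  have h := hS.map_of_exact ((evaluation SimplexCategoryᵒᵖ (SMod R)).obj p ⋙
    (evaluation SimplexCategoryᵒᵖ (ModuleCat.{u} R)).obj q)
  refine ⟨h.moduleCat_injective_f, ?_, h.moduleCat_surjective_g⟩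
  exact (ShortComplex.ShortExact.moduleCat_exact_iff_function_exact _).1 h.exact

theorem bisTot_exact (S : ShortComplex (BMod R)) (hS : S.ShortExact)
    [(bisTot R).PreservesZeroMorphisms] : (S.map (bisTot R)).ShortExact :=
  (tot_shortExact (bisDoubleMap S.f) (bisDoubleMap S.g) (fun _ _ => (bX_exact hS _ _).1)
    (fun _ _ => (bX_exact hS _ _).2.1) (fun _ _ => (bX_exact hS _ _).2.2)).2

variable (R) in
/-- The alternating complex of the diagonal of a bisimplicial module. -/
def diagCx : BMod R ⥤ ChainComplex (ModuleCat.{u} R) ℕ := bisDiag R ⋙ alt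

theorem diagCx_exact (S : ShortComplex (BMod R)) (hS : S.ShortExact)
    [(diagCx R).PreservesZeroMorphisms] : (S.map (diagCx R)).ShortExact :=
  HomologicalComplex.shortExact_of_degreewise_shortExact _ fun _ =>
    ModuleCat.shortComplex_shortExact _ (bX_exact hS _ _).2.1 (bX_exact hS _ _).1
      (bX_exact hS _ _).2.2

instance : (bisTot R).PreservesZeroMorphisms where
  map_zero _ _ := rfl

instance : (diagCx R).PreservesZeroMorphisms where
  map_zero _ _ := rfl

/-! ### Acyclicity -/

/-- The diagonal of the double décalage is the décalage of the diagonal, so its own extra degeneracy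
contracts it. -/
theorem isZero_diagCx_decDec (A : BMod R) (n : ℕ) :
    IsZero (((diagCx R).obj (decDec.obj A)).homology (n + 1)) := by
  apply @ModuleCat.isZero_of_subsingleton _ _ _ ⟨fun a b => ?_⟩
  rw [← sub_eq_zero]
  obtain ⟨x, hx⟩ := cls_surjective _ _ (a - b)
  rw [← hx, cls_eq_zero_iff]
  let B : SMod R := (bisDiag R).obj A
  have h0 : decD B n x.1 = 0 :=
    (ConcreteCategory.congr_hom (dec_d B n) x.1).symm.trans (mem_cyc_succ.1 x.2)
  have key : ∀ y : B.obj (op (SimplexCategory.mk (n + 2))), decD B n y = 0 →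
      decD B (n + 1) (SimplicialObject.σ B (n := n + 2) 0 y) = y := fun y hy => by
    refine (ConcreteCategory.congr_hom (decD_succ B n) y).trans ?_
    change y - SimplicialObject.σ B (n := n + 1) 0 (decD B n y) = y
    rw [hy, map_zero, sub_zero]
  exact ⟨B.map (SimplexCategory.σ (n := n + 2) 0).op x.1,
    (ConcreteCategory.congr_hom (dec_d B (n + 1)) _).trans (key x.1 h0)⟩

end bisimplicial

end Kunneth
end

/-! ### Acyclicity of total complexes and the comparison in degree zero -/

noncomputable section

namespace Kunneth

open AlgebraicTopology Opposite HomologicalComplex DoubleComplex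

variable {R : Type u} [CommRing R]

/-- The maps `h` contract the horizontal direction onto the complex `L`, which `t` contracts in
turn. For a cycle, `h` produces a bounding chain except for an error in column zero, and `s ∘ t ∘ a`
corrects that error. -/
theorem tot_acyclic (A : DoubleComplex R) (L : ℕ → ModuleCat.{u} R)
    (dL : ∀ q, L (q + 1) →ₗ[R] L q) (h : ∀ p q, A.X p q →ₗ[R] A.X (p + 1) q)
    (a : ∀ q, A.X 0 q →ₗ[R] L q) (s : ∀ q, L q →ₗ[R] A.X 0 q) (t : ∀ q, L q →ₗ[R] L (q + 1))
    (hv : ∀ p q x, A.dv (p + 1) q (h p (q + 1) x) = h p q (A.dv p q x))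
    (hs : ∀ p q x, A.dh (p + 1) q (h (p + 1) q x) = x - h p q (A.dh p q x))
    (hz : ∀ q x, A.dh 0 q (h 0 q x) = x - s q (a q x))
    (adh : ∀ q x, a q (A.dh 0 q x) = 0)
    (sv : ∀ q y, A.dv 0 q (s (q + 1) y) = s q (dL q y))
    (av : ∀ q x, a q (A.dv 0 q x) = dL q (a (q + 1) x))
    (ht : ∀ q y, dL (q + 1) (t (q + 1) y) = y - t q (dL q y)) (n : ℕ) :
    Subsingleton (A.tot.homology (n + 1)) := by
  refine ⟨fun b b' => ?_⟩
  rw [← sub_eq_zero]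
  obtain ⟨x, hx⟩ := cls_surjective _ _ (b - b')
  rw [← hx, cls_eq_zero_iff]
  let x' : A.TotX (n + 1) := x.1
  have hc : ∀ p q (hpq : p + q + 1 = n + 1), A.dh p q (x' ⟨(p + 1, q), by simp; omega⟩) +
      (-1 : R) ^ p • A.dv p q (x' ⟨(p, q + 1), by simp; omega⟩) = 0 := (mem_cyc_tot A x').1 x.2
  let y : A.TotX (n + 2) := fun c => match c with
    | ⟨(0, 0), _⟩ => 0
    | ⟨(0, q + 1), hq⟩ => s (q + 1) (t q (a q (x' ⟨(0, q), by simp at hq ⊢; omega⟩)))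
    | ⟨(p + 1, q), hq⟩ => h p q (x' ⟨(p, q), by simp at hq ⊢; omega⟩)
  refine ⟨y, (tot_d_apply A (n + 1) y).trans ?_⟩
  funext ⟨⟨p, q⟩, hpq⟩
  rw [totD_apply]
  have hpq' : p + q = n + 1 := hpq
  cases p with
  | zero =>
    obtain rfl : q = n + 1 := by omega
    have h1 := congrArg (a n) (hc 0 n (by omega))
    rw [map_add, adh, map_zero, zero_add, pow_zero, one_smul, av] at h1
    change A.dh 0 (n + 1) (h 0 (n + 1) (x' ⟨(0, n + 1), hpq⟩)) + (-1 : R) ^ 0 •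
      A.dv 0 (n + 1) (s (n + 2) (t (n + 1) (a (n + 1) (x' ⟨(0, n + 1), hpq⟩)))) =
      x' ⟨(0, n + 1), hpq⟩
    rw [hz, sv, ht, h1, map_zero, sub_zero, pow_zero, one_smul, sub_add_cancel]
  | succ p =>
    change A.dh (p + 1) q (h (p + 1) q (x' ⟨(p + 1, q), hpq⟩)) + (-1 : R) ^ (p + 1) •
      A.dv (p + 1) q (h p (q + 1) (x' ⟨(p, q + 1), _⟩)) = x' ⟨(p + 1, q), hpq⟩
    have h1 := congrArg (h p q) (hc p q (by omega))
    rw [map_add, map_zero, map_smul] at h1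
    rw [hs, hv, pow_succ, mul_neg_one, neg_smul, ← sub_eq_add_neg, sub_sub, h1, sub_zero]

/-- The outer décalage contracts horizontally onto the décalage of the zeroth column, which the
inner extra degeneracy contracts vertically. -/
theorem isZero_bisTot_decDec (A : BMod R) (n : ℕ) :
    IsZero (((bisTot R).obj (decDec.obj A)).homology (n + 1)) := by
  let B : SimplicialObject (SMod R) := A ⋙ decFun (ModuleCat.{u} R)
  let E : SimplicialObject (ModuleCat.{u} R) := A.obj (op (SimplexCategory.mk 0))
  have edh : ∀ p, (altOuter (decDec.obj A)).d (p + 1) p = decD B p := dec_d B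
  apply @ModuleCat.isZero_of_subsingleton _ _ _ (tot_acyclic (bisDouble (decDec.obj A))
    (fun q => (dec E).obj (op (SimplexCategory.mk q)))
    (fun q => ((alt.obj (dec E)).d (q + 1) q).hom)
    (fun p q => ((B.σ (n := p + 1) 0).app (op (SimplexCategory.mk q))).hom)
    (fun q => ((B.δ (n := 0) 1).app (op (SimplexCategory.mk q))).hom)
    (fun q => ((B.σ (n := 0) 0).app (op (SimplexCategory.mk q))).hom)
    (fun q => (E.σ (n := q + 1) 0).hom) ?_ ?_ ?_ ?_ ?_ ?_ ?_ n)
  · intro p q x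
    exact (map_d_apply (alt.map (B.σ (n := p + 1) 0)) (q + 1) q x).symm
  · intro p q x
    have h1 := ConcreteCategory.congr_hom (NatTrans.congr_app (decD_succ B p)
      (op (SimplexCategory.mk q))) x
    rw [← edh, ← edh] at h1
    exact h1
  · intro q x
    have h1 := ConcreteCategory.congr_hom (NatTrans.congr_app (decD_zero B)
      (op (SimplexCategory.mk q))) x
    rw [← edh] at h1
    exact h1
  · intro q x
    have h1 := ConcreteCategory.congr_hom (NatTrans.congr_app (decD_δ B)
      (op (SimplexCategory.mk q))) x
    rw [← edh] at h1
    exact h1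
  · intro q x
    exact (map_d_apply (alt.map (B.σ (n := 0) 0)) (q + 1) q x).symm
  · intro q x
    exact (map_d_apply (alt.map (B.δ (n := 0) 1)) (q + 1) q x)
  · intro q x
    have h1 := ConcreteCategory.congr_hom (decD_succ E q) x
    rw [← dec_d, ← dec_d] at h1
    exact h1

theorem effacing_bisTot : Effacing (decDecε (R := R)) (bisTot R) where
  zero := inferInstance
  exact S hS := bisTot_exact S hS
  acyclic := isZero_bisTot_decDec

theorem effacing_diagCx : Effacing (decDecε (R := R)) (diagCx R) where
  zero := inferInstance
  exact S hS := diagCx_exact S hS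
  acyclic := isZero_diagCx_decDec

theorem alt_d_zero {𝓒 : Type*} [Category* 𝓒] [Preadditive 𝓒] (B : SimplicialObject 𝓒) :
    ((alternatingFaceMapComplex 𝓒).obj B).d 1 0 = B.δ (n := 0) 0 - B.δ (n := 0) 1 := by
  refine (AlternatingFaceMapComplex.obj_d_eq B 0).trans ?_
  rw [Fin.sum_univ_two]
  simp [sub_eq_add_neg]

/-- The horizontal faces in degree one. -/
abbrev bδh (A : BMod R) (i : Fin 2) (q : ℕ) : bX A 1 q →ₗ[R] bX A 0 q :=
  ((SimplicialObject.δ (n := 0) A i).app (op (SimplexCategory.mk q))).hom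

/-- The vertical faces in degree one. -/
abbrev bδv (A : BMod R) (i : Fin 2) (p : ℕ) : bX A p 1 →ₗ[R] bX A p 0 :=
  (SimplicialObject.δ (n := 0) (A.obj (op (SimplexCategory.mk p))) i).hom

/-- The horizontal degeneracy in degree zero. -/
abbrev bσh (A : BMod R) (q : ℕ) : bX A 0 q →ₗ[R] bX A 1 q :=
  ((SimplicialObject.σ (n := 0) A 0).app (op (SimplexCategory.mk q))).hom

/-- The vertical degeneracy in degree zero. -/
abbrev bσv (A : BMod R) (p : ℕ) : bX A p 0 →ₗ[R] bX A p 1 :=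
  (SimplicialObject.σ (n := 0) (A.obj (op (SimplexCategory.mk p))) 0).hom

theorem bδv_bδh (A : BMod R) (i j : Fin 2) (x : bX A 1 1) :
    bδv A i 0 (bδh A j 1 x) = bδh A j 0 (bδv A i 1 x) :=
  (ConcreteCategory.congr_hom ((SimplicialObject.δ (n := 0) A j).naturality
    (SimplexCategory.δ (n := 0) i).op) x).symm

theorem bδh_bσv (A : BMod R) (j : Fin 2) (x : bX A 1 0) :
    bδh A j 1 (bσv A 1 x) = bσv A 0 (bδh A j 0 x) :=
  ConcreteCategory.congr_hom ((SimplicialObject.δ (n := 0) A j).naturality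
    (SimplexCategory.σ (n := 0) 0).op) x

theorem δ_σ_one {𝓒 : Type*} [Category* 𝓒] (B : SimplicialObject 𝓒) (i : Fin 2) :
    B.σ (n := 0) 0 ≫ B.δ (n := 0) i = 𝟙 _ := by
  fin_cases i
  · exact B.δ_comp_σ_self (n := 0) (i := 0)
  · exact B.δ_comp_σ_succ (n := 0) (i := 0)

theorem bδv_bσv (A : BMod R) (i : Fin 2) (p : ℕ) (x : bX A p 0) : bδv A i p (bσv A p x) = x :=
  ConcreteCategory.congr_hom (δ_σ_one (A.obj (op (SimplexCategory.mk p))) i) x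

theorem bδh_bσh (A : BMod R) (i : Fin 2) (q : ℕ) (x : bX A 0 q) : bδh A i q (bσh A q x) = x :=
  ConcreteCategory.congr_hom (NatTrans.congr_app (δ_σ_one A i) (op (SimplexCategory.mk q))) x

theorem bδ_bσ (A : BMod R) (z : bX A 1 0) (w : bX A 0 1) :
    bδv A 0 0 (bδh A 0 1 (bσv A 1 z + bσh A 1 w)) - bδv A 1 0 (bδh A 1 1 (bσv A 1 z + bσh A 1 w)) =
      (bδh A 0 0 z - bδh A 1 0 z) + (bδv A 0 0 w - bδv A 1 0 w) := by
  simp only [map_add, bδh_bσv, bδv_bσv, bδh_bσh]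
  abel

theorem diagCx_d_zero (A : BMod R) (x : bX A 1 1) : ((diagCx R).obj A).d 1 0 x =
    bδv A 0 0 (bδh A 0 1 x) - bδv A 1 0 (bδh A 1 1 x) :=
  ConcreteCategory.congr_hom (alt_d_zero ((bisDiag R).obj A)) x

theorem bisTot_d_zero (A : BMod R) (y : (bisDouble A).TotX 1) :
    (show (bisDouble A).TotX 0 from ((bisTot R).obj A).d 1 0 y) ⟨(0, 0), rfl⟩ =
      (bδh A 0 0 (y ⟨(1, 0), rfl⟩) - bδh A 1 0 (y ⟨(1, 0), rfl⟩)) +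
        (bδv A 0 0 (y ⟨(0, 1), rfl⟩) - bδv A 1 0 (y ⟨(0, 1), rfl⟩)) := by
  refine (congrFun (tot_d_apply (bisDouble A) 0 y) ⟨(0, 0), rfl⟩).trans ?_
  rw [totD_apply, pow_zero, one_smul]
  refine congrArg₂ (· + ·) ?_ ?_
  · exact ConcreteCategory.congr_hom (NatTrans.congr_app (alt_d_zero A)
      (op (SimplexCategory.mk 0))) _
  · exact ConcreteCategory.congr_hom (alt_d_zero (A.obj (op (SimplexCategory.mk 0)))) _

/-- The isomorphism of the degree zero term of a double complex with that of its total complex. -/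
def totZero (A : DoubleComplex R) : A.X 0 0 ≃ₗ[R] A.TotX 0 where
  toFun x := fun c => match c with
    | ⟨(0, 0), _⟩ => x
    | ⟨(_ + 1, _), h⟩ => by simp at h
    | ⟨(0, _ + 1), h⟩ => by simp at h
  map_add' x y := by
    funext ⟨⟨p, q⟩, h⟩
    obtain ⟨rfl, rfl⟩ : p = 0 ∧ q = 0 := by simp at h; omega
    rfl
  map_smul' x y := by
    funext ⟨⟨p, q⟩, h⟩
    obtain ⟨rfl, rfl⟩ : p = 0 ∧ q = 0 := by simp at h; omega
    rfl
  invFun y := y ⟨(0, 0), rfl⟩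
  left_inv _ := rfl
  right_inv y := by
    funext ⟨⟨p, q⟩, h⟩
    obtain ⟨rfl, rfl⟩ : p = 0 ∧ q = 0 := by simp at h; omega
    rfl

/-- A cycle in degree zero. -/
def cycZero (K : ChainComplex (ModuleCat.{u} R) ℕ) : K.X 0 →ₗ[R] cyc K 0 :=
  LinearMap.codRestrict _ LinearMap.id fun x => mem_cyc_zero K x

/-- Both groups are quotients of the `(0, 0)` term, and their boundaries coincide. A horizontal and
a vertical edge become diagonal ones by degenerating in the other direction; conversely, the
diagonal of a square is homologous to a path along two of its sides. -/
theorem homIso_zero : HomIso (bisTot R) (diagCx R) 0 := by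
  let f (A : BMod R) : ((bisTot R).obj A).homology 0 →ₗ[R] ((diagCx R).obj A).homology 0 :=
    homDesc _ _ (cls _ _ ∘ₗ cycZero ((diagCx R).obj A) ∘ₗ (totZero (bisDouble A)).symm.toLinearMap
      ∘ₗ (cyc ((bisTot R).obj A) 0).subtype) fun y => by
      refine (cls_eq_zero_iff _ _).2
        ⟨bσv A 1 ((y : (bisDouble A).TotX 1) ⟨(1, 0), rfl⟩) +
          bσh A 1 ((y : (bisDouble A).TotX 1) ⟨(0, 1), rfl⟩), ?_⟩
      refine Eq.trans ?_ (bisTot_d_zero A y).symm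
      exact (diagCx_d_zero A _).trans (bδ_bσ A _ _)
  let g (A : BMod R) : ((diagCx R).obj A).homology 0 →ₗ[R] ((bisTot R).obj A).homology 0 :=
    homDesc _ _ (cls _ _ ∘ₗ cycZero ((bisTot R).obj A) ∘ₗ (totZero (bisDouble A)).toLinearMap
      ∘ₗ (cyc ((diagCx R).obj A) 0).subtype) fun x => by
      let x' : bX A 1 1 := x
      let y : (bisDouble A).TotX 1 := fun c => match c with
        | ⟨(1, 0), _⟩ => bδv A 0 1 x'
        | ⟨(0, 1), _⟩ => bδh A 1 1 x'
        | ⟨(0, 0), h⟩ => by simp at h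
        | ⟨(0, _ + 2), h⟩ => by simp at h
        | ⟨(1, _ + 1), h⟩ => by simp at h
        | ⟨(_ + 2, _), h⟩ => by simp at h; omega
      refine (cls_eq_zero_iff _ _).2 ⟨y, ?_⟩
      apply (totZero (bisDouble A)).symm.injective
      refine (bisTot_d_zero A y).trans ?_
      refine Eq.trans ?_ (diagCx_d_zero A x').symm
      change bδh A 0 0 (bδv A 0 1 x') - bδh A 1 0 (bδv A 0 1 x') +
        (bδv A 0 0 (bδh A 1 1 x') - bδv A 1 0 (bδh A 1 1 x')) = _
      rw [bδv_bδh A 0 0, bδv_bδh A 0 1]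
      abel
  have hf (A : BMod R) (x) : f A (cls _ _ x) =
      cls _ _ (cycZero ((diagCx R).obj A) ((totZero (bisDouble A)).symm x.1)) := homDesc_cls _ _ _
  have hg (A : BMod R) (x) : g A (cls _ _ x) =
      cls _ _ (cycZero ((bisTot R).obj A) (totZero (bisDouble A) x.1)) := homDesc_cls _ _ _
  refine ⟨fun A => LinearEquiv.toModuleIso (LinearEquiv.ofLinearMap (f A) (g A)
    (homology_ext fun x => ?_) (homology_ext fun x => ?_)), fun {A B} k => ?_⟩
  · exact (congrArg (f A) (hg A x)).trans (hf A _)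
  · refine (congrArg (g A) (hf A x)).trans ((hg A _).trans ?_)
    exact congrArg (cls _ _) (Subtype.ext ((totZero (bisDouble A)).apply_symm_apply x.1))
  · refine ModuleCat.hom_ext (homology_ext fun x => ?_)
    refine (congrArg (f B) (homologyMap_cls _ x)).trans ((hf B _).trans ?_)
    refine Eq.trans ?_ (congrArg (homologyMap ((diagCx R).map k) 0) (hf A x)).symm
    refine Eq.trans ?_ (homologyMap_cls ((diagCx R).map k)
      (cycZero ((diagCx R).obj A) ((totZero (bisDouble A)).symm x.1))).symm
    exact congrArg (cls _ 0) (Subtype.ext rfl)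

/-- The homology of the diagonal of a bisimplicial module is naturally isomorphic to that of its
total complex. -/
theorem eilenbergZilber (n : ℕ) : HomIso (bisTot R) (diagCx R) n :=
  effacing_bisTot.homIso effacing_diagCx homIso_zero n

end Kunneth
end

noncomputable section

namespace Kunneth

open AlgebraicTopology Opposite HomologicalComplex DoubleComplex
open scoped TensorProduct

variable {R : Type u} [CommRing R]

/-! ### Coproducts of copies of a module -/

section copies

/-- The coproduct of copies of `G` indexed by `ι`. -/
abbrev copies (ι : Type u) (G : ModuleCat.{u} R) : ModuleCat.{u} R := (sigmaConst.obj G).obj ι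

/-- The inclusion of a summand. -/
abbrev copiesι {ι : Type u} (G : ModuleCat.{u} R) (i : ι) : G ⟶ copies ι G :=
  Sigma.ι (fun _ : ι => G) i

theorem copies_hom_ext {ι : Type u} {G T : ModuleCat.{u} R} {f g : copies ι G ⟶ T}
    (h : ∀ i, copiesι G i ≫ f = copiesι G i ≫ g) : f = g :=
  Sigma.hom_ext _ _ h

theorem copiesι_map {ι κ : Type u} {G : ModuleCat.{u} R} (f : ι ⟶ κ) (i : ι) :
    copiesι G i ≫ (sigmaConst.obj G).map f = copiesι G (f i) := by
  simp [copiesι, sigmaConst, Sigma.map']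

theorem copiesι_map_app {ι : Type u} {G G' : ModuleCat.{u} R} (φ : G ⟶ G') (i : ι) :
    copiesι G i ≫ (sigmaConst.map φ).app ι = φ ≫ copiesι G' i := by
  simp [copiesι, sigmaConst]

/-- A coproduct of copies consists of finitely supported functions. -/
def copiesEquiv (ι : Type u) (G : ModuleCat.{u} R) : copies ι G ≃ₗ[R] (ι →₀ G) :=
  LinearEquiv.ofLinearMap
    (Sigma.desc (fun i : ι => ModuleCat.ofHom (Finsupp.lsingle (R := R) (M := G) i))).hom
    (Finsupp.lsum R fun i => (copiesι G i).hom)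
    (by ext i g j; simp)
    (congrArg ModuleCat.Hom.hom (copies_hom_ext (G := G)
      (f := Sigma.desc (fun i : ι => ModuleCat.ofHom (Finsupp.lsingle (R := R) (M := G) i)) ≫
        ModuleCat.ofHom (Finsupp.lsum R fun i => (copiesι G i).hom))
      (g := 𝟙 _) fun i => by ext; simp))

theorem copiesEquiv_ι {ι : Type u} (G : ModuleCat.{u} R) (i : ι) (g : G) :
    copiesEquiv ι G (copiesι G i g) = Finsupp.single i g :=
  ConcreteCategory.congr_hom (Sigma.ι_desc (fun i : ι =>
    ModuleCat.ofHom (Finsupp.lsingle (R := R) (M := G) i)) i) g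

theorem copiesEquiv_symm_single {ι : Type u} (G : ModuleCat.{u} R) (i : ι) (g : G) :
    (copiesEquiv ι G).symm (Finsupp.single i g) = copiesι G i g := by
  rw [LinearEquiv.symm_apply_eq, copiesEquiv_ι]

/-- The comparison of copies of a tensor product with a tensor product of copies. -/
def prodCopies {ι κ μ : Type u} (f : μ ⟶ ι) (g : μ ⟶ κ) (G G' : ModuleCat.{u} R) :
    copies μ (G ⊗ G') ⟶ copies ι G ⊗ copies κ G' :=
  Sigma.desc fun m => copiesι G (f m) ⊗ₘ copiesι G' (g m)

theorem ι_prodCopies {ι κ μ : Type u} (f : μ ⟶ ι) (g : μ ⟶ κ) (G G' : ModuleCat.{u} R) (m : μ) :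
    copiesι (G ⊗ G') m ≫ prodCopies f g G G' = copiesι G (f m) ⊗ₘ copiesι G' (g m) :=
  Sigma.ι_desc _ _

theorem prodCopies_map {ι κ μ ι' κ' μ' : Type u} {f : μ ⟶ ι} {g : μ ⟶ κ} {f' : μ' ⟶ ι'}
    {g' : μ' ⟶ κ'} (c : μ ⟶ μ') (a : ι ⟶ ι') (b : κ ⟶ κ') (hf : ∀ m, f' (c m) = a (f m))
    (hg : ∀ m, g' (c m) = b (g m)) {G G' : ModuleCat.{u} R} :
    (sigmaConst.obj (G ⊗ G')).map c ≫ prodCopies f' g' G G' =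
      prodCopies f g G G' ≫ ((sigmaConst.obj G).map a ⊗ₘ (sigmaConst.obj G').map b) := by
  refine copies_hom_ext fun m => ?_
  rw [← Category.assoc, copiesι_map, ι_prodCopies, ← Category.assoc, ι_prodCopies,
    tensorHom_comp_tensorHom, copiesι_map, copiesι_map, hf, hg]

theorem prodCopies_coeff {ι κ μ : Type u} (f : μ ⟶ ι) (g : μ ⟶ κ)
    {G G₁ G' G₁' : ModuleCat.{u} R} (φ : G ⟶ G₁) (ψ : G' ⟶ G₁') :
    (sigmaConst.map (φ ⊗ₘ ψ)).app μ ≫ prodCopies f g G₁ G₁' =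
      prodCopies f g G G' ≫ ((sigmaConst.map φ).app ι ⊗ₘ (sigmaConst.map ψ).app κ) := by
  refine copies_hom_ext fun m => ?_
  rw [← Category.assoc, copiesι_map_app, Category.assoc, ι_prodCopies, ← Category.assoc,
    ι_prodCopies, tensorHom_comp_tensorHom, tensorHom_comp_tensorHom, copiesι_map_app,
    copiesι_map_app]

/-- The tensor product distributes over both direct sums, and the index set `μ` is the product of
`ι` and `κ`. -/
theorem prodCopies_bijective {ι κ μ : Type u} (f : μ ⟶ ι) (g : μ ⟶ κ)
    (h : Function.Bijective fun m => (f m, g m)) (G G' : ModuleCat.{u} R) :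
    Function.Bijective (prodCopies f g G G') := by
  let e : copies μ (G ⊗ G') ≃ₗ[R] (copies ι G ⊗[R] copies κ G') :=
    (copiesEquiv μ (G ⊗ G')).trans ((Finsupp.domLCongr (Equiv.ofBijective _ h)).trans
      ((finsuppTensorFinsupp R R G G' ι κ).symm.trans
        (TensorProduct.congr (copiesEquiv ι G).symm (copiesEquiv κ G').symm)))
  have he : prodCopies f g G G' = ModuleCat.ofHom e.toLinearMap := by
    refine copies_hom_ext fun m => ?_
    rw [ι_prodCopies]
    refine ModuleCat.hom_ext (TensorProduct.ext' fun x y => ?_)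
    change (copiesι G (f m) x) ⊗ₜ[R] (copiesι G' (g m) y) = e (copiesι (G ⊗ G') m (x ⊗ₜ[R] y))
    have h1 := copiesEquiv_ι (G ⊗ G') m (x ⊗ₜ[R] y)
    simp only [e, LinearEquiv.trans_apply]
    rw [h1]
    erw [Finsupp.domLCongr_single, finsuppTensorFinsupp_symm_single, TensorProduct.congr_tmul,
      copiesEquiv_symm_single, copiesEquiv_symm_single]
    rfl
  rw [he]
  exact e.bijective

end copies

/-! ### External products -/

/-- The external product of simplicial modules. -/
def extProd (S T : SMod R) : BMod R :=
  S ⋙ curriedTensor (ModuleCat.{u} R) ⋙ (Functor.whiskeringLeft _ _ _).obj T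

/-- The external product of maps of simplicial modules. -/
def extProdMap {S S' T T' : SMod R} (f : S ⟶ S') (g : T ⟶ T') : extProd S T ⟶ extProd S' T' where
  app p :=
    { app q := f.app p ⊗ₘ g.app q
      naturality q q' h := by
        change S.obj p ◁ T.map h ≫ (f.app p ⊗ₘ g.app q') =
          (f.app p ⊗ₘ g.app q) ≫ S'.obj p ◁ T'.map h
        simp [← id_tensorHom] }
  naturality p p' h := NatTrans.ext (funext fun q => by
    change S.map h ▷ T.obj q ≫ (f.app p' ⊗ₘ g.app q) = (f.app p ⊗ₘ g.app q) ≫ S'.map h ▷ T'.obj q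
    simp [← tensorHom_id])

theorem altSum_whiskerRight_tmul {A A' B : ModuleCat.{u} R} {m : ℕ} (f : Fin m → (A ⟶ A')) (x : A)
    (y : B) : (∑ i : Fin m, (-1 : ℤ) ^ (i : ℕ) • (f i ▷ B)).hom (x ⊗ₜ[R] y) =
      (∑ i : Fin m, (-1 : ℤ) ^ (i : ℕ) • f i).hom x ⊗ₜ[R] y := by
  rw [ModuleCat.hom_sum, ModuleCat.hom_sum, LinearMap.sum_apply, LinearMap.sum_apply,
    TensorProduct.sum_tmul]
  refine Finset.sum_congr rfl fun i _ => ?_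
  rw [ModuleCat.hom_zsmul, LinearMap.smul_apply, ModuleCat.hom_zsmul, LinearMap.smul_apply,
    ← TensorProduct.smul_tmul']
  rfl

theorem altSum_whiskerLeft_tmul {A B B' : ModuleCat.{u} R} {m : ℕ} (f : Fin m → (B ⟶ B')) (x : A)
    (y : B) : (∑ i : Fin m, (-1 : ℤ) ^ (i : ℕ) • (A ◁ f i)).hom (x ⊗ₜ[R] y) =
      x ⊗ₜ[R] (∑ i : Fin m, (-1 : ℤ) ^ (i : ℕ) • f i).hom y := by
  rw [ModuleCat.hom_sum, ModuleCat.hom_sum, LinearMap.sum_apply, LinearMap.sum_apply,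
    TensorProduct.tmul_sum]
  refine Finset.sum_congr rfl fun i _ => ?_
  rw [ModuleCat.hom_zsmul, LinearMap.smul_apply, ModuleCat.hom_zsmul, LinearMap.smul_apply,
    TensorProduct.tmul_smul]
  rfl

/-- The terms agree by definition, so the isomorphism of total complexes is the identity on modules
once the differentials agree on pure tensors. -/
theorem bisDouble_extProd_dh (S T : SMod R) (p q : ℕ)
    (x : (S.obj (op (SimplexCategory.mk (p + 1)))) ⊗[R] (T.obj (op (SimplexCategory.mk q)))) :
    (bisDouble (extProd S T)).dh p q x =
      (tensorDouble (alt.obj S) (alt.obj T)).dh p q x := by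
  have e1 : (altOuter (extProd S T)).d (p + 1) p =
      ∑ i : Fin (p + 2), (-1 : ℤ) ^ (i : ℕ) • SimplicialObject.δ (extProd S T) i :=
    AlternatingFaceMapComplex.obj_d_eq _ _
  have e2 : (alt.obj S).d (p + 1) p =
      ∑ i : Fin (p + 2), (-1 : ℤ) ^ (i : ℕ) • SimplicialObject.δ S i :=
    AlternatingFaceMapComplex.obj_d_eq _ _
  induction x with
  | zero => exact (map_zero ((bisDouble (extProd S T)).dh p q)).trans (map_zero _).symm
  | add x y hx hy =>
    exact (map_add ((bisDouble (extProd S T)).dh p q) x y).trans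
      ((congrArg₂ (· + ·) hx hy).trans (map_add _ x y).symm)
  | tmul x y =>
    change (((altOuter (extProd S T)).d (p + 1) p).app (op (SimplexCategory.mk q))) (x ⊗ₜ y) =
      ((alt.obj S).d (p + 1) p x) ⊗ₜ[R] y
    have e3 : ((altOuter (extProd S T)).d (p + 1) p).app (op (SimplexCategory.mk q)) =
        ∑ i : Fin (p + 2), (-1 : ℤ) ^ (i : ℕ) •
          (SimplicialObject.δ S i ▷ T.obj (op (SimplexCategory.mk q))) :=
      (congrArg (fun k => k.app (op (SimplexCategory.mk q))) e1).trans (NatTrans.app_sum _ _ _)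
    rw [e2]
    exact (congrArg (fun k => k.hom (x ⊗ₜ[R] y)) e3).trans (altSum_whiskerRight_tmul _ x y)

theorem bisDouble_extProd_dv (S T : SMod R) (p q : ℕ)
    (x : (S.obj (op (SimplexCategory.mk p))) ⊗[R] (T.obj (op (SimplexCategory.mk (q + 1))))) :
    (bisDouble (extProd S T)).dv p q x =
      (tensorDouble (alt.obj S) (alt.obj T)).dv p q x := by
  have e1 : (alt.obj ((extProd S T).obj (op (SimplexCategory.mk p)))).d (q + 1) q =
      ∑ i : Fin (q + 2), (-1 : ℤ) ^ (i : ℕ) •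
        SimplicialObject.δ ((extProd S T).obj (op (SimplexCategory.mk p))) i :=
    AlternatingFaceMapComplex.obj_d_eq _ _
  have e2 : (alt.obj T).d (q + 1) q =
      ∑ i : Fin (q + 2), (-1 : ℤ) ^ (i : ℕ) • SimplicialObject.δ T i :=
    AlternatingFaceMapComplex.obj_d_eq _ _
  induction x with
  | zero => exact (map_zero ((bisDouble (extProd S T)).dv p q)).trans (map_zero _).symm
  | add x y hx hy =>
    exact (map_add ((bisDouble (extProd S T)).dv p q) x y).trans
      ((congrArg₂ (· + ·) hx hy).trans (map_add _ x y).symm)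
  | tmul x y =>
    change ((alt.obj ((extProd S T).obj (op (SimplexCategory.mk p)))).d (q + 1) q).hom (x ⊗ₜ y) =
      x ⊗ₜ[R] ((alt.obj T).d (q + 1) q y)
    rw [e2]
    exact (congrArg (fun k => k.hom (x ⊗ₜ[R] y)) e1).trans (altSum_whiskerLeft_tmul
      (SimplicialObject.δ T) x y)

/-- The double complex of an external product maps to the tensor double complex. -/
def extProdHom (S T : SMod R) :
    DoubleComplex.Hom (bisDouble (extProd S T)) (tensorDouble (alt.obj S) (alt.obj T)) where
  f p q := LinearMap.id (R := R) (M := S.obj (op (SimplexCategory.mk p)) ⊗[R]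
    T.obj (op (SimplexCategory.mk q)))
  comm_h p q x := bisDouble_extProd_dh S T p q x
  comm_v p q x := bisDouble_extProd_dv S T p q x

/-- The tensor double complex maps to the double complex of an external product. -/
def extProdInv (S T : SMod R) :
    DoubleComplex.Hom (tensorDouble (alt.obj S) (alt.obj T)) (bisDouble (extProd S T)) where
  f p q := LinearMap.id (R := R) (M := S.obj (op (SimplexCategory.mk p)) ⊗[R]
    T.obj (op (SimplexCategory.mk q)))
  comm_h p q x := (bisDouble_extProd_dh S T p q x).symm
  comm_v p q x := (bisDouble_extProd_dv S T p q x).symm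

/-- The total complex of an external product is a tensor product of complexes. -/
def extProdIso (S T : SMod R) : (bisTot R).obj (extProd S T) ≅ tens (alt.obj S) (alt.obj T) where
  hom := totMap (extProdHom S T)
  inv := totMap (extProdInv S T)
  hom_inv_id := rfl
  inv_hom_id := rfl

/-! ### Simplicial chains -/

/-- The simplicial module of chains of a simplicial set. -/
abbrev sch (K : SSet.{u}) (G : ModuleCat.{u} R) : SMod R := K ⋙ sigmaConst.obj G

/-- The map of simplicial modules of chains. -/
abbrev schMap {K L : SSet.{u}} (f : K ⟶ L) {G G' : ModuleCat.{u} R} (φ : G ⟶ G') :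
    sch K G ⟶ sch L G' :=
  Functor.whiskerRight f (sigmaConst.obj G) ≫ Functor.whiskerLeft L (sigmaConst.map φ)

theorem ι_schMap {K L : SSet.{u}} (f : K ⟶ L) {G G' : ModuleCat.{u} R} (φ : G ⟶ G')
    (n : SimplexCategoryᵒᵖ) (k : K.obj n) :
    copiesι G k ≫ (schMap f φ).app n = φ ≫ copiesι G' (f.app n k) := by
  change copiesι G k ≫ (sigmaConst.obj G).map (f.app n) ≫ (sigmaConst.map φ).app (L.obj n) = _
  rw [← Category.assoc, copiesι_map, copiesι_map_app]

/-- A simplicial set whose simplices are the pairs of simplices of two simplicial sets. -/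
structure ProductCone (K L M : SSet.{u}) where
  fst : M ⟶ K
  snd : M ⟶ L
  bijective : ∀ n, Function.Bijective fun m : M.obj n => (fst.app n m, snd.app n m)

variable {K L M K' L' M' : SSet.{u}}

/-- Chains on a product are the diagonal of the external product of the chains. -/
def prodChains (P : ProductCone K L M) (G G' : ModuleCat.{u} R) :
    sch M (G ⊗ G') ⟶ (bisDiag R).obj (extProd (sch K G) (sch L G')) where
  app n := prodCopies (P.fst.app n) (P.snd.app n) G G'
  naturality n n' h := by
    refine (prodCopies_map (f := P.fst.app n) (g := P.snd.app n) (M.map h) (K.map h)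
      (L.map h) (fun m => ?_) (fun m => ?_)).trans ?_
    · exact ConcreteCategory.congr_hom (P.fst.naturality h) m
    · exact ConcreteCategory.congr_hom (P.snd.naturality h) m
    · exact congrArg (prodCopies _ _ G G' ≫ ·) (tensorHom_def _ _)

theorem prodChains_bijective (P : ProductCone K L M) (G G' : ModuleCat.{u} R)
    (n : SimplexCategoryᵒᵖ) : Function.Bijective ((prodChains P G G').app n) :=
  prodCopies_bijective _ _ (P.bijective n) G G'

instance (P : ProductCone K L M) (G G' : ModuleCat.{u} R) : IsIso (prodChains P G G') :=
  haveI : ∀ n, IsIso ((prodChains P G G').app n) := fun n =>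
    (ConcreteCategory.isIso_iff_bijective _).2 (prodChains_bijective P G G' n)
  NatIso.isIso_of_isIso_app _

theorem prodChains_natural (P : ProductCone K L M) (P' : ProductCone K' L' M') (a : K ⟶ K')
    (b : L ⟶ L') (c : M ⟶ M') (hf : c ≫ P'.fst = P.fst ≫ a) (hg : c ≫ P'.snd = P.snd ≫ b)
    {G G₁ G' G₁' : ModuleCat.{u} R} (φ : G ⟶ G₁) (ψ : G' ⟶ G₁') :
    schMap c (φ ⊗ₘ ψ) ≫ prodChains P' G₁ G₁' =
      prodChains P G G' ≫ (bisDiag R).map (extProdMap (schMap a φ) (schMap b ψ)) := by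
  refine NatTrans.ext (funext fun n => ?_)
  have h1 := prodCopies_map (G := G) (G' := G') (f := P.fst.app n) (g := P.snd.app n)
    (f' := P'.fst.app n) (g' := P'.snd.app n) (c.app n) (a.app n) (b.app n)
    (fun m => ConcreteCategory.congr_hom (NatTrans.congr_app hf n) m)
    (fun m => ConcreteCategory.congr_hom (NatTrans.congr_app hg n) m)
  have h2 := prodCopies_coeff (P'.fst.app n) (P'.snd.app n) φ ψ
  change ((sigmaConst.obj (G ⊗ G')).map (c.app n) ≫ (sigmaConst.map (φ ⊗ₘ ψ)).app (M'.obj n)) ≫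
    prodCopies (P'.fst.app n) (P'.snd.app n) G₁ G₁' =
    prodCopies (P.fst.app n) (P.snd.app n) G G' ≫
    (((sigmaConst.obj G).map (a.app n) ≫ (sigmaConst.map φ).app (K'.obj n)) ⊗ₘ
      ((sigmaConst.obj G').map (b.app n) ≫ (sigmaConst.map ψ).app (L'.obj n)))
  rw [Category.assoc, h2, ← Category.assoc, h1, Category.assoc, tensorHom_comp_tensorHom]

end Kunneth
end

noncomputable section

namespace Kunneth

open AlgebraicTopology Opposite HomologicalComplex DoubleComplex
open scoped TensorProduct

variable {R : Type u} [CommRing R]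

/-! ### Torsion products of coproducts of copies -/

section tor

theorem tor₁_congr {M M' N N' : ModuleCat.{u} R} (e : M ≅ M') (f : N ≅ N')
    (h : IsZero (tor₁ M N)) : IsZero (tor₁ M' N') :=
  h.of_iso (((Tor (ModuleCat.{u} R) 1).mapIso e).symm.app N' ≪≫
    ((Tor (ModuleCat.{u} R) 1).obj M).mapIso f.symm)

theorem finsuppLeft_lTensor {ι : Type u} [DecidableEq ι]
    {M N N' : Type u} [AddCommGroup M] [AddCommGroup N]
    [AddCommGroup N'] [Module R M] [Module R N] [Module R N'] (f : N →ₗ[R] N')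
    (x : (ι →₀ M) ⊗[R] N) : TensorProduct.finsuppLeft R R M N' ι (f.lTensor (ι →₀ M) x) =
      Finsupp.mapRange.linearMap (f.lTensor M) (TensorProduct.finsuppLeft R R M N ι x) := by
  ext i
  induction x with
  | zero => simp
  | add x y hx hy => simp_all
  | tmul x y => simp

theorem finsuppRight_lTensor {ι : Type u} [DecidableEq ι]
    {M N N' : Type u} [AddCommGroup M] [AddCommGroup N]
    [AddCommGroup N'] [Module R M] [Module R N] [Module R N'] (f : N →ₗ[R] N')
    (x : M ⊗[R] (ι →₀ N)) : TensorProduct.finsuppRight R R M N' ι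
        ((Finsupp.mapRange.linearMap (α := ι) f).lTensor M x) =
      Finsupp.mapRange.linearMap (f.lTensor M) (TensorProduct.finsuppRight R R M N ι x) := by
  ext i
  induction x with
  | zero => simp
  | add x y hx hy => simp_all
  | tmul x y => simp

variable [IsDomain R] [IsPrincipalIdealRing R]

theorem exists_presentation (N : ModuleCat.{u} R) : ∃ (F₁ F₀ : ModuleCat.{u} R) (i : F₁ ⟶ F₀)
    (p : F₀ ⟶ N) (w : i ≫ p = 0), (ShortComplex.mk i p w).ShortExact ∧
      Module.Projective R F₁ ∧ Module.Projective R F₀ := by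
  let p : ModuleCat.of R (N →₀ R) ⟶ N := ModuleCat.ofHom (Finsupp.linearCombination R id)
  have hp : Function.Surjective p := Finsupp.linearCombination_id_surjective R N
  exact ⟨ModuleCat.of R (LinearMap.ker p.hom), _, ModuleCat.ofHom (LinearMap.ker p.hom).subtype, p,
    ModuleCat.hom_ext (LinearMap.ext fun x => x.2), ModuleCat.shortComplex_shortExact _
      (LinearMap.exact_subtype_ker_map p.hom) (LinearMap.ker p.hom).injective_subtype hp,
    inferInstanceAs (Module.Projective R (LinearMap.ker p.hom)),
    inferInstanceAs (Module.Projective R (N →₀ R))⟩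

/-- `Tor₁` commutes with direct sums. Copies of a projective presentation of `G'` present the copies
of `G'`, and injectivity after tensoring is checked componentwise, first in `κ` and then in `ι`. -/
theorem isZero_tor₁_copies {G G' : ModuleCat.{u} R} (h : IsZero (tor₁ G G')) (ι κ : Type u) :
    IsZero (tor₁ (copies ι G) (copies κ G')) := by
  classical
  obtain ⟨F₁, F₀, i, p, w, hS, hF₁, hF₀⟩ := exists_presentation G'
  have hi : Function.Injective i.hom := hS.moduleCat_injective_f
  have hp : Function.Surjective p.hom := hS.moduleCat_surjective_g
  have hip : Function.Exact i.hom p.hom :=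
    (ShortComplex.ShortExact.moduleCat_exact_iff_function_exact _).1 hS.exact
  let i' : ModuleCat.of R (κ →₀ F₁) ⟶ ModuleCat.of R (κ →₀ F₀) :=
    ModuleCat.ofHom (Finsupp.mapRange.linearMap i.hom)
  let p' : ModuleCat.of R (κ →₀ F₀) ⟶ ModuleCat.of R (κ →₀ G') :=
    ModuleCat.ofHom (Finsupp.mapRange.linearMap p.hom)
  have w' : i' ≫ p' = 0 := ModuleCat.hom_ext (LinearMap.ext fun x => Finsupp.ext fun k =>
    hip.apply_apply_eq_zero (x k))
  have hS' : (ShortComplex.mk i' p' w').ShortExact := ModuleCat.shortComplex_shortExact _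
    (LinearMap.exact_iff.2 (by
      refine (Finsupp.ker_mapRange p.hom κ).trans (Eq.trans ?_
        (Finsupp.range_mapRange_linearMap i.hom (LinearMap.ker_eq_bot.2 hi) κ).symm)
      rw [LinearMap.exact_iff.1 hip]))
    (Finsupp.mapRange_injective _ (map_zero _) hi)
    (Finsupp.mapRange_surjective _ (map_zero _) hp)
  have i1 := (isZero_tor₁_iff G hS ((IsProjective.iff_projective _).1 hF₁)
    ((IsProjective.iff_projective _).1 hF₀)).1 h
  have i2 : Function.Injective
      ((Finsupp.mapRange.linearMap (α := κ) i.hom).lTensor G) := by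
    intro x y hxy
    apply (TensorProduct.finsuppRight R R G F₁ κ).injective
    apply Finsupp.mapRange_injective _ (map_zero _) i1
    exact (finsuppRight_lTensor i.hom x).symm.trans
      ((congrArg _ hxy).trans (finsuppRight_lTensor i.hom y))
  have i3 : Function.Injective
      ((Finsupp.mapRange.linearMap (α := κ) i.hom).lTensor (ι →₀ G)) := by
    intro x y hxy
    apply (TensorProduct.finsuppLeft R R G (κ →₀ F₁) ι).injective
    apply Finsupp.mapRange_injective _ (map_zero _) i2
    exact (finsuppLeft_lTensor _ x).symm.trans
      ((congrArg _ hxy).trans (finsuppLeft_lTensor _ y))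
  have q : ∀ F : ModuleCat.{u} R, Module.Projective R F → Module.Projective R (κ →₀ F) :=
    fun F _ => Module.Projective.of_equiv (finsuppLEquivDirectSum R F κ).symm
  have key : IsZero (tor₁ (ModuleCat.of R (ι →₀ G)) (ModuleCat.of R (κ →₀ G'))) :=
    (isZero_tor₁_iff (S := ShortComplex.mk i' p' w') (ModuleCat.of R (ι →₀ G)) hS'
      ((IsProjective.iff_projective (ModuleCat.of R (κ →₀ F₁))).1 (q F₁ hF₁))
      ((IsProjective.iff_projective (ModuleCat.of R (κ →₀ F₀))).1 (q F₀ hF₀))).2 i3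
  let e : ModuleCat.of R (ι →₀ G) ≅ copies ι G := (copiesEquiv ι G).symm.toModuleIso
  let f : ModuleCat.of R (κ →₀ G') ≅ copies κ G' := (copiesEquiv κ G').symm.toModuleIso
  exact tor₁_congr e f key

end tor

/-! ### The Künneth sequence of a product of simplicial sets -/

section kunneth

/-- The chain complex of a simplicial set. -/
abbrev scx (K : SSet.{u}) (G : ModuleCat.{u} R) : ChainComplex (ModuleCat.{u} R) ℕ :=
  alt.obj (sch K G)

/-- The map of chain complexes induced by a simplicial map and a map of modules. -/
abbrev scxMap {K L : SSet.{u}} (f : K ⟶ L) {G G' : ModuleCat.{u} R} (φ : G ⟶ G') :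
    scx K G ⟶ scx L G' := alt.map (schMap f φ)

/-- A natural isomorphism between the homology of the total complex and of the diagonal of a
bisimplicial module. -/
def ezIso (n : ℕ) (A : BMod R) :
    ((bisTot R).obj A).homology n ≅ ((diagCx R).obj A).homology n :=
  (eilenbergZilber n).choose A

theorem ezIso_natural (n : ℕ) {A B : BMod R} (f : A ⟶ B) :
    homologyMap ((bisTot R).map f) n ≫ (ezIso n B).hom =
      (ezIso n A).hom ≫ homologyMap ((diagCx R).map f) n :=
  (eilenbergZilber n).choose_spec f

variable {K L M K' L' M' : SSet.{u}}

/-- The homology of a product of simplicial sets is that of the tensor product of the chain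
complexes. -/
def prodIso (P : ProductCone K L M) (G G' : ModuleCat.{u} R) (n : ℕ) :
    (tens (scx K G) (scx L G')).homology n ≅ (scx M (G ⊗ G')).homology n :=
  (homologyFunctor _ _ n).mapIso (extProdIso (sch K G) (sch L G')).symm ≪≫
    ezIso n (extProd (sch K G) (sch L G')) ≪≫
    (alt ⋙ homologyFunctor _ _ n).mapIso (asIso (prodChains P G G')).symm

theorem iso_inv_hom_apply {A B : ModuleCat.{u} R} (e : A ≅ B) (x : A) : e.inv (e.hom x) = x :=
  ConcreteCategory.congr_hom e.hom_inv_id x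

theorem iso_hom_inv_apply {A B : ModuleCat.{u} R} (e : A ≅ B) (x : B) : e.hom (e.inv x) = x :=
  ConcreteCategory.congr_hom e.inv_hom_id x

theorem paste_squares {𝓒 : Type*} [Category* 𝓒] {A B C D A' B' C' D' : 𝓒} {i : A ⟶ B} {j : B ⟶ C}
    {k : C ⟶ D} {i' : A' ⟶ B'} {j' : B' ⟶ C'} {k' : C' ⟶ D'} {a : A ⟶ A'} {b : B ⟶ B'}
    {c : C ⟶ C'} {d : D ⟶ D'} (h₁ : a ≫ i' = i ≫ b) (h₂ : b ≫ j' = j ≫ c) (h₃ : c ≫ k' = k ≫ d) :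
    a ≫ i' ≫ j' ≫ k' = (i ≫ j ≫ k) ≫ d := by
  rw [Category.assoc, Category.assoc, ← h₃, ← reassoc_of% h₂, reassoc_of% h₁]

theorem prodIso_natural (P : ProductCone K L M) (P' : ProductCone K' L' M') (a : K ⟶ K')
    (b : L ⟶ L') (c : M ⟶ M') (hf : c ≫ P'.fst = P.fst ≫ a) (hg : c ≫ P'.snd = P.snd ≫ b)
    {G G₁ G' G₁' : ModuleCat.{u} R} (φ : G ⟶ G₁) (ψ : G' ⟶ G₁') (n : ℕ) :
    homologyMap (tensMap (scxMap a φ) (scxMap b ψ)) n ≫ (prodIso P' G₁ G₁' n).hom =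
      (prodIso P G G' n).hom ≫ homologyMap (scxMap c (φ ⊗ₘ ψ)) n := by
  have h1 := ezIso_natural n (extProdMap (schMap a φ) (schMap b ψ))
  have h2 : homologyMap (tensMap (scxMap a φ) (scxMap b ψ)) n ≫
      homologyMap (extProdIso (sch K' G₁) (sch L' G₁')).inv n =
      homologyMap (extProdIso (sch K G) (sch L G')).inv n ≫
        homologyMap ((bisTot R).map (extProdMap (schMap a φ) (schMap b ψ))) n := by
    rw [← homologyMap_comp, ← homologyMap_comp]
    rfl
  have h3 : homologyMap ((diagCx R).map (extProdMap (schMap a φ) (schMap b ψ))) n ≫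
      homologyMap (alt.map (inv (prodChains P' G₁ G₁'))) n =
      homologyMap (alt.map (inv (prodChains P G G'))) n ≫ homologyMap (scxMap c (φ ⊗ₘ ψ)) n := by
    have h4 := prodChains_natural P P' a b c hf hg φ ψ
    have h5 : (bisDiag R).map (extProdMap (schMap a φ) (schMap b ψ)) ≫
        inv (prodChains P' G₁ G₁') = inv (prodChains P G G') ≫ schMap c (φ ⊗ₘ ψ) := by
      rw [IsIso.comp_inv_eq, Category.assoc, h4, IsIso.inv_hom_id_assoc]
    exact (homologyMap_comp _ _ n).symm.trans ((congrArg (homologyMap · n)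
      ((alt.map_comp _ _).symm.trans ((congrArg alt.map h5).trans (alt.map_comp _ _)))).trans
        (homologyMap_comp _ _ n))
  have h6 := paste_squares h2 h1 h3
  exact h6

attribute [irreducible] prodIso

variable [IsDomain R] [IsPrincipalIdealRing R]

theorem isZero_tor₁_scx (K L : SSet.{u}) {G G' : ModuleCat.{u} R} (h : IsZero (tor₁ G G'))
    (i j : ℕ) : IsZero (tor₁ ((scx K G).X i) ((scx L G').X j)) :=
  isZero_tor₁_copies h _ _

variable (P : ProductCone K L M) {G G' : ModuleCat.{u} R} (h : IsZero (tor₁ G G')) (n : ℕ)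

/-- The map `⨁ H_i(K; G) ⊗ H_j(L; G') → H_n(K × L; G ⊗ G')`. -/
def sι : TensTerm (scx K G) (scx L G') n →ₗ[R] (scx M (G ⊗ G')).homology n :=
  (prodIso P G G' n).hom.hom ∘ₗ gι (scx K G) (scx L G') (isZero_tor₁_scx K L h) n

/-- The map `H_n(K × L; G ⊗ G') → ⨁ Tor₁(H_i(K; G), H_j(L; G'))`. -/
def sπ : (scx M (G ⊗ G')).homology n →ₗ[R] TorTerm (scx K G) (scx L G') n :=
  gπ (scx K G) (scx L G') (isZero_tor₁_scx K L h) n ∘ₗ (prodIso P G G' n).inv.hom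

theorem sι_injective : Function.Injective (sι P h n) :=
  (Function.LeftInverse.injective (iso_inv_hom_apply (prodIso P G G' n))).comp
    (gι_injective _ _ _ n)

theorem sπ_surjective : Function.Surjective (sπ P h n) :=
  (gπ_surjective _ _ _ n).comp
    (Function.RightInverse.surjective (iso_inv_hom_apply (prodIso P G G' n)))

theorem sι_sπ_exact : Function.Exact (sι P h n) (sπ P h n) := fun x => by
  refine (general_exact _ _ (isZero_tor₁_scx K L h) n _).trans ?_
  constructor
  · rintro ⟨y, hy⟩
    exact ⟨y, (congrArg (prodIso P G G' n).hom hy).trans (iso_hom_inv_apply _ x)⟩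
  · rintro ⟨y, hy⟩
    exact ⟨y, (iso_inv_hom_apply (prodIso P G G' n) _).symm.trans
      (congrArg (prodIso P G G' n).inv hy)⟩

theorem exists_retraction_sι : ∃ l : (scx M (G ⊗ G')).homology n →ₗ[R]
    TensTerm (scx K G) (scx L G') n, ∀ y, l (sι P h n y) = y := by
  obtain ⟨l, hl⟩ := exists_retraction_gι (scx K G) (scx L G') (isZero_tor₁_scx K L h) n
  exact ⟨l ∘ₗ (prodIso P G G' n).inv.hom, fun y =>
    (congrArg l (iso_inv_hom_apply (prodIso P G G' n) _)).trans (hl y)⟩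

variable {P h} (P' : ProductCone K' L' M') (a : K ⟶ K') (b : L ⟶ L') (c : M ⟶ M')
  {G₁ G₁' : ModuleCat.{u} R}
  (h₁ : IsZero (tor₁ G₁ G₁')) (φ : G ⟶ G₁) (ψ : G' ⟶ G₁')

theorem sι_natural (hf : c ≫ P'.fst = P.fst ≫ a) (hg : c ≫ P'.snd = P.snd ≫ b)
    (y : TensTerm (scx K G) (scx L G') n) :
    homologyMap (scxMap c (φ ⊗ₘ ψ)) n (sι P h n y) =
      sι P' h₁ n (tensTermMap (scxMap a φ) (scxMap b ψ) n y) := by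
  refine (ConcreteCategory.congr_hom (prodIso_natural P P' a b c hf hg φ ψ n)
    (gι _ _ (isZero_tor₁_scx K L h) n y)).symm.trans ?_
  exact congrArg (prodIso P' G₁ G₁' n).hom
    (gι_natural (isZero_tor₁_scx K L h) (isZero_tor₁_scx K' L' h₁) _ _ n y)

theorem sπ_natural (hf : c ≫ P'.fst = P.fst ≫ a) (hg : c ≫ P'.snd = P.snd ≫ b)
    (x : (scx M (G ⊗ G')).homology n) :
    sπ P' h₁ n (homologyMap (scxMap c (φ ⊗ₘ ψ)) n x) =
      torTermMap' (scxMap a φ) (scxMap b ψ) n (sπ P h n x) := by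
  have e0 := iso_hom_inv_apply (prodIso P G G' n) x
  have e2 := ConcreteCategory.congr_hom (prodIso_natural P P' a b c hf hg φ ψ n)
    ((prodIso P G G' n).inv x)
  have e3 : (prodIso P' G₁ G₁' n).inv (homologyMap (scxMap c (φ ⊗ₘ ψ)) n x) =
      homologyMap (tensMap (scxMap a φ) (scxMap b ψ)) n ((prodIso P G G' n).inv x) :=
    (congrArg (fun z => (prodIso P' G₁ G₁' n).inv (homologyMap (scxMap c (φ ⊗ₘ ψ)) n z))
      e0.symm).trans ((congrArg (prodIso P' G₁ G₁' n).inv e2.symm).trans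
        (iso_inv_hom_apply (prodIso P' G₁ G₁' n) _))
  exact (congrArg (gπ _ _ (isZero_tor₁_scx K' L' h₁) n) e3).trans
    (gπ_natural (isZero_tor₁_scx K L h) (isZero_tor₁_scx K' L' h₁) _ _ n _)

end kunneth

end Kunneth
end

noncomputable section

namespace Kunneth

open AlgebraicTopology Opposite HomologicalComplex DoubleComplex SemiUniformSpace
open scoped TensorProduct

variable {R : Type u} [CommRing R]

/-! ### Extremal entourages -/

section extremal

/-- Intersecting a minimal member of a filter with any other member gives nothing smaller, so
minimal means least. -/
theorem isExtremal_iff {X : SemiUniformSpace.{u}} {U : Set (X.carrier × X.carrier)} :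
    X.IsExtremal U ↔ U ∈ X.entourages ∧ ∀ V ∈ X.entourages, U ⊆ V :=
  ⟨fun h => ⟨h.1, fun _ hV => (h.2 (Filter.inter_mem h.1 hV) Set.inter_subset_left).trans
    Set.inter_subset_right⟩, fun h => ⟨h.1, fun V hV _ => h.2 V hV⟩⟩

/-- Boxes form a basis of the product filter, and the box of two least sets lies in every box. -/
theorem isExtremal_boxRel {X Y : SemiUniformSpace.{u}} {U : Set (X.carrier × X.carrier)}
    {V : Set (Y.carrier × Y.carrier)} (hU : X.IsExtremal U) (hV : Y.IsExtremal V) :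
    (X.prod Y).IsExtremal (boxRel U V) := by
  rw [isExtremal_iff] at hU hV
  refine isExtremal_iff.2 ⟨mem_boxFilter.2 ⟨U, hU.1, V, hV.1, subset_rfl⟩, fun W hW => ?_⟩
  obtain ⟨U', hU', V', hV', h⟩ := mem_boxFilter.1 hW
  exact fun p hp => h ⟨hU.2 U' hU' hp.1, hV.2 V' hV' hp.2⟩

theorem isExtremal_unique {X : SemiUniformSpace.{u}} {U V : Set (X.carrier × X.carrier)}
    (hU : X.IsExtremal U) (hV : X.IsExtremal V) : U = V :=
  ((isExtremal_iff.1 hU).2 V hV.1).antisymm ((isExtremal_iff.1 hV).2 U hU.1)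

variable (X Y X' Y' : SemiUniformSpace.{u}) [X.HasExtremal] [Y.HasExtremal] [X'.HasExtremal]
  [Y'.HasExtremal]

instance : (X.prod Y).HasExtremal := by
  obtain ⟨U, hU⟩ := HasExtremal.exists_extremal (X := X)
  obtain ⟨V, hV⟩ := HasExtremal.exists_extremal (X := Y)
  exact ⟨_, isExtremal_boxRel hU hV⟩

/-- The extremal entourage. -/
def extr : X.Entourage :=
  ⟨(HasExtremal.exists_extremal (X := X)).choose,
    (HasExtremal.exists_extremal (X := X)).choose_spec.1⟩

theorem isExtremal_extr : X.IsExtremal (extr X).1 :=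
  (HasExtremal.exists_extremal (X := X)).choose_spec

theorem extr_subset (V : X.Entourage) : (extr X).1 ⊆ V.1 :=
  (isExtremal_iff.1 (isExtremal_extr X)).2 V.1 V.2

theorem extr_prod : (extr (X.prod Y)).1 = boxRel (extr X).1 (extr Y).1 :=
  isExtremal_unique (isExtremal_extr (X.prod Y))
    (isExtremal_boxRel (isExtremal_extr X) (isExtremal_extr Y))

/-- The extremal entourage is initial. -/
def isInitialExtr : IsInitial (extr X) :=
  IsInitial.ofUniqueHom (fun V => homOfLE (extr_subset X V)) fun _ _ => Subsingleton.elim _ _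

theorem extr_refl (x : X.carrier) : (x, x) ∈ (extr X).1 := X.refl _ (extr X).2 x

/-- The Vietoris–Rips complex of the extremal entourage. -/
abbrev rips : SSet.{u} := X.ripsSystem.obj (extr X)

variable {X X' Y Y'}

/-- The map of Vietoris–Rips complexes of the extremal entourages. -/
def ripsOf (f : Map X X') : rips X ⟶ rips X' :=
  ripsMap (extr_refl X) (extr_refl X') f.toFun fun _ hp =>
    extr_subset X (f.pullback.obj (extr X')) hp

variable (X Y) in
/-- The Vietoris–Rips complex of a product. -/
def ripsProd : ProductCone (rips X) (rips Y) (rips (X.prod Y)) where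
  fst := ripsMap (extr_refl (X.prod Y)) (extr_refl X) Prod.fst fun p hp =>
    ((extr_prod X Y).le hp).1
  snd := ripsMap (extr_refl (X.prod Y)) (extr_refl Y) Prod.snd fun p hp =>
    ((extr_prod X Y).le hp).2
  bijective n := by
    constructor
    · intro x y h
      have h1 := congrArg (fun z => z.1.1) h
      have h2 := congrArg (fun z => z.2.1) h
      exact Subtype.ext (funext fun i => Prod.ext (congrFun h1 i) (congrFun h2 i))
    · rintro ⟨x, y⟩
      refine ⟨⟨fun i => (x.1 i, y.1 i), fun i j hij => ?_⟩, rfl⟩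
      exact (extr_prod X Y).ge ⟨x.2 i j hij, y.2 i j hij⟩

/-! ### Vietoris–Rips homology at the extremal entourage -/

/-- A limit over a category with an initial object is the value there. -/
theorem isIso_limit_π (G : ModuleCat.{u} R) (q : ℤ) :
    IsIso (limit.π (X.homologySystem G q) (extr X)) :=
  (IsLimit.conePointUniqueUpToIso (limit.isLimit _)
    (limitOfDiagramInitial (isInitialExtr X) (X.homologySystem G q))).isIso_hom

variable (X) in
/-- Vietoris–Rips homology is the homology of the Vietoris–Rips complex of the extremal
entourage. -/
def vIso' (G : ModuleCat.{u} R) (q : ℤ) :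
    X.vrHomology G q ≅ ((simplicialHomology R q).obj G).obj (rips X) :=
  @asIso (ModuleCat.{u} R) _ (limit (X.homologySystem G q)) ((X.homologySystem G q).obj (extr X))
    (limit.π (X.homologySystem G q) (extr X)) (isIso_limit_π G q)

/-- The pullback of the least entourage of `X'` contains that of `X` but need not equal it.
Compatibility of the limit projections along this inclusion turns the induced map into the one given
by `ripsOf`. -/
theorem vIso'_natural (f : Map X X') {G G' : ModuleCat.{u} R} (φ : G ⟶ G') (q : ℤ) :
    vrMap f φ q ≫ (vIso' X' G' q).hom = (vIso' X G q).hom ≫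
      ((simplicialHomology R q).obj G).map (ripsOf f) ≫
        ((simplicialHomology R q).map φ).app (rips X') := by
  have h1 := limit.w (X.homologySystem G q) (homOfLE (extr_subset X (f.pullback.obj (extr X'))))
  change vrMap f φ q ≫ limit.π _ (extr X') = limit.π _ (extr X) ≫ _
  have h2 : vrMap f φ q ≫ limit.π (X'.homologySystem G' q) (extr X') =
      limit.π (X.homologySystem G q) (f.pullback.obj (extr X')) ≫
        ((simplicialHomology R q).obj G).map (f.ripsTrans.app (extr X')) ≫
          ((simplicialHomology R q).map φ).app (rips X') := by
    refine (Category.assoc _ _ _).trans ((congrArg _ (limMap_π _ _)).trans ?_)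
    refine (Category.assoc _ _ _).symm.trans ?_
    exact congrArg (· ≫ _) (limit.pre_π (X.homologySystem G q) f.pullback (extr X'))
  refine h2.trans ?_
  rw [← h1, Category.assoc]
  refine congrArg (limit.π _ _ ≫ ·) ?_
  refine (Category.assoc _ _ _).symm.trans (congrArg (· ≫ _) ?_)
  exact (((simplicialHomology R q).obj G).map_comp _ _).symm

variable (X) in
/-- Vietoris–Rips homology in degree `n ≥ 0`. -/
def vIso (G : ModuleCat.{u} R) (n : ℕ) : X.vrHomology G (n : ℤ) ≅ (scx (rips X) G).homology n :=
  vIso' X G n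

theorem vIso_natural (f : Map X X') {G G' : ModuleCat.{u} R} (φ : G ⟶ G') (n : ℕ) :
    vrMap f φ n ≫ (vIso X' G' n).hom =
      (vIso X G n).hom ≫ homologyMap (scxMap (ripsOf f) φ) n := by
  refine (vIso'_natural f φ n).trans (congrArg ((vIso' X G n).hom ≫ ·) ?_)
  refine (homologyMap_comp _ _ n).symm.trans ?_
  exact congrArg (homologyMap · n) (alt.map_comp _ _).symm

theorem isZero_vrHomology (G : ModuleCat.{u} R) (n : ℕ) :
    IsZero (X.vrHomology G (Int.negSucc n)) :=
  IsZero.of_iso (ModuleCat.isZero_of_subsingleton (ModuleCat.of R PUnit)) (vIso' X G _)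

end extremal

end Kunneth
end

noncomputable section

namespace Kunneth

open AlgebraicTopology Opposite HomologicalComplex DoubleComplex SemiUniformSpace
open scoped TensorProduct

variable {R : Type u} [CommRing R]

/-! ### Coproducts with finitely many nonzero terms -/

section cop

variable {I J : Type} [Finite J] {F F' : I → ModuleCat.{u} R} {E E' : J → ModuleCat.{u} R}
  (c : J → I)

/-- The comparison of a finite product with a coproduct over a larger index set. -/
def piToCop (e : ∀ a, F (c a) ≅ E a) : ModuleCat.of R (∀ a, E a) ⟶ ∐ F :=
  haveI := Fintype.ofFinite J
  ModuleCat.ofHom (∑ a, (Sigma.ι F (c a)).hom ∘ₗ (e a).inv.hom ∘ₗ LinearMap.proj a)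

theorem piToCop_natural (e : ∀ a, F (c a) ≅ E a) (e' : ∀ a, F' (c a) ≅ E' a)
    (m : ∀ i, F i ⟶ F' i) (k : ∀ a, E a →ₗ[R] E' a)
    (h : ∀ a, (e a).inv ≫ m (c a) = ModuleCat.ofHom (k a) ≫ (e' a).inv) :
    piToCop c e ≫ Limits.Sigma.map m =
      ModuleCat.ofHom (LinearMap.pi fun a => k a ∘ₗ LinearMap.proj a) ≫ piToCop c e' := by
  let := Fintype.ofFinite J
  refine ModuleCat.hom_ext (LinearMap.ext fun x => ?_)
  change Limits.Sigma.map m ((∑ a, (Sigma.ι F (c a)).hom ∘ₗ (e a).inv.hom ∘ₗ LinearMap.proj a) x) =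
    (∑ a, (Sigma.ι F' (c a)).hom ∘ₗ (e' a).inv.hom ∘ₗ LinearMap.proj a) (fun a => k a (x a))
  rw [LinearMap.sum_apply, LinearMap.sum_apply, map_sum]
  refine Finset.sum_congr rfl fun a _ => ?_
  have h1 := ConcreteCategory.congr_hom (h a) (x a)
  have h2 := ConcreteCategory.congr_hom (Sigma.ι_map m (c a)) ((e a).inv (x a))
  exact h2.trans (congrArg (Sigma.ι F' (c a)) h1)

/-- The summands outside the image of `c` are zero, and over the finite rest product and coproduct
agree. -/
theorem isIso_piToCop (hc : Function.Injective c) (hz : ∀ i, (¬ ∃ a, c a = i) → IsZero (F i))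
    (e : ∀ a, F (c a) ≅ E a) : IsIso (piToCop c e) := by
  classical
  let := Fintype.ofFinite J
  let s (a : J) : E a ⟶ ModuleCat.of R (∀ a, E a) :=
    ModuleCat.ofHom (LinearMap.single R (fun a => E a) a)
  let g : ∐ F ⟶ ModuleCat.of R (∀ a, E a) := Sigma.desc fun i =>
    if h : ∃ a, c a = i then eqToHom (by rw [h.choose_spec]) ≫ (e h.choose).hom ≫ s h.choose else 0
  have hg (a : J) : Sigma.ι F (c a) ≫ g = (e a).hom ≫ s a := by
    have h : ∃ b, c b = c a := ⟨a, rfl⟩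
    have key : ∀ b (hb : c b = c a), eqToHom (by rw [hb]) ≫ (e b).hom ≫ s b =
        (e a).hom ≫ s a := by
      intro b hb
      obtain rfl := hc hb
      simp
    rw [Sigma.ι_desc, dif_pos h]
    exact key _ h.choose_spec
  have hs (a : J) (y : E a) : piToCop c e (s a y) = Sigma.ι F (c a) ((e a).inv y) := by
    change (∑ b, (Sigma.ι F (c b)).hom ∘ₗ (e b).inv.hom ∘ₗ LinearMap.proj b)
      (Pi.single (M := fun a => E a) a y) = _
    rw [LinearMap.sum_apply, Finset.sum_eq_single a]
    · simp
    · intro b _ hb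
      simp [hb]
    · simp
  refine ⟨g, ?_, ?_⟩
  · refine ModuleCat.hom_ext (LinearMap.pi_ext fun a y => ?_)
    refine (congrArg g (hs a y)).trans ((ConcreteCategory.congr_hom (hg a) _).trans ?_)
    exact congrArg (s a) (iso_hom_inv_apply (e a) y)
  · refine Sigma.hom_ext _ _ fun i => ?_
    by_cases h : ∃ a, c a = i
    · obtain ⟨a, rfl⟩ := h
      refine ModuleCat.hom_ext (LinearMap.ext fun y => ?_)
      refine (congrArg (piToCop c e) (ConcreteCategory.congr_hom (hg a) y)).trans ?_
      refine (hs a _).trans ?_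
      exact congrArg (Sigma.ι F (c a)) (iso_inv_hom_apply (e a) y)
    · exact (hz i h).eq_of_src _ _

theorem isZero_cop (hz : ∀ i, IsZero (F i)) : IsZero (∐ F) := by
  rw [IsZero.iff_id_eq_zero]
  exact Sigma.hom_ext _ _ fun i => (hz i).eq_of_src _ _

end cop

theorem isZero_tensor_left {M N : ModuleCat.{u} R} (h : IsZero M) : IsZero (M ⊗ N) := by
  have := ModuleCat.subsingleton_of_isZero h
  exact @ModuleCat.isZero_of_subsingleton _ _ _ (inferInstanceAs (Subsingleton (M ⊗[R] N)))

theorem isZero_tensor_right {M N : ModuleCat.{u} R} (h : IsZero N) : IsZero (M ⊗ N) := by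
  have := ModuleCat.subsingleton_of_isZero h
  exact @ModuleCat.isZero_of_subsingleton _ _ _ (inferInstanceAs (Subsingleton (M ⊗[R] N)))

theorem isZero_tor₁_right {M N : ModuleCat.{u} R} (h : IsZero N) : IsZero (tor₁ M N) := by
  have := ModuleCat.subsingleton_of_isZero h
  have hN : Projective N :=
    (IsProjective.iff_projective N).1 (Module.Projective.of_free (R := R) (P := N))
  have hS : (ShortComplex.mk (0 : N ⟶ N) (0 : N ⟶ N) zero_comp).ShortExact :=
    ModuleCat.shortComplex_shortExact _
      (fun x => ⟨fun _ => ⟨x, Subsingleton.elim (α := N) _ _⟩,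
        fun _ => Subsingleton.elim (α := N) _ _⟩)
      (Function.injective_of_subsingleton (α := N) _) fun x => ⟨x, Subsingleton.elim (α := N) _ _⟩
  exact (isZero_tor₁_iff (S := ShortComplex.mk (0 : N ⟶ N) (0 : N ⟶ N) zero_comp) M hS hN hN).2
    (Function.injective_of_subsingleton (α := M ⊗[R] N) _)

theorem isZero_tor₁_left [IsDomain R] [IsPrincipalIdealRing R] {M N : ModuleCat.{u} R}
    (h : IsZero M) : IsZero (tor₁ M N) := by
  obtain ⟨F₁, F₀, i, p, w, hS, hF₁, hF₀⟩ := exists_presentation N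
  have := ModuleCat.subsingleton_of_isZero h
  exact (isZero_tor₁_iff M hS ((IsProjective.iff_projective _).1 hF₁)
    ((IsProjective.iff_projective _).1 hF₀)).2 (Function.injective_of_subsingleton _)

instance (n : ℕ) : Finite (Idx n) :=
  Finite.of_injective (fun a : Idx n => (⟨a.1.1, by have := a.2; omega⟩ : Fin (n + 1)))
    fun a b h => Subtype.ext (Prod.ext (congrArg Fin.val h) (by
      have := congrArg Fin.val h
      have := a.2
      have := b.2
      simp only at *
      omega))

instance (n : ℕ) : Finite (Idx' n) :=
  Finite.of_injective (fun a : Idx' n => (⟨a.1.1, by have := a.2; omega⟩ : Fin (n + 1)))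
    fun a b h => Subtype.ext (Prod.ext (congrArg Fin.val h) (by
      have := congrArg Fin.val h
      have := a.2
      have := b.2
      simp only at *
      omega))

/-! ### The Künneth sequence for Vietoris–Rips homology -/

section sequence

variable (X Y X' Y' : SemiUniformSpace.{u}) [X.HasExtremal] [Y.HasExtremal] [X'.HasExtremal]
  [Y'.HasExtremal] (G G' : ModuleCat.{u} R)

/-- The pair of integers given by a pair of natural numbers. -/
def idxPair (n : ℕ) (a : Idx n) : Pairs (n : ℤ) :=
  ⟨(a.1.1, a.1.2), by have := a.2; push_cast [← this]; rfl⟩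

/-- The pair of integers given by a pair of natural numbers. -/
def idxPair' (n : ℕ) (a : Idx' n) : Pairs ((n : ℤ) - 1) :=
  ⟨(a.1.1, a.1.2), by have := a.2; push_cast [← this]; simp⟩

theorem idxPair_injective (n : ℕ) : Function.Injective (idxPair n) := fun a b h => by
  have h1 := congrArg (fun z => z.1.1) h
  have h2 := congrArg (fun z => z.1.2) h
  exact Subtype.ext (Prod.ext (Int.ofNat_inj.1 h1) (Int.ofNat_inj.1 h2))

theorem idxPair'_injective (n : ℕ) : Function.Injective (idxPair' n) := fun a b h => by
  have h1 := congrArg (fun z => z.1.1) h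
  have h2 := congrArg (fun z => z.1.2) h
  exact Subtype.ext (Prod.ext (Int.ofNat_inj.1 h1) (Int.ofNat_inj.1 h2))

theorem isZero_tensor_of_neg {i j : ℤ} (h : i < 0 ∨ j < 0) :
    IsZero (X.vrHomology G i ⊗ Y.vrHomology G' j) := by
  rcases h with h | h
  · obtain ⟨k, rfl⟩ := Int.eq_negSucc_of_lt_zero h
    exact isZero_tensor_left (isZero_vrHomology G k)
  · obtain ⟨k, rfl⟩ := Int.eq_negSucc_of_lt_zero h
    exact isZero_tensor_right (isZero_vrHomology G' k)

theorem isZero_tor₁_of_neg [IsDomain R] [IsPrincipalIdealRing R] {i j : ℤ} (h : i < 0 ∨ j < 0) :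
    IsZero (tor₁ (X.vrHomology G i) (Y.vrHomology G' j)) := by
  rcases h with h | h
  · obtain ⟨k, rfl⟩ := Int.eq_negSucc_of_lt_zero h
    exact isZero_tor₁_left (isZero_vrHomology G k)
  · obtain ⟨k, rfl⟩ := Int.eq_negSucc_of_lt_zero h
    exact isZero_tor₁_right (isZero_vrHomology G' k)

/-- Only pairs of natural numbers can contribute to the integer-indexed coproduct; homology in
negative degrees is zero. -/
theorem neg_of_not_idxPair (n : ℕ) (p : Pairs (n : ℤ)) (h : ¬ ∃ a, idxPair n a = p) :
    p.1.1 < 0 ∨ p.1.2 < 0 := by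
  by_contra! hp
  obtain ⟨⟨i, j⟩, hij⟩ := p
  lift i to ℕ using hp.1
  lift j to ℕ using hp.2
  exact h ⟨⟨(i, j), by simp only at hij ⊢; omega⟩, rfl⟩

theorem neg_of_not_idxPair' (n : ℕ) (p : Pairs ((n : ℤ) - 1)) (h : ¬ ∃ a, idxPair' n a = p) :
    p.1.1 < 0 ∨ p.1.2 < 0 := by
  by_contra! hp
  obtain ⟨⟨i, j⟩, hij⟩ := p
  lift i to ℕ using hp.1
  lift j to ℕ using hp.2
  exact h ⟨⟨(i, j), by simp only at hij ⊢; omega⟩, rfl⟩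

/-- The terms of the tensor part of the sequence. -/
abbrev tensE (n : ℕ) (a : Idx n) : ModuleCat.{u} R :=
  (scx (rips X) G).homology a.1.1 ⊗ (scx (rips Y) G').homology a.1.2

/-- The terms of the torsion part of the sequence. -/
abbrev torE (n : ℕ) (a : Idx' n) : ModuleCat.{u} R :=
  tor₁ ((scx (rips X) G).homology a.1.1) ((scx (rips Y) G').homology a.1.2)

/-- The isomorphisms of the terms. -/
def tensEIso (n : ℕ) (a : Idx n) :
    X.vrHomology G (idxPair n a).1.1 ⊗ Y.vrHomology G' (idxPair n a).1.2 ≅ tensE X Y G G' n a :=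
  vIso X G a.1.1 ⊗ᵢ vIso Y G' a.1.2

theorem tor₁Map_id (M N : ModuleCat.{u} R) : tor₁Map (𝟙 M) (𝟙 N) = 𝟙 _ := by
  rw [tor₁Map, CategoryTheory.Functor.map_id, CategoryTheory.Functor.map_id, NatTrans.id_app]
  exact Category.id_comp _

/-- The isomorphism of torsion products induced by isomorphisms. -/
def tor₁Iso {M M' N N' : ModuleCat.{u} R} (e : M ≅ M') (f : N ≅ N') : tor₁ M N ≅ tor₁ M' N' where
  hom := tor₁Map e.hom f.hom
  inv := tor₁Map e.inv f.inv
  hom_inv_id := by rw [tor₁Map_comp, Iso.hom_inv_id, Iso.hom_inv_id, tor₁Map_id]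
  inv_hom_id := by rw [tor₁Map_comp, Iso.inv_hom_id, Iso.inv_hom_id, tor₁Map_id]

/-- The isomorphisms of the terms. -/
def torEIso (n : ℕ) (a : Idx' n) :
    tor₁ (X.vrHomology G (idxPair' n a).1.1) (Y.vrHomology G' (idxPair' n a).1.2) ≅
      torE X Y G G' n a :=
  tor₁Iso (vIso X G a.1.1) (vIso Y G' a.1.2)

/-- The tensor term of the sequence in degree `n ≥ 0`. -/
def tensIso (n : ℕ) : ModuleCat.of R (TensTerm (scx (rips X) G) (scx (rips Y) G') n) ≅
    tensorTerm X Y G G' (n : ℤ) :=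
  @asIso (ModuleCat.{u} R) _ (ModuleCat.of R (∀ a, tensE X Y G G' n a))
    (tensorTerm X Y G G' (n : ℤ)) (piToCop (idxPair n) (tensEIso X Y G G' n))
    (isIso_piToCop (idxPair n) (idxPair_injective n)
      (fun p hp => isZero_tensor_of_neg X Y G G' (neg_of_not_idxPair n p hp)) _)

/-- The torsion term of the sequence in degree `n ≥ 0`. -/
def torIso [IsDomain R] [IsPrincipalIdealRing R] (n : ℕ) :
    ModuleCat.of R (TorTerm (scx (rips X) G) (scx (rips Y) G') n) ≅
    torTerm X Y G G' ((n : ℤ) - 1) :=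
  @asIso (ModuleCat.{u} R) _ (ModuleCat.of R (∀ a, torE X Y G G' n a))
    (torTerm X Y G G' ((n : ℤ) - 1)) (piToCop (idxPair' n) (torEIso X Y G G' n))
    (isIso_piToCop (idxPair' n) (idxPair'_injective n)
      (fun p hp => isZero_tor₁_of_neg X Y G G' (neg_of_not_idxPair' n p hp)) _)

variable {X Y X' Y' G G'} (f : Map X X') (g : Map Y Y') {G₁ G₁' : ModuleCat.{u} R} (φ : G ⟶ G₁)
  (ψ : G' ⟶ G₁')

theorem vIso_inv_natural (n : ℕ) : (vIso X G n).inv ≫ vrMap f φ n =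
    homologyMap (scxMap (ripsOf f) φ) n ≫ (vIso X' G₁ n).inv := by
  rw [Iso.inv_comp_eq, ← Category.assoc, Iso.eq_comp_inv]
  exact vIso_natural f φ n

theorem tensEIso_natural (n : ℕ) (a : Idx n) : (tensEIso X Y G G' n a).inv ≫
    (vrMap f φ (idxPair n a).1.1 ⊗ₘ vrMap g ψ (idxPair n a).1.2) =
    (homologyMap (scxMap (ripsOf f) φ) a.1.1 ⊗ₘ homologyMap (scxMap (ripsOf g) ψ) a.1.2) ≫
      (tensEIso X' Y' G₁ G₁' n a).inv :=
  (tensorHom_comp_tensorHom _ _ _ _).trans ((congrArg₂ (· ⊗ₘ ·) (vIso_inv_natural f φ a.1.1)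
    (vIso_inv_natural g ψ a.1.2)).trans (tensorHom_comp_tensorHom _ _ _ _).symm)

theorem torEIso_natural (n : ℕ) (a : Idx' n) : (torEIso X Y G G' n a).inv ≫
    tor₁Map (vrMap f φ (idxPair' n a).1.1) (vrMap g ψ (idxPair' n a).1.2) =
    tor₁Map (homologyMap (scxMap (ripsOf f) φ) a.1.1) (homologyMap (scxMap (ripsOf g) ψ) a.1.2) ≫
      (torEIso X' Y' G₁ G₁' n a).inv :=
  (tor₁Map_comp _ _ _ _).trans ((congrArg₂ tor₁Map (vIso_inv_natural f φ a.1.1)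
    (vIso_inv_natural g ψ a.1.2)).trans (tor₁Map_comp _ _ _ _).symm)

theorem tensIso_natural (n : ℕ) : (tensIso X Y G G' n).hom ≫ tensorTermMap f g φ ψ (n : ℤ) =
    ModuleCat.ofHom (tensTermMap (scxMap (ripsOf f) φ) (scxMap (ripsOf g) ψ) n) ≫
      (tensIso X' Y' G₁ G₁' n).hom := by
  have h := piToCop_natural (F := fun p : Pairs (n : ℤ) => X.vrHomology G p.1.1 ⊗
      Y.vrHomology G' p.1.2) (F' := fun p : Pairs (n : ℤ) => X'.vrHomology G₁ p.1.1 ⊗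
      Y'.vrHomology G₁' p.1.2) (E := tensE X Y G G' n) (E' := tensE X' Y' G₁ G₁' n)
    (idxPair n) (tensEIso X Y G G' n) (tensEIso X' Y' G₁ G₁' n)
    (fun p : Pairs (n : ℤ) => vrMap f φ p.1.1 ⊗ₘ vrMap g ψ p.1.2)
    (fun a => (homologyMap (scxMap (ripsOf f) φ) a.1.1 ⊗ₘ
      homologyMap (scxMap (ripsOf g) ψ) a.1.2).hom) (tensEIso_natural f g φ ψ n)
  exact h

theorem torIso_natural [IsDomain R] [IsPrincipalIdealRing R] (n : ℕ) :
    (torIso X Y G G' n).hom ≫ torTermMap f g φ ψ ((n : ℤ) - 1) =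
    ModuleCat.ofHom (torTermMap' (scxMap (ripsOf f) φ) (scxMap (ripsOf g) ψ) n) ≫
      (torIso X' Y' G₁ G₁' n).hom := by
  have h := piToCop_natural
    (F := fun p : Pairs ((n : ℤ) - 1) => tor₁ (X.vrHomology G p.1.1) (Y.vrHomology G' p.1.2))
    (F' := fun p : Pairs ((n : ℤ) - 1) => tor₁ (X'.vrHomology G₁ p.1.1) (Y'.vrHomology G₁' p.1.2))
    (E := torE X Y G G' n) (E' := torE X' Y' G₁ G₁' n)
    (idxPair' n) (torEIso X Y G G' n) (torEIso X' Y' G₁ G₁' n)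
    (fun p : Pairs ((n : ℤ) - 1) => tor₁Map (vrMap f φ p.1.1) (vrMap g ψ p.1.2))
    (fun a => (tor₁Map (homologyMap (scxMap (ripsOf f) φ) a.1.1)
      (homologyMap (scxMap (ripsOf g) ψ) a.1.2)).hom) (torEIso_natural f g φ ψ n)
  exact h

/-- A sequence isomorphic to a short exact sequence of modules is short exact. -/
theorem shortExact_of_isos {A B C A' B' C' : ModuleCat.{u} R} (a : A' ≅ A) (b : B ≅ B') (c : C ≅ C')
    (i : A ⟶ B) (p : B ⟶ C) (hi : Function.Injective i) (hip : Function.Exact i p)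
    (hp : Function.Surjective p) : ∃ w, (ShortComplex.mk (a.hom ≫ i ≫ b.hom)
      (b.inv ≫ p ≫ c.hom) w).ShortExact := by
  have w : i ≫ p = 0 := ModuleCat.hom_ext (LinearMap.ext fun x => hip.apply_apply_eq_zero x)
  have w' : (a.hom ≫ i ≫ b.hom) ≫ b.inv ≫ p ≫ c.hom = 0 := by simp [reassoc_of% w]
  refine ⟨w', ?_⟩
  have h : (ShortComplex.mk i p w).ShortExact := ModuleCat.shortComplex_shortExact _ hip hi hp
  refine ShortComplex.shortExact_of_iso (ShortComplex.isoMk a.symm b c ?_ ?_) h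
  · simp
  · simp

theorem shortExact_of_isZero {A B C : ModuleCat.{u} R} (hA : IsZero A) (hB : IsZero B)
    (hC : IsZero C) (i : A ⟶ B) (p : B ⟶ C) (w : i ≫ p = 0) :
    (ShortComplex.mk i p w).ShortExact :=
  { exact := ShortComplex.exact_of_isZero_X₂ _ hB
    mono_f := ⟨fun _ _ _ => hA.eq_of_tgt _ _⟩
    epi_g := ⟨fun _ _ _ => hC.eq_of_src _ _⟩ }

theorem retraction_of_isos {𝓒 : Type*} [Category* 𝓒] {A A' B B' : 𝓒} (a : A ≅ A') (b : B' ≅ B)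
    {i : A ⟶ B} {l : B ⟶ A} (h : i ≫ l = 𝟙 A) :
    (a.inv ≫ i ≫ b.inv) ≫ b.hom ≫ l ≫ a.hom = 𝟙 A' := by
  simp [reassoc_of% h]

variable [IsDomain R] [IsPrincipalIdealRing R]

variable (X Y) in
/-- The first map of the Künneth sequence. -/
def vrι (h : IsZero (tor₁ G G')) : ∀ q : ℤ, tensorTerm X Y G G' q ⟶ (X.prod Y).vrHomology (G ⊗ G') q
  | Int.ofNat n => (tensIso X Y G G' n).inv ≫ ModuleCat.ofHom (sι (ripsProd X Y) h n) ≫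
      (vIso (X.prod Y) (G ⊗ G') n).inv
  | Int.negSucc _ => 0

variable (X Y) in
/-- The second map of the Künneth sequence. -/
def vrπ (h : IsZero (tor₁ G G')) :
    ∀ q : ℤ, (X.prod Y).vrHomology (G ⊗ G') q ⟶ torTerm X Y G G' (q - 1)
  | Int.ofNat n => (vIso (X.prod Y) (G ⊗ G') n).hom ≫ ModuleCat.ofHom (sπ (ripsProd X Y) h n) ≫
      (torIso X Y G G' n).hom
  | Int.negSucc _ => 0

/-- Two integers with negative sum cannot both be nonnegative. -/
theorem isZero_tensorTerm_negSucc (n : ℕ) : IsZero (tensorTerm X Y G G' (Int.negSucc n)) :=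
  isZero_cop fun p => isZero_tensor_of_neg X Y G G' (by have := p.2; omega)

theorem isZero_torTerm_negSucc (n : ℕ) : IsZero (torTerm X Y G G' (Int.negSucc n - 1)) :=
  isZero_cop fun p => isZero_tor₁_of_neg X Y G G' (by have := p.2; omega)

theorem exists_vr_shortExact (h : IsZero (tor₁ G G')) (q : ℤ) :
    ∃ w, (ShortComplex.mk (vrι X Y h q) (vrπ X Y h q) w).ShortExact := by
  cases q with
  | ofNat n =>
    exact shortExact_of_isos (tensIso X Y G G' n).symm (vIso (X.prod Y) (G ⊗ G') n).symm
      (torIso X Y G G' n) (ModuleCat.ofHom (sι (ripsProd X Y) h n))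
      (ModuleCat.ofHom (sπ (ripsProd X Y) h n)) (sι_injective _ h n) (sι_sπ_exact _ h n)
      (sπ_surjective _ h n)
  | negSucc n =>
    exact ⟨comp_zero, shortExact_of_isZero (isZero_tensorTerm_negSucc n)
      (isZero_vrHomology (X := X.prod Y) (G ⊗ G') n) (isZero_torTerm_negSucc n) _ _ _⟩

theorem exists_vr_retraction (h : IsZero (tor₁ G G')) (q : ℤ) :
    ∃ r, vrι X Y h q ≫ r = 𝟙 _ := by
  cases q with
  | ofNat n =>
    obtain ⟨l, hl⟩ := exists_retraction_sι (ripsProd X Y) h n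
    have h1 : ModuleCat.ofHom (sι (ripsProd X Y) h n) ≫ ModuleCat.ofHom l = 𝟙 _ :=
      ModuleCat.hom_ext (LinearMap.ext hl)
    refine ⟨(vIso (X.prod Y) (G ⊗ G') n).hom ≫ ModuleCat.ofHom l ≫ (tensIso X Y G G' n).hom, ?_⟩
    exact retraction_of_isos (tensIso X Y G G' n) (vIso (X.prod Y) (G ⊗ G') n) h1
  | negSucc n => exact ⟨0, (isZero_tensorTerm_negSucc n).eq_of_src _ _⟩

theorem vrι_natural (h : IsZero (tor₁ G G')) (h₁ : IsZero (tor₁ G₁ G₁')) (q : ℤ) :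
    vrι X Y h q ≫ vrMap (f.prod g) (φ ⊗ₘ ψ) q = tensorTermMap f g φ ψ q ≫ vrι X' Y' h₁ q := by
  cases q with
  | ofNat n =>
    have e1 := vIso_inv_natural (f.prod g) (φ ⊗ₘ ψ) n
    have e2 : ModuleCat.ofHom (sι (ripsProd X Y) h n) ≫
        homologyMap (scxMap (ripsOf (f.prod g)) (φ ⊗ₘ ψ)) n =
        ModuleCat.ofHom (tensTermMap (scxMap (ripsOf f) φ) (scxMap (ripsOf g) ψ) n) ≫
          ModuleCat.ofHom (sι (ripsProd X' Y') h₁ n) :=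
      ModuleCat.hom_ext (LinearMap.ext fun y => sι_natural (P := ripsProd X Y) (h := h) n
        (ripsProd X' Y') (ripsOf f) (ripsOf g) (ripsOf (f.prod g)) h₁ φ ψ rfl rfl y)
    have e3 : (tensIso X Y G G' n).inv ≫
        ModuleCat.ofHom (tensTermMap (scxMap (ripsOf f) φ) (scxMap (ripsOf g) ψ) n) =
        tensorTermMap f g φ ψ n ≫ (tensIso X' Y' G₁ G₁' n).inv := by
      rw [Iso.inv_comp_eq, ← Category.assoc, Iso.eq_comp_inv]
      exact (tensIso_natural f g φ ψ n).symm
    change ((tensIso X Y G G' n).inv ≫ ModuleCat.ofHom (sι (ripsProd X Y) h n) ≫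
      (vIso (X.prod Y) (G ⊗ G') n).inv) ≫ vrMap (f.prod g) (φ ⊗ₘ ψ) (n : ℤ) =
      tensorTermMap f g φ ψ (n : ℤ) ≫ (tensIso X' Y' G₁ G₁' n).inv ≫
        ModuleCat.ofHom (sι (ripsProd X' Y') h₁ n) ≫ (vIso (X'.prod Y') (G₁ ⊗ G₁') n).inv
    rw [Category.assoc, Category.assoc, e1, reassoc_of% e2, reassoc_of% e3]
  | negSucc n => exact (isZero_tensorTerm_negSucc n).eq_of_src _ _

theorem vrπ_natural (h : IsZero (tor₁ G G')) (h₁ : IsZero (tor₁ G₁ G₁')) (q : ℤ) :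
    vrπ X Y h q ≫ torTermMap f g φ ψ (q - 1) =
      vrMap (f.prod g) (φ ⊗ₘ ψ) q ≫ vrπ X' Y' h₁ q := by
  cases q with
  | ofNat n =>
    have e1 := vIso_natural (f.prod g) (φ ⊗ₘ ψ) n
    have e2 : homologyMap (scxMap (ripsOf (f.prod g)) (φ ⊗ₘ ψ)) n ≫
        ModuleCat.ofHom (sπ (ripsProd X' Y') h₁ n) = ModuleCat.ofHom (sπ (ripsProd X Y) h n) ≫
        ModuleCat.ofHom (torTermMap' (scxMap (ripsOf f) φ) (scxMap (ripsOf g) ψ) n) :=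
      ModuleCat.hom_ext (LinearMap.ext fun y => sπ_natural (P := ripsProd X Y) (h := h) n
        (ripsProd X' Y') (ripsOf f) (ripsOf g) (ripsOf (f.prod g)) h₁ φ ψ rfl rfl y)
    have e3 := torIso_natural f g φ ψ n
    exact (paste_squares e1 e2 e3.symm).symm
  | negSucc n => exact (isZero_vrHomology (X := X.prod Y) (G ⊗ G') n).eq_of_src _ _

variable (R) in
/-- The natural Künneth sequence. -/
def vrSequence : NaturalSequence R where
  ι X Y _ _ _ _ h q := vrι X Y h q
  π X Y _ _ _ _ h q := vrπ X Y h q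
  zero _ _ _ _ _ _ h q := (exists_vr_shortExact h q).choose
  shortExact _ _ _ _ _ _ h q := (exists_vr_shortExact h q).choose_spec
  ι_natural f g _ _ _ _ φ ψ h h₁ q := vrι_natural f g φ ψ h h₁ q
  π_natural f g _ _ _ _ φ ψ h h₁ q := vrπ_natural f g φ ψ h h₁ q

theorem nonempty_splitting (h : IsZero (tor₁ G G')) (q : ℤ) :
    Nonempty ((vrSequence R).seq X Y G G' h q).Splitting := by
  obtain ⟨r, hr⟩ := exists_vr_retraction (X := X) (Y := Y) h q
  have hS := (vrSequence R).shortExact X Y G G' h q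
  exact ⟨ShortComplex.Splitting.ofExactOfRetraction _ hS.exact r hr hS.epi_g⟩

end sequence

end Kunneth
end

noncomputable section

namespace Kunneth

open AlgebraicTopology Opposite HomologicalComplex DoubleComplex SemiUniformSpace
open scoped TensorProduct

variable {R : Type u} [CommRing R]

/-! ### The boundary of a simplex -/

section boundary

variable (K : SSet.{u}) (G : ModuleCat.{u} R)

/-- A simplex with a coefficient, as a chain. -/
abbrev schain {K : SSet.{u}} {n : ℕ} (x : K.obj (op (SimplexCategory.mk n))) (g : G) :
    (scx K G).X n := copiesι G x g

theorem altSum_apply {A B : ModuleCat.{u} R} {m : ℕ} (f : Fin m → (A ⟶ B)) (x : A) :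
    (∑ i : Fin m, (-1 : ℤ) ^ (i : ℕ) • f i).hom x = ∑ i : Fin m, (-1 : ℤ) ^ (i : ℕ) • f i x := by
  rw [ModuleCat.hom_sum, LinearMap.sum_apply]
  refine Finset.sum_congr rfl fun i _ => ?_
  rw [ModuleCat.hom_zsmul, LinearMap.smul_apply]

theorem scx_d_schain (n : ℕ) (x : K.obj (op (SimplexCategory.mk (n + 1)))) (g : G) :
    (scx K G).d (n + 1) n (schain G x g) =
      ∑ i : Fin (n + 2), (-1 : ℤ) ^ (i : ℕ) • schain G (K.map (SimplexCategory.δ i).op x) g := by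
  have e : (scx K G).d (n + 1) n =
      ∑ i : Fin (n + 2), (-1 : ℤ) ^ (i : ℕ) • (sch K G).map (SimplexCategory.δ i).op :=
    AlternatingFaceMapComplex.obj_d_eq _ _
  refine (ConcreteCategory.congr_hom e _).trans ((altSum_apply _ _).trans ?_)
  exact Finset.sum_congr rfl fun i _ => congrArg _ (ConcreteCategory.congr_hom
    (copiesι_map (G := G) (K.map (SimplexCategory.δ i).op) x) g)

theorem scxMap_schain {K L : SSet.{u}} (f : K ⟶ L) {G G' : ModuleCat.{u} R} (φ : G ⟶ G') (n : ℕ)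
    (x : K.obj (op (SimplexCategory.mk n))) (g : G) :
    (scxMap f φ).f n (schain G x g) = schain G' (f.app _ x) (φ g) :=
  ConcreteCategory.congr_hom (ι_schMap f φ (op (SimplexCategory.mk n)) x) g

theorem scx_induction {n : ℕ} {p : (scx K G).X n → Prop} (h0 : p 0)
    (ha : ∀ a b, p a → p b → p (a + b)) (hs : ∀ x g, p (schain G x g)) (c) : p c := by
  obtain ⟨c, rfl⟩ := (copiesEquiv (K.obj (op (SimplexCategory.mk n))) G).symm.surjective c
  induction c using Finsupp.induction_linear with
  | zero => rw [map_zero]; exact h0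
  | add a b ha' hb' => rw [map_add]; exact ha _ _ ha' hb'
  | single x g => rw [copiesEquiv_symm_single]; exact hs x g

variable [hK : ∀ n, Unique (K.obj n)]

theorem scx_d_unique (n : ℕ) (g : G) : (scx K G).d (n + 1) n (schain G default g) =
    (if Even (n + 2) then (0 : ℤ) else 1) • schain G default g := by
  rw [scx_d_schain, ← Fin.sum_neg_one_pow, Finset.sum_smul]
  exact Finset.sum_congr rfl fun i _ => congrArg (fun x => (-1 : ℤ) ^ (i : ℕ) • schain G x g)
    (Subsingleton.elim _ _)

theorem exists_schain_default (n : ℕ) (c : (scx K G).X n) : ∃ g, c = schain G default g := by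
  induction c using scx_induction with
  | h0 => exact ⟨0, (map_zero _).symm⟩
  | ha a b ha hb =>
    obtain ⟨g, rfl⟩ := ha
    obtain ⟨g', rfl⟩ := hb
    exact ⟨g + g', (map_add _ _ _).symm⟩
  | hs x g => exact ⟨g, congrArg (fun y => schain G y g) (Subsingleton.elim _ _)⟩

/-- The complex is `G` in every degree, with differentials alternately zero and the identity. A
class in positive degree is a boundary or has a zero representative, according to parity. -/
theorem isZero_homology_succ_unique (n : ℕ) : IsZero ((scx K G).homology (n + 1)) := by
  refine @ModuleCat.isZero_of_subsingleton _ _ _ (subsingleton_of_forall_eq 0 fun a => ?_)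
  obtain ⟨x, rfl⟩ := cls_surjective _ _ a
  obtain ⟨g, hg⟩ := exists_schain_default K G (n + 1) x.1
  have hx := mem_cyc_succ.1 x.2
  rw [hg, scx_d_unique] at hx
  rw [cls_eq_zero_iff]
  by_cases h : Even n
  · have h1 : ¬ Even (n + 1 + 2) := by simp [Nat.even_add_one, h]
    refine ⟨schain G default g, ?_⟩
    rw [scx_d_unique, if_neg h1, one_smul, hg]
  · have h1 : ¬ Even (n + 2) := by simpa [Nat.even_add_one] using h
    rw [if_neg h1, one_smul] at hx
    refine ⟨0, ?_⟩
    have hg0 : g = 0 := by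
      have h2 := congrArg (copiesEquiv _ G) hx
      rw [copiesEquiv_ι, map_zero] at h2
      exact Finsupp.single_eq_zero.1 h2
    rw [hg, hg0, map_zero]
    exact (map_zero (copiesι G default).hom).symm

theorem projective_homology_zero_unique [Module.Projective R G] :
    Projective ((scx K G).homology 0) := by
  have hinj : Function.Injective (cls (scx K G) 0) := by
    refine (injective_iff_map_eq_zero _).2 fun x hx => ?_
    obtain ⟨y, hy⟩ := (cls_eq_zero_iff _ _).1 hx
    obtain ⟨g, rfl⟩ := exists_schain_default K G 1 y
    rw [scx_d_unique, if_pos (by decide), zero_smul] at hy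
    exact Subtype.ext hy.symm
  have htop : cyc (scx K G) 0 = ⊤ := eq_top_iff.2 fun x _ => mem_cyc_zero _ x
  let e : (PUnit.{u + 1} →₀ G) ≃ₗ[R] (scx K G).X 0 :=
    (Finsupp.domLCongr (Equiv.ofUnique PUnit (K.obj (op (SimplexCategory.mk 0))))).trans
      (copiesEquiv (K.obj (op (SimplexCategory.mk 0))) G).symm
  let e' : G ≃ₗ[R] (scx K G).homology 0 := (Finsupp.uniqueLinearEquiv R G PUnit.unit).symm.trans
    (e.trans ((LinearEquiv.ofTop _ htop).symm.trans
      (LinearEquiv.ofBijective _ ⟨hinj, cls_surjective _ _⟩)))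
  exact (IsProjective.iff_projective _).1 (Module.Projective.of_equiv e')

theorem homologyMap_zero_surjective {G G' : ModuleCat.{u} R} (r : G ⟶ G')
    (hr : Function.Surjective r) : Function.Surjective (homologyMap (scxMap (𝟙 K) r) 0) := by
  intro a
  obtain ⟨x, rfl⟩ := cls_surjective _ _ a
  obtain ⟨g, hg⟩ := exists_schain_default K G' 0 x.1
  obtain ⟨g, rfl⟩ := hr g
  refine ⟨cls _ 0 ⟨schain G default g, mem_cyc_zero _ _⟩, ?_⟩
  refine (homologyMap_cls _ _).trans (congrArg (cls _ 0) (Subtype.ext ?_))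
  refine (scxMap_schain (𝟙 K) r 0 default g).trans hg.symm

end boundary

end Kunneth
end

noncomputable section

namespace Kunneth

open AlgebraicTopology Opposite HomologicalComplex DoubleComplex SemiUniformSpace
open scoped TensorProduct

variable {R : Type u} [CommRing R]

/-! ### Products with a point and natural splittings -/

section point

/-- The identity map. -/
def idMap (X : SemiUniformSpace.{u}) : Map X X where
  toFun x := x
  preimage_mem _ h := h

variable {X X' Y : SemiUniformSpace.{u}} [X.HasExtremal] [X'.HasExtremal] [Y.HasExtremal]
  (G G' : ModuleCat.{u} R)

theorem vrMap_idMap_surjective_of_homologyMap {G G' : ModuleCat.{u} R} (r : G ⟶ G') (n : ℕ)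
    (h : Function.Surjective (homologyMap (scxMap (𝟙 (rips X)) r) n)) :
    Epi (vrMap (idMap X) r (n : ℤ)) := by
  have h1 : Epi (homologyMap (scxMap (ripsOf (idMap X)) r) n) :=
    (ModuleCat.epi_iff_surjective _).2 h
  have h2 : vrMap (idMap X) r (n : ℤ) = (vIso X G n).hom ≫
      homologyMap (scxMap (ripsOf (idMap X)) r) n ≫ (vIso X G' n).inv := by
    rw [← Category.assoc, Iso.eq_comp_inv]
    exact vIso_natural (idMap X) r n
  rw [h2]
  infer_instance

instance epi_vrMap_idMap_id (q : ℤ) : Epi (vrMap (idMap X) (𝟙 G) q) := by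
  cases q with
  | ofNat n =>
    refine vrMap_idMap_surjective_of_homologyMap (𝟙 G) n ?_
    have h : scxMap (𝟙 (rips X)) (𝟙 G) = 𝟙 _ := by
      refine (congrArg alt.map (?_ : schMap (𝟙 (rips X)) (𝟙 G) = 𝟙 _)).trans
        (alt.map_id _)
      refine NatTrans.ext (funext fun n => copies_hom_ext fun k => ?_)
      exact (ι_schMap (𝟙 _) (𝟙 G) n k).trans ((Category.id_comp _).trans (Category.comp_id _).symm)
    rw [h]
    exact (homologyMap_id_bijective _ n).2
  | negSucc n => exact ⟨fun _ _ _ => (isZero_vrHomology G n).eq_of_src _ _⟩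

/-! ### A point as second factor -/

section unique

variable [Unique Y.carrier]

instance (n : SimplexCategoryᵒᵖ) : Unique ((rips Y).obj n) where
  default := ⟨fun _ => default, fun _ _ _ => extr_refl Y _⟩
  uniq _ := Subtype.ext (funext fun _ => Unique.eq_default _)

theorem isZero_vrHomology_point_succ (n : ℕ) : IsZero (Y.vrHomology G ((n + 1 : ℕ) : ℤ)) :=
  (isZero_homology_succ_unique (rips Y) G n).of_iso (vIso Y G (n + 1))

theorem epi_vrMap_point {G G' : ModuleCat.{u} R} (r : G ⟶ G') [Epi r] (q : ℤ) :
    Epi (vrMap (idMap Y) r q) := by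
  cases q with
  | ofNat n =>
    cases n with
    | zero =>
      exact vrMap_idMap_surjective_of_homologyMap (X := Y) r 0
        (homologyMap_zero_surjective (rips Y) r ((ModuleCat.epi_iff_surjective r).1 inferInstance))
    | succ n => exact ⟨fun _ _ _ => (isZero_vrHomology_point_succ G' n).eq_of_src _ _⟩
  | negSucc n => exact ⟨fun _ _ _ => (isZero_vrHomology G' n).eq_of_src _ _⟩

theorem projective_vrHomology_point [Module.Projective R G] (q : ℤ) :
    Projective (Y.vrHomology G q) := by
  cases q with
  | ofNat n =>
    cases n with
    | zero => exact Projective.of_iso (vIso Y G 0).symm (projective_homology_zero_unique (rips Y) G)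
    | succ n => exact (isZero_vrHomology_point_succ G n).projective
  | negSucc n => exact (isZero_vrHomology G n).projective

/-- The homology of a point with projective coefficients is projective in every degree, so each
torsion product vanishes. -/
theorem isZero_torTerm_point [Module.Projective R G'] (q : ℤ) : IsZero (torTerm X Y G G' q) :=
  isZero_cop fun p =>
    haveI := projective_vrHomology_point (Y := Y) G' p.1.2
    isZero_Tor_succ_of_projective _ _ _ 0

theorem epi_tensorHom {A A' B B' : ModuleCat.{u} R} (a : A ⟶ A') (b : B ⟶ B') [Epi a] [Epi b] :
    Epi (a ⊗ₘ b) :=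
  (ModuleCat.epi_iff_surjective _).2 (TensorProduct.map_surjective
    ((ModuleCat.epi_iff_surjective a).1 inferInstance)
    ((ModuleCat.epi_iff_surjective b).1 inferInstance))

/-- A surjection of coefficients is surjective on the homology of a point, so the whole tensor term
lifts along `r`. -/
theorem epi_tensorTermMap_point {G G' : ModuleCat.{u} R} (A : ModuleCat.{u} R) (r : G ⟶ G') [Epi r]
    (q : ℤ) : Epi (tensorTermMap (idMap X) (idMap Y) (𝟙 A) r q) := by
  have h : ∀ p : Pairs q, Epi (vrMap (idMap X) (𝟙 A) p.1.1 ⊗ₘ vrMap (idMap Y) r p.1.2) := fun p =>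
    haveI := epi_vrMap_point (Y := Y) r p.1.2
    epi_tensorHom _ _
  exact Sigma.map_epi _

variable {G G'}

/-- If the image of a class under `f` is the reduction of a class with projective coefficients, but
not the image of such a reduction, then the sequences do not split naturally. -/
theorem not_splitsNaturally {A : ModuleCat.{u} R} [Module.Projective R A] (r : A ⟶ G') [Epi r]
    (h : IsZero (tor₁ G G')) (h₀ : IsZero (tor₁ G A)) (f : Map X X') (q : ℤ)
    (c : (X.prod Y).vrHomology (G ⊗ G') q) (d : (X'.prod Y).vrHomology (G ⊗ A) q)
    (hd : vrMap (f.prod (idMap Y)) (𝟙 G ⊗ₘ 𝟙 G') q c =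
      vrMap ((idMap X').prod (idMap Y)) (𝟙 G ⊗ₘ r) q d)
    (hne : ∀ e : (X.prod Y).vrHomology (G ⊗ A) q, vrMap (f.prod (idMap Y)) (𝟙 G ⊗ₘ 𝟙 G') q c ≠
      vrMap (f.prod (idMap Y)) (𝟙 G ⊗ₘ 𝟙 G') q
        (vrMap ((idMap X).prod (idMap Y)) (𝟙 G ⊗ₘ r) q e))
    (K : NaturalSequence R) : ¬ K.SplitsNaturally G G' h := by
  rintro ⟨s, hs, hn⟩
  have hn' := hn f (idMap Y) q
  rw [← id_tensorHom_id] at hn'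
  -- The image of `c` is the reduction of `d`, and `π` of it factors through the torsion term for
  -- `A`, which is zero.
  have h1 : K.π X' Y G G' h q (vrMap (f.prod (idMap Y)) (𝟙 G ⊗ₘ 𝟙 G') q c) = 0 := by
    rw [hd]
    refine (ConcreteCategory.congr_hom
      (K.π_natural (idMap X') (idMap Y) (𝟙 G) r h₀ h q) d).symm.trans ?_
    have := ModuleCat.subsingleton_of_isZero
      (isZero_torTerm_point (X := X') (Y := Y) G A (q - 1))
    refine (congrArg (torTermMap (idMap X') (idMap Y) (𝟙 G) r (q - 1))
      (Subsingleton.elim (K.π X' Y G A h₀ q d) 0)).trans (map_zero _)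
  -- This is the use of naturality of the section: the map `f` can be moved past `s` and `π`.
  have h2 : vrMap (f.prod (idMap Y)) (𝟙 G ⊗ₘ 𝟙 G') q (s X Y q (K.π X Y G G' h q c)) = 0 := by
    refine (ConcreteCategory.congr_hom hn' _).trans ?_
    have h3 := ConcreteCategory.congr_hom (K.π_natural f (idMap Y) (𝟙 G) (𝟙 G') h h q) c
    exact (congrArg (s X' Y q) (h3.trans h1)).trans (map_zero _)
  have h4 : K.π X Y G G' h q (c - s X Y q (K.π X Y G G' h q c)) = 0 := by
    rw [map_sub, sub_eq_zero]
    exact (ConcreteCategory.congr_hom (hs X Y q) _).symm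
  -- The difference lies in the tensor part, which lifts to coefficients `A`. It has the same image
  -- as `c` under `f`, so that image comes from a reduction, against `hne`.
  obtain ⟨w, hw⟩ : ∃ w, K.ι X Y G G' h q w = c - s X Y q (K.π X Y G G' h q c) :=
    ((ShortComplex.ShortExact.moduleCat_exact_iff_function_exact _).1
      (K.shortExact X Y G G' h q).exact _).1 h4
  obtain ⟨w, rfl⟩ := (ModuleCat.epi_iff_surjective _).1
    (epi_tensorTermMap_point (X := X) (Y := Y) G r q) w
  refine hne (K.ι X Y G A h₀ q w) ?_
  have h5 := ConcreteCategory.congr_hom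
    (K.ι_natural (idMap X) (idMap Y) (𝟙 G) r h₀ h q) w
  refine Eq.trans ?_ (congrArg (vrMap (f.prod (idMap Y)) (𝟙 G ⊗ₘ 𝟙 G') q)
    (h5.trans hw)).symm
  rw [map_sub, h2, sub_zero]

end unique

end point

end Kunneth
end

noncomputable section

namespace Kunneth

open AlgebraicTopology Opposite HomologicalComplex DoubleComplex SemiUniformSpace
open scoped TensorProduct

/-! ### Graphs as semi-uniform spaces -/

section graph

/-- The one-point space. -/
def onePoint : SemiUniformSpace.{u} where
  carrier := PUnit
  entourages := ⊤
  proper := inferInstance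
  refl _ hU x := by rw [Filter.mem_top.1 hU]; trivial
  symm U hU := ⟨U, hU, fun p _ => by rw [Filter.mem_top.1 hU]; trivial⟩

instance : Unique onePoint.{u}.carrier := inferInstanceAs (Unique PUnit)

instance : onePoint.{u}.HasExtremal :=
  ⟨Set.univ, isExtremal_iff.2 ⟨Filter.univ_mem, fun _ hV => (Filter.mem_top.1 hV).ge⟩⟩

/-- A finite reflexive graph. -/
structure Graph (n : ℕ) where
  adj : Fin n → Fin n → Bool
  refl : ∀ a, adj a a
  symm : ∀ a b, adj a b → adj b a

variable {n m : ℕ} [NeZero n] [NeZero m]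

/-- The edge relation of a graph. -/
def Graph.edges (Γ : Graph n) : Set (ULift.{u} (Fin n) × ULift.{u} (Fin n)) :=
  {p | Γ.adj p.1.down p.2.down}

/-- The semi-uniform space of a graph. -/
def Graph.space (Γ : Graph n) : SemiUniformSpace.{u} where
  carrier := ULift.{u} (Fin n)
  entourages := Filter.principal Γ.edges
  proper := Filter.principal_neBot_iff.2 ⟨(⟨0⟩, ⟨0⟩), Γ.refl 0⟩
  refl _ hU x := hU (Γ.refl x.down)
  symm _ hU := ⟨Γ.edges, Filter.mem_principal_self _, fun _ hp => hU (Γ.symm _ _ hp)⟩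

theorem Graph.isExtremal_edges (Γ : Graph n) : Γ.space.IsExtremal Γ.edges.{u} :=
  isExtremal_iff.2 ⟨Filter.mem_principal_self _, fun _ hV => hV⟩

instance (Γ : Graph n) : Γ.space.{u}.HasExtremal := ⟨_, Γ.isExtremal_edges⟩

/-- The map of spaces given by a map of graphs. -/
def Graph.map {Γ : Graph n} {Γ' : Graph m} (f : Fin n → Fin m)
    (hf : ∀ a b, Γ.adj a b → Γ'.adj (f a) (f b)) : Map Γ.space.{u} Γ'.space.{u} where
  toFun x := ⟨f x.down⟩
  preimage_mem _ hV := fun p hp => hV (hf p.1.down p.2.down hp)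

/-- The Vietoris–Rips complex of the product of a graph with a point. -/
abbrev Graph.rips (Γ : Graph n) : SSet.{u} := Kunneth.rips (Γ.space.prod onePoint)

theorem Graph.mem_extr (Γ : Graph n) (p : (Γ.space.prod onePoint.{u}).carrier ×
    (Γ.space.prod onePoint.{u}).carrier) : p ∈ (extr (Γ.space.prod onePoint)).1 ↔
      Γ.adj p.1.1.down p.2.1.down := by
  rw [extr_prod, isExtremal_unique (isExtremal_extr Γ.space) Γ.isExtremal_edges]
  refine ⟨fun h => h.1, fun h => ⟨h, ?_⟩⟩
  rw [Filter.mem_top.1 (extr onePoint).2]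
  trivial

/-- The simplex with given vertices. -/
def Graph.spx (Γ : Graph n) {k : ℕ} (v : Fin (k + 1) → Fin n)
    (hv : ∀ i j, Γ.adj (v i) (v j)) : Γ.rips.{u}.obj (op (SimplexCategory.mk k)) :=
  ⟨fun i => (⟨v i⟩, PUnit.unit), fun i j _ => (Γ.mem_extr _).2 (hv i j)⟩

/-- The vertices of a simplex. -/
def Graph.vert {Γ : Graph n} {k : ℕ} (x : Γ.rips.{u}.obj (op (SimplexCategory.mk k)))
    (i : Fin (k + 1)) : Fin n := (x.1 i).1.down

theorem Graph.vert_injective (Γ : Graph n) {k : ℕ} :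
    Function.Injective (Graph.vert : Γ.rips.{u}.obj (op (SimplexCategory.mk k)) → _) :=
  fun _ _ h => Subtype.ext (funext fun i => Prod.ext (ULift.ext _ _ (congrFun h i)) rfl)

/-- Simplices only prescribe the relation for increasing indices; symmetry and reflexivity of the
graph supply the rest. -/
theorem Graph.adj_vert {Γ : Graph n} {k : ℕ} (x : Γ.rips.{u}.obj (op (SimplexCategory.mk k)))
    (i j : Fin (k + 1)) : Γ.adj (vert x i) (vert x j) := by
  rcases lt_trichotomy i j with h | rfl | h
  · exact (Γ.mem_extr _).1 (x.2 i j h)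
  · exact Γ.refl _
  · exact Γ.symm _ _ ((Γ.mem_extr _).1 (x.2 j i h))end graph

/-! ### Chains and cochains -/

section chains

variable {R : Type u} [CommRing R] {n m : ℕ} [NeZero n] [NeZero m]

/-- The combination of simplices with given vertices and coefficients. -/
def Graph.chain (Γ : Graph n) {k T : ℕ} (σ : Fin T → Fin (k + 1) → Fin n)
    (hσ : ∀ t i j, Γ.adj (σ t i) (σ t j)) (a : Fin T → ℤ) {G : ModuleCat.{u} R} (g : G) :
    (scx Γ.rips G).X k := ∑ t, a t • schain G (Γ.spx (σ t) (hσ t)) g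

/-- The coefficient of a face in the boundary of a combination of simplices. -/
def faceCoeff {n k T : ℕ} (σ : Fin T → Fin (k + 2) → Fin n) (a : Fin T → ℤ)
    (e : Fin (k + 1) → Fin n) : ℤ :=
  ∑ t, ∑ i : Fin (k + 2), if σ t ∘ i.succAbove = e then (-1) ^ i.val * a t else 0

/-- Each face occurs in the boundary with an integer multiple of `l` as coefficient, and `l` kills
`g`. The case `l = 2` serves cycles modulo two, and `l = 0` integral ones. -/
theorem Graph.d_chain (Γ : Graph n) {k T : ℕ} (σ : Fin T → Fin (k + 2) → Fin n)
    (hσ : ∀ t i j, Γ.adj (σ t i) (σ t j)) (a : Fin T → ℤ) {G : ModuleCat.{u} R} (g : G) (l : ℤ)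
    (hl : l • g = 0) (h : ∀ e : Fin (k + 1) → Fin n, l ∣ faceCoeff σ a e) :
    (scx Γ.rips G).d (k + 1) k (Γ.chain σ hσ a g) = 0 := by
  classical
  have e1 : (scx Γ.rips G).d (k + 1) k (Γ.chain σ hσ a g) = ∑ t, a t • ∑ i : Fin (k + 2),
      (-1 : ℤ) ^ (i : ℕ) • schain G (Γ.rips.map (SimplexCategory.δ i).op
        (Γ.spx (σ t) (hσ t))) g := by
    refine (map_sum ((scx Γ.rips G).d (k + 1) k).hom _ _).trans
      (Finset.sum_congr rfl fun t _ => ?_)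
    exact (map_zsmul ((scx Γ.rips G).d (k + 1) k).hom _ _).trans
      (congrArg (a t • ·) (scx_d_schain _ _ _ _ _))
  rw [e1]
  apply (copiesEquiv (Γ.rips.obj (op (SimplexCategory.mk k))) G).injective
  rw [map_zero, map_sum]
  refine Finsupp.ext fun e => ?_
  have e2 : ∀ t, (copiesEquiv (Γ.rips.obj (op (SimplexCategory.mk k))) G)
      (a t • ∑ i : Fin (k + 2), (-1 : ℤ) ^ (i : ℕ) • schain G
        (Γ.rips.map (SimplexCategory.δ i).op (Γ.spx (σ t) (hσ t))) g) e =
      (∑ i : Fin (k + 2), if σ t ∘ i.succAbove = vert e then (-1) ^ i.val * a t else 0) • g := by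
    intro t
    rw [map_zsmul, map_sum, Finsupp.smul_apply, Finsupp.finsetSum_apply, Finset.smul_sum,
      Finset.sum_smul]
    refine Finset.sum_congr rfl fun i _ => ?_
    rw [map_zsmul, Finsupp.smul_apply]
    refine (congrArg (fun z => a t • (-1 : ℤ) ^ (i : ℕ) • z) (DFunLike.congr_fun
      (copiesEquiv_ι G (Γ.rips.map (SimplexCategory.δ i).op (Γ.spx (σ t) (hσ t))) g) e)).trans ?_
    rw [Finsupp.single_apply]
    have e3 : (Γ.rips.map (SimplexCategory.δ i).op (Γ.spx (σ t) (hσ t)) = e) ↔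
        σ t ∘ i.succAbove = vert e := Γ.vert_injective.eq_iff.symm
    by_cases h4 : σ t ∘ i.succAbove = vert e
    · rw [if_pos h4, if_pos (e3.2 h4), smul_smul, mul_comm]
    · rw [if_neg h4, if_neg (mt e3.1 h4), smul_zero, smul_zero, zero_smul]
  rw [Finsupp.finsetSum_apply, Finset.sum_congr rfl fun t _ => e2 t, ← Finset.sum_smul]
  obtain ⟨b, hb⟩ := h (vert e)
  change faceCoeff σ a (vert e) • g = 0
  rw [hb, mul_comm, mul_smul, hl, smul_zero]

/-- The cochain with given values. -/
def cochain {K : SSet.{u}} {k : ℕ} (w : K.obj (op (SimplexCategory.mk k)) → ℤ)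
    {G M : ModuleCat.{u} R} (f : G ⟶ M) : (scx K G).X k ⟶ M :=
  Sigma.desc fun x => w x • f

theorem cochain_schain {K : SSet.{u}} {k : ℕ} (w : K.obj (op (SimplexCategory.mk k)) → ℤ)
    {G M : ModuleCat.{u} R} (f : G ⟶ M) (x : K.obj (op (SimplexCategory.mk k))) (g : G) :
    cochain w f (schain G x g) = w x • f g :=
  ConcreteCategory.congr_hom (Sigma.ι_desc (fun x => w x • f) x) g

theorem cochain_d {K : SSet.{u}} {k : ℕ} (w : K.obj (op (SimplexCategory.mk k)) → ℤ)
    {G M : ModuleCat.{u} R} (f : G ⟶ M) (x : K.obj (op (SimplexCategory.mk (k + 1)))) (g : G) :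
    cochain w f ((scx K G).d (k + 1) k (schain G x g)) =
      (∑ i : Fin (k + 2), (-1) ^ i.val * w (K.map (SimplexCategory.δ i).op x)) • f g := by
  rw [scx_d_schain, Finset.sum_smul]
  refine (map_sum (cochain w f).hom _ _).trans (Finset.sum_congr rfl fun i _ => ?_)
  refine (map_zsmul (cochain w f).hom _ _).trans ?_
  rw [mul_smul]
  exact congrArg _ (cochain_schain w f _ g)

end chains

end Kunneth
end

noncomputable section

namespace Kunneth

open AlgebraicTopology Opposite HomologicalComplex DoubleComplex SemiUniformSpace
open scoped TensorProduct

/-! ### The projective plane -/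

section projectivePlane

/-- The graph of the octahedron. -/
def octahedron : Graph 6 where
  adj a b := a.val + 3 != b.val && b.val + 3 != a.val
  refl := by decide +kernel
  symm := by decide +kernel

/-- The triangles of a triangulation of the projective plane. -/
def triangles : Fin 22 → Fin 3 → Fin 12 :=
  ![![0, 1, 2], ![0, 1, 11], ![0, 2, 9], ![0, 9, 10], ![0, 10, 11], ![1, 2, 3], ![1, 3, 4],
    ![1, 4, 11], ![2, 3, 5], ![2, 5, 9], ![3, 4, 7], ![3, 5, 8], ![3, 7, 10], ![3, 8, 10],
    ![4, 6, 9], ![4, 6, 11], ![4, 7, 9], ![5, 6, 9], ![5, 6, 11], ![5, 8, 11], ![7, 9, 10],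
    ![8, 10, 11]]

/-- The graph of the triangulation: two vertices are adjacent if they lie in a common triangle. -/
def projPlane : Graph 12 where
  adj a b := decide (∃ t, (∃ i, triangles t i = a) ∧ ∃ j, triangles t j = b)
  refl := by decide +kernel
  symm := by decide +kernel

theorem triangles_adj (t : Fin 22) (i j : Fin 3) :
    projPlane.adj (triangles t i) (triangles t j) :=
  decide_eq_true ⟨t, ⟨i, rfl⟩, j, rfl⟩

/-- The map that collapses the complement of a neighbourhood of a triangle. -/
def collapse : Fin 12 → Fin 6 := ![0, 1, 2, 3, 3, 3, 3, 3, 3, 4, 4, 5]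

theorem collapse_adj (a b : Fin 12) (h : projPlane.adj a b) :
    octahedron.adj (collapse a) (collapse b) := by
  revert a b; decide +kernel

/-- Orientations of the images of the triangles. -/
def octSign : Fin 22 → ℤ :=
  ![1, -1, 1, 1, 1, -1, 1, -1, -1, 1, 1, -1, 1, -1, 1, -1, 1, -1, 1, -1, -1, -1]

/-- The cochain dual to a face of the octahedron. -/
def octForm (x : Fin 3 → Fin 6) : ℤ :=
  if (x 0 < 3 ∧ x 1 < 3 ∧ x 2 < 3) ∧ x 0 ≠ x 1 ∧ x 1 ≠ x 2 ∧ x 0 ≠ x 2 then 1 else 0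

/-- The edges on which `projForm` takes the value `1`. -/
def arrows : List (Fin 12 × Fin 12) :=
  [(1, 2), (1, 3), (4, 7), (9, 10), (2, 0), (9, 0), (4, 3), (9, 7)]

/-- A cochain on the projective plane whose coboundary modulo `4` is twice the pullback of
`octForm`. -/
def projForm (x : Fin 2 → Fin 12) : ℤ :=
  (if (x 0, x 1) ∈ arrows then 1 else 0) - (if (x 1, x 0) ∈ arrows then 1 else 0)

/-- Every edge lies in an even number of triangles, so the sum of all triangles is a cycle modulo
two. -/
theorem faceCoeff_triangles (e : Fin 2 → Fin 12) : 2 ∣ faceCoeff triangles (fun _ => 1) e := by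
  have h : ∀ a b, (2 : ℤ) ∣ faceCoeff triangles (fun _ => 1) ![a, b] := by decide +kernel
  have he : e = ![e 0, e 1] := by ext i; fin_cases i <;> rfl
  rw [he]
  exact h _ _

/-- After the collapse the triangles can be oriented to form an integral cycle. The chains are not
normalised, so degenerate images have boundaries too, and their signs in `octSign` matter. -/
theorem faceCoeff_collapse (e : Fin 2 → Fin 6) :
    0 ∣ faceCoeff (fun t => collapse ∘ triangles t) octSign e := by
  have h : ∀ a b, faceCoeff (fun t => collapse ∘ triangles t) octSign ![a, b] = 0 := by
    decide +kernel
  have he : e = ![e 0, e 1] := by ext i; fin_cases i <;> rfl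
  rw [he]
  exact (h _ _).symm.dvd

/-- A clique contains at most one vertex of each of the three antipodal pairs, so four vertices
repeat one. Modulo two the order of the vertices is irrelevant, and for this reason `octForm`
carries no sign. -/
theorem octForm_cocycle (x : Fin 4 → Fin 6) (hx : ∀ i j, octahedron.adj (x i) (x j)) :
    2 ∣ ∑ i : Fin 4, (-1) ^ i.val * octForm (x ∘ i.succAbove) := by
  have h : ∀ a b c d : Fin 6, octahedron.adj a b → octahedron.adj a c → octahedron.adj a d →
      octahedron.adj b c → octahedron.adj b d → octahedron.adj c d →
        (2 : ℤ) ∣ ∑ i : Fin 4, (-1) ^ i.val * octForm (![a, b, c, d] ∘ i.succAbove) := by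
    decide +kernel
  have he : x = ![x 0, x 1, x 2, x 3] := by ext i; fin_cases i <;> rfl
  have := h (x 0) (x 1) (x 2) (x 3) (hx _ _) (hx _ _) (hx _ _) (hx _ _) (hx _ _) (hx _ _)
  rwa [← he] at this

/-- Only the triangle `{0, 1, 2}` is mapped onto that face: the collapse has degree one modulo two.
-/
theorem sum_octForm : ∑ t, octForm (collapse ∘ triangles t) = 1 := by
  decide +kernel

/-- Twice a top cocycle of the projective plane is a coboundary. Working modulo four hides the
missing signs of `octForm`. The check covers all cliques, degenerate ones included, so nothing is
assumed about which cliques are faces of the triangulation. -/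
theorem projForm_coboundary (x : Fin 3 → Fin 12) (hx : ∀ i j, projPlane.adj (x i) (x j)) :
    4 ∣ 2 * octForm (collapse ∘ x) - ∑ i : Fin 3, (-1) ^ i.val * projForm (x ∘ i.succAbove) := by
  have h : ∀ a b c : Fin 12, projPlane.adj a b → projPlane.adj a c → projPlane.adj b c →
      (4 : ℤ) ∣ 2 * octForm (collapse ∘ ![a, b, c]) -
        ∑ i : Fin 3, (-1) ^ i.val * projForm (![a, b, c] ∘ i.succAbove) := by
    decide +kernel
  have he : x = ![x 0, x 1, x 2] := by ext i; fin_cases i <;> rfl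
  have := h (x 0) (x 1) (x 2) (hx _ _) (hx _ _) (hx _ _)
  rwa [← he] at this

theorem odd_octSign (t : Fin 22) : 2 ∣ octSign t - 1 := by
  revert t; decide +kernel

end projectivePlane

/-! ### Failure of natural splitting -/

section coefficients

variable (R : Type u) [CommRing R]

/-- The ring as a module. -/
abbrev unitMod : ModuleCat.{u} R := ModuleCat.of R R

/-- The quotient of the ring by the ideal generated by an element. -/
abbrev quotMod (a : R) : ModuleCat.{u} R := ModuleCat.of R (R ⧸ Ideal.span {a})

/-- Reduction. -/
def red (a : R) : unitMod R ⟶ quotMod R a := ModuleCat.ofHom (Ideal.span {a}).mkQ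

instance (a : R) : Epi (red R a) :=
  (ModuleCat.epi_iff_surjective _).2 (Submodule.mkQ_surjective _)

/-- Multiplication by two. -/
def dblQ : (R ⧸ Ideal.span {(2 : R)}) →ₗ[R] (R ⧸ Ideal.span {(4 : R)}) :=
  Submodule.liftQ _ ((2 : R) • (Ideal.span {(4 : R)}).mkQ) (by
    rw [Ideal.span_le, Set.singleton_subset_iff]
    change (2 : R) • (Ideal.span {(4 : R)}).mkQ 2 = 0
    rw [← map_smul, Submodule.mkQ_apply, Submodule.Quotient.mk_eq_zero, smul_eq_mul]
    norm_num)

/-- Multiplication by two, after identifying `R ⊗ R/2` with `R/2`. -/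
def dbl : unitMod R ⊗ quotMod R 2 ⟶ quotMod R 4 :=
  ModuleCat.ofHom (dblQ R ∘ₗ (TensorProduct.lid R (R ⧸ Ideal.span {(2 : R)})).toLinearMap)

/-- Multiplication followed by reduction. -/
def mulRed : unitMod R ⊗ unitMod R ⟶ quotMod R 4 :=
  ModuleCat.ofHom ((Ideal.span {(4 : R)}).mkQ ∘ₗ (TensorProduct.lid R R).toLinearMap)

theorem dbl_red (z : (unitMod R ⊗ unitMod R : ModuleCat.{u} R)) :
    dbl R ((𝟙 (unitMod R) ⊗ₘ red R 2) z) = (2 : ℤ) • mulRed R z := by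
  have h : (𝟙 (unitMod R) ⊗ₘ red R 2) ≫ dbl R = (2 : ℤ) • mulRed R := by
    refine ModuleCat.hom_ext (TensorProduct.ext' fun x y => ?_)
    change dblQ R (x • (Ideal.span {(2 : R)}).mkQ y) = (2 : ℤ) • (Ideal.span {(4 : R)}).mkQ (x • y)
    rw [← map_smul]
    have key : ∀ v : R ⧸ Ideal.span {(4 : R)}, (2 : R) • v = (2 : ℤ) • v := fun v => by
      rw [two_smul, two_smul]
    exact key ((Ideal.span {(4 : R)}).mkQ (x • y))
  exact ConcreteCategory.congr_hom h z

/-- The generator of `R ⊗ R/2`. -/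
def gen : (unitMod R ⊗ quotMod R 2 : ModuleCat.{u} R) :=
  (𝟙 (unitMod R) ⊗ₘ red R 2) ((1 : R) ⊗ₜ[R] (1 : R))

theorem two_smul_gen : (2 : ℤ) • gen R = 0 := by
  change (2 : ℤ) • ((1 : R) ⊗ₜ[R] (Ideal.span {(2 : R)}).mkQ 1) = 0
  rw [two_smul, ← TensorProduct.tmul_add, ← map_add, one_add_one_eq_two]
  have : (Ideal.span {(2 : R)}).mkQ 2 = 0 :=
    (Submodule.Quotient.mk_eq_zero _).2 (Ideal.mem_span_singleton_self 2)
  rw [this, TensorProduct.tmul_zero]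

/-- The value is the class of `2` modulo `4`. -/
theorem dbl_gen (h2 : (2 : R) ∉ Ideal.span {(4 : R)}) : dbl R (gen R) ≠ 0 := by
  intro h
  have h1 : (2 : ℤ) • (Ideal.span {(4 : R)}).mkQ ((1 : R) • (1 : R)) = 0 :=
    (dbl_red R ((1 : R) ⊗ₜ[R] (1 : R))).symm.trans h
  rw [smul_eq_mul, mul_one, two_smul, ← map_add, one_add_one_eq_two] at h1
  exact h2 ((Submodule.Quotient.mk_eq_zero _).1 h1)

theorem two_smul_dbl (z : (unitMod R ⊗ quotMod R 2 : ModuleCat.{u} R)) :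
    (2 : ℤ) • dbl R z = 0 := by
  obtain ⟨w, rfl⟩ := (ModuleCat.epi_iff_surjective _).1
    (epi_tensorHom (𝟙 (unitMod R)) (red R 2)) z
  have h4 : (4 : ℤ) • mulRed R w = 0 := by
    obtain ⟨y, hy⟩ := Submodule.mkQ_surjective _ (mulRed R w)
    rw [← hy, ← map_zsmul]
    refine (Submodule.Quotient.mk_eq_zero _).2 (Ideal.mem_span_singleton.2 ⟨y, ?_⟩)
    rw [zsmul_eq_mul]
    norm_num
  rw [dbl_red, smul_smul]
  exact h4

theorem four_smul_mulRed (w : (unitMod R ⊗ unitMod R : ModuleCat.{u} R)) :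
    (4 : ℤ) • mulRed R w = 0 := by
  have := two_smul_dbl R ((𝟙 (unitMod R) ⊗ₘ red R 2) w)
  rwa [dbl_red, smul_smul] at this

theorem isZero_tor₁_unitMod [IsDomain R] [IsPrincipalIdealRing R] (N : ModuleCat.{u} R) :
    IsZero (tor₁ (unitMod R) N) := by
  obtain ⟨F₁, F₀, i, p, w, hS, hF₁, hF₀⟩ := exists_presentation N
  exact (isZero_tor₁_iff (unitMod R) hS ((IsProjective.iff_projective _).1 hF₁)
    ((IsProjective.iff_projective _).1 hF₀)).2
      (Module.Flat.lTensor_preserves_injective_linearMap i.hom hS.moduleCat_injective_f)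

end coefficients

/-! ### The two fundamental cycles and the cochain that detects the obstruction -/

section counterexample

variable (R : Type u) [CommRing R]

/-- The collapse as a map of spaces. -/
abbrev collapseMap : Map projPlane.space.{u} octahedron.space.{u} := Graph.map collapse collapse_adj

theorem Graph.scxMap_chain {n m : ℕ} [NeZero n] [NeZero m] {Γ : Graph n} {Γ' : Graph m}
    (f : Fin n → Fin m) (hf : ∀ a b, Γ.adj a b → Γ'.adj (f a) (f b)) {k T : ℕ}
    (σ : Fin T → Fin (k + 1) → Fin n) (hσ : ∀ t i j, Γ.adj (σ t i) (σ t j)) (a : Fin T → ℤ)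
    {G G' : ModuleCat.{u} R} (φ : G ⟶ G') (g : G) :
    (scxMap (ripsOf ((Graph.map f hf).prod (idMap onePoint))) φ).f k (Γ.chain σ hσ a g) =
      Γ'.chain (fun t => f ∘ σ t) (fun t i j => hf _ _ (hσ t i j)) a (φ g) := by
  refine (map_sum ((scxMap (ripsOf ((Graph.map f hf).prod (idMap onePoint))) φ).f k).hom _ _).trans
    (Finset.sum_congr rfl fun t _ => ?_)
  exact (map_zsmul ((scxMap (ripsOf ((Graph.map f hf).prod (idMap onePoint))) φ).f k).hom _ _).trans
    (congrArg (a t • ·) (scxMap_schain _ _ _ _ _))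

/-- The fundamental cycle of the projective plane modulo two. -/
def projCycle : cyc (scx projPlane.rips (unitMod R ⊗ quotMod R 2)) 2 :=
  ⟨projPlane.chain triangles triangles_adj (fun _ => 1) (gen R), mem_cyc_succ.2
    (projPlane.d_chain _ _ _ _ 2 (two_smul_gen R) faceCoeff_triangles)⟩

/-- A fundamental cycle of the octahedron. -/
def octCycle : cyc (scx octahedron.rips (unitMod R ⊗ unitMod R)) 2 :=
  ⟨octahedron.chain (fun t => collapse ∘ triangles t)
    (fun t i j => collapse_adj _ _ (triangles_adj t i j)) octSign ((1 : R) ⊗ₜ[R] (1 : R)),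
    mem_cyc_succ.2 (octahedron.d_chain _ _ _ _ 0 (zero_smul _ _) faceCoeff_collapse)⟩

/-- The map of complexes given by the collapse. -/
abbrev collapseCx : scx projPlane.rips (unitMod R ⊗ quotMod R 2) ⟶
    scx octahedron.rips (unitMod R ⊗ quotMod R 2) :=
  scxMap (ripsOf (collapseMap.prod (idMap onePoint))) (𝟙 (unitMod R) ⊗ₘ 𝟙 (quotMod R 2))

/-- The reduction of coefficients. -/
abbrev redCx {n : ℕ} [NeZero n] (Γ : Graph n) :
    scx Γ.rips (unitMod R ⊗ unitMod R) ⟶ scx Γ.rips (unitMod R ⊗ quotMod R 2) :=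
  scxMap (ripsOf ((idMap Γ.space).prod (idMap onePoint))) (𝟙 (unitMod R) ⊗ₘ red R 2)

/-- Both sides combine the same simplices. The coefficients `1` and `octSign t` differ by an even
integer, and `gen R` is killed by two. -/
theorem collapseCx_projCycle : (collapseCx R).f 2 (projCycle R).1 =
    (redCx R octahedron).f 2 (octCycle R).1 := by
  refine (Graph.scxMap_chain R collapse collapse_adj triangles triangles_adj (fun _ => 1)
    (𝟙 (unitMod R) ⊗ₘ 𝟙 (quotMod R 2)) (gen R)).trans ?_
  refine Eq.trans ?_ (Graph.scxMap_chain R (Γ := octahedron) (Γ' := octahedron) (fun x => x)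
    (fun _ _ h => h) (fun t => collapse ∘ triangles t)
    (fun t i j => collapse_adj _ _ (triangles_adj t i j)) octSign
    (𝟙 (unitMod R) ⊗ₘ red R 2) ((1 : R) ⊗ₜ[R] (1 : R))).symm
  have hg : (𝟙 (unitMod R) ⊗ₘ 𝟙 (quotMod R 2)) (gen R) = gen R := by
    rw [id_tensorHom_id]; rfl
  rw [hg]
  refine Finset.sum_congr rfl fun t _ => ?_
  obtain ⟨b, hb⟩ := odd_octSign t
  have h1 : octSign t = b * 2 + 1 := by rw [mul_comm, ← hb, sub_add_cancel]
  have h2 : ∀ x : octahedron.rips.{u}.obj (op (SimplexCategory.mk 2)),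
      (2 : ℤ) • schain (unitMod R ⊗ quotMod R 2) x (gen R) = 0 := fun x =>
    (map_zsmul (copiesι (unitMod R ⊗ quotMod R 2) x).hom 2 (gen R)).symm.trans
      ((congrArg _ (two_smul_gen R)).trans (map_zero (copiesι _ x).hom))
  rw [h1, add_smul, mul_smul]
  refine Eq.trans ?_ (congrArg₂ (· + ·) ((congrArg (b • ·) (h2 _)).trans (smul_zero b)).symm rfl)
  exact (zero_add _).symm

/-- The cochain of `octForm`. -/
def octCochain : (scx octahedron.rips (unitMod R ⊗ quotMod R 2)).X 2 ⟶ quotMod R 4 :=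
  cochain (fun x => octForm (Graph.vert x)) (dbl R)

/-- The values of `dbl` are killed by two, so the cocycle condition modulo two suffices. -/
theorem octCochain_d (y) : octCochain R
    ((scx octahedron.rips (unitMod R ⊗ quotMod R 2)).d 3 2 y) = 0 := by
  induction y using scx_induction with
  | h0 => rw [map_zero, map_zero]
  | ha a b ha hb => rw [map_add, map_add, ha, hb, add_zero]
  | hs x g =>
    refine (cochain_d (fun x => octForm (Graph.vert x)) (dbl R) x g).trans ?_
    obtain ⟨b, hb⟩ := octForm_cocycle (Graph.vert x) (Graph.adj_vert x)
    change (∑ i : Fin 4, (-1) ^ i.val * octForm (Graph.vert x ∘ i.succAbove)) • dbl R g = 0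
    rw [hb, mul_comm, mul_smul, two_smul_dbl, smul_zero]

/-- The class of `octForm`. -/
def octClass : (scx octahedron.rips (unitMod R ⊗ quotMod R 2)).homology 2 →ₗ[R] quotMod R 4 :=
  homDesc _ 2 ((octCochain R).hom ∘ₗ (cyc _ 2).subtype) (octCochain_d R)

theorem octCochain_collapseCx_projCycle :
    octCochain R ((collapseCx R).f 2 (projCycle R).1) = dbl R (gen R) := by
  have hg : (𝟙 (unitMod R) ⊗ₘ 𝟙 (quotMod R 2)) (gen R) = gen R := by
    rw [id_tensorHom_id]; rfl
  refine (congrArg (octCochain R) (Graph.scxMap_chain R collapse collapse_adj triangles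
    triangles_adj (fun _ => 1) (𝟙 (unitMod R) ⊗ₘ 𝟙 (quotMod R 2)) (gen R))).trans ?_
  rw [hg]
  refine (map_sum (octCochain R).hom _ _).trans ?_
  have h : ∀ t, octCochain R ((1 : ℤ) • schain (unitMod R ⊗ quotMod R 2) (octahedron.spx
      (collapse ∘ triangles t) (fun i j => collapse_adj _ _ (triangles_adj t i j))) (gen R)) =
      octForm (collapse ∘ triangles t) • dbl R (gen R) := fun t => by
    rw [one_smul]
    exact cochain_schain _ _ _ _
  refine (Finset.sum_congr rfl fun t _ => h t).trans ?_
  rw [← Finset.sum_smul, sum_octForm, one_smul]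

/-- The cochain of `projForm`. -/
def projCochain : (scx projPlane.rips (unitMod R ⊗ unitMod R)).X 1 ⟶ quotMod R 4 :=
  cochain (fun x => projForm (Graph.vert x)) (mulRed R)

/-- On reductions of `R`-chains `dbl` becomes twice `mulRed`, so the integer cochain being evaluated
is `2 * octForm`, the coboundary of `projForm` modulo four. On reductions of cycles the value is
therefore zero. -/
theorem octCochain_collapseCx_redCx (y) :
    octCochain R ((collapseCx R).f 2 ((redCx R projPlane).f 2 y)) =
      projCochain R ((scx projPlane.rips (unitMod R ⊗ unitMod R)).d 2 1 y) := by
  induction y using scx_induction with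
  | h0 => simp only [map_zero]
  | ha a b ha hb => simp only [map_add, ha, hb]
  | hs x g =>
    have hg : (𝟙 (unitMod R) ⊗ₘ 𝟙 (quotMod R 2)) ((𝟙 (unitMod R) ⊗ₘ red R 2) g) =
        (𝟙 (unitMod R) ⊗ₘ red R 2) g := by
      rw [id_tensorHom_id]; rfl
    refine Eq.trans ?_ (cochain_d (fun x => projForm (Graph.vert x)) (mulRed R) x g).symm
    refine (congrArg (fun z => octCochain R ((collapseCx R).f 2 z)) (scxMap_schain _ _ _ x g)).trans
      ((congrArg (octCochain R) (scxMap_schain _ _ _ _ _)).trans ?_)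
    refine (cochain_schain _ _ _ _).trans ?_
    refine (congrArg (fun z => octForm (collapse ∘ Graph.vert x) • dbl R z) hg).trans ?_
    obtain ⟨b, hb⟩ := projForm_coboundary (Graph.vert x) (Graph.adj_vert x)
    change octForm (collapse ∘ Graph.vert x) • dbl R ((𝟙 (unitMod R) ⊗ₘ red R 2) g) =
      (∑ i : Fin 3, (-1) ^ i.val * projForm (Graph.vert x ∘ i.succAbove)) • mulRed R g
    rw [dbl_red, smul_smul, ← sub_eq_zero, ← sub_smul, mul_comm, hb, mul_comm, mul_smul,
      four_smul_mulRed, smul_zero]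

theorem homologyMap_collapseCx_ne (h2 : (2 : R) ∉ Ideal.span {(4 : R)})
    (e : (scx projPlane.rips (unitMod R ⊗ unitMod R)).homology 2) :
    homologyMap (collapseCx R) 2 (cls _ 2 (projCycle R)) ≠
      homologyMap (collapseCx R) 2 (homologyMap (redCx R projPlane) 2 e) := by
  intro h
  obtain ⟨x, rfl⟩ := cls_surjective _ _ e
  have e1 := congrArg (octClass R) (homologyMap_cls (collapseCx R) (projCycle R))
  have e2 := congrArg (fun z => octClass R (homologyMap (collapseCx R) 2 z))
    (homologyMap_cls (redCx R projPlane) x)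
  have e3 := congrArg (octClass R)
    (homologyMap_cls (collapseCx R) (cycMap (redCx R projPlane) 2 x))
  have hc (y) : octClass R (cls _ 2 y) = octCochain R y.1 :=
    homDesc_cls ((octCochain R).hom ∘ₗ (cyc _ 2).subtype) (octCochain_d R) y
  have e4 := (hc _).symm.trans (e1.symm.trans
    ((congrArg (octClass R) h).trans (e2.trans (e3.trans (hc _)))))
  have e5 : octCochain R ((collapseCx R).f 2 (projCycle R).1) =
    octCochain R ((collapseCx R).f 2 ((redCx R projPlane).f 2 x.1)) := e4
  -- The left side is twice the generator of `R/4`; the right side vanishes because `x` is a cycle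
  -- with coefficients in `R ⊗ R`.
  rw [octCochain_collapseCx_projCycle, octCochain_collapseCx_redCx, mem_cyc_succ.1 x.2,
    map_zero] at e5
  exact dbl_gen R h2 e5

variable [IsDomain R] [IsPrincipalIdealRing R]

theorem not_splitsNaturally_unitMod (h2 : (2 : R) ∉ Ideal.span {(4 : R)})
    (K : NaturalSequence R) :
    ¬ K.SplitsNaturally (unitMod R) (quotMod R 2) (isZero_tor₁_unitMod R _) := by
  let c := (vIso (projPlane.space.prod onePoint) (unitMod R ⊗ quotMod R 2) 2).inv
    (cls _ 2 (projCycle R))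
  let d := (vIso (octahedron.space.prod onePoint) (unitMod R ⊗ unitMod R) 2).inv
    (cls _ 2 (octCycle R))
  refine not_splitsNaturally (red R 2) (isZero_tor₁_unitMod R _) (isZero_tor₁_unitMod R _)
    collapseMap ((2 : ℕ) : ℤ) c d ?_ (fun e he => ?_) K
  -- The comparison with the complexes of the least entourages turns the two hypotheses on classes
  -- into `collapseCx_projCycle` and `homologyMap_collapseCx_ne`.
  · refine (ConcreteCategory.congr_hom (vIso_inv_natural (collapseMap.prod (idMap onePoint))
      (𝟙 (unitMod R) ⊗ₘ 𝟙 (quotMod R 2)) 2) (cls _ 2 (projCycle R))).trans ?_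
    refine Eq.trans ?_ (ConcreteCategory.congr_hom (vIso_inv_natural
      ((idMap octahedron.space).prod (idMap onePoint)) (𝟙 (unitMod R) ⊗ₘ red R 2) 2)
      (cls _ 2 (octCycle R))).symm
    refine congrArg (vIso (octahedron.space.prod onePoint) (unitMod R ⊗ quotMod R 2) 2).inv ?_
    refine (homologyMap_cls (collapseCx R) (projCycle R)).trans (Eq.trans ?_
      (homologyMap_cls (redCx R octahedron) (octCycle R)).symm)
    exact congrArg (cls _ 2) (Subtype.ext (collapseCx_projCycle R))
  · obtain ⟨e, rfl⟩ : ∃ e', (vIso (projPlane.space.prod onePoint)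
        (unitMod R ⊗ unitMod R) 2).inv e' = e := ⟨_, iso_inv_hom_apply _ e⟩
    have h1 := ConcreteCategory.congr_hom (vIso_inv_natural (collapseMap.prod (idMap onePoint))
      (𝟙 (unitMod R) ⊗ₘ 𝟙 (quotMod R 2)) 2)
    have h3 := ConcreteCategory.congr_hom (vIso_inv_natural
      ((idMap projPlane.space).prod (idMap onePoint)) (𝟙 (unitMod R) ⊗ₘ red R 2) 2) e
    have h4 := (h1 (cls _ 2 (projCycle R))).symm.trans (he.trans
      ((congrArg (vrMap (collapseMap.prod (idMap onePoint))
        (𝟙 (unitMod R) ⊗ₘ 𝟙 (quotMod R 2)) 2) h3).trans (h1 _)))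
    refine homologyMap_collapseCx_ne R h2 e ?_
    have h5 := congrArg
      (vIso (octahedron.space.prod onePoint) (unitMod R ⊗ quotMod R 2) 2).hom h4
    exact (iso_hom_inv_apply _ _).symm.trans (h5.trans (iso_hom_inv_apply _ _))

end counterexample

end Kunneth
end

theorem mainTheorem2 :
    (∀ (X Y : SemiUniformSpace.{u}) (U : Set (X.carrier × X.carrier))
      (V : Set (Y.carrier × Y.carrier)), X.IsExtremal U → Y.IsExtremal V →
      (X.prod Y).IsExtremal (SemiUniformSpace.boxRel U V)) ∧
    (∀ (R : Type u) [CommRing R] [IsDomain R] [IsPrincipalIdealRing R],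
      ∃ K : Kunneth.NaturalSequence R,
        ∀ (X Y : SemiUniformSpace.{u}) [X.HasExtremal] [Y.HasExtremal] (G G' : ModuleCat.{u} R)
          (h : IsZero (Kunneth.tor₁ G G')) (q : ℤ),
          Nonempty (K.seq X Y G G' h q).Splitting) ∧
    (∃ (R : Type u) (_ : CommRing R) (_ : IsDomain R) (_ : IsPrincipalIdealRing R)
      (G G' : ModuleCat.{u} R) (h : IsZero (Kunneth.tor₁ G G')),
      ∀ K : Kunneth.NaturalSequence R, ¬ K.SplitsNaturally G G' h) := by
  -- The ring of the counterexample is `ℤ`, lifted to the given universe; of its arithmetic only the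
  -- fact that `4` does not divide `2` is needed.
  have e : ℤ ≃+* ULift.{u} ℤ := ULift.ringEquiv.symm
  have : IsDomain (ULift.{u} ℤ) := e.symm.toMulEquiv.isDomain ℤ
  have : IsPrincipalIdealRing (ULift.{u} ℤ) :=
    IsPrincipalIdealRing.of_surjective e.toRingHom e.surjective
  have h2 : (2 : ULift.{u} ℤ) ∉ Ideal.span {(4 : ULift.{u} ℤ)} := fun h => by
    obtain ⟨a, ha⟩ := Ideal.mem_span_singleton.1 h
    have hz : (2 : ℤ) = 4 * e.symm a := by
      have := congrArg e.symm ha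
      rwa [map_mul, map_ofNat, map_ofNat] at this
    omega
  exact ⟨fun X Y U V hU hV => Kunneth.isExtremal_boxRel hU hV,
    fun R _ _ _ => ⟨Kunneth.vrSequence R, fun X Y _ _ G G' h q => Kunneth.nonempty_splitting h q⟩,
    ⟨ULift.{u} ℤ, inferInstance, inferInstance, inferInstance, Kunneth.unitMod _,
      Kunneth.quotMod _ 2, Kunneth.isZero_tor₁_unitMod _ _,
      Kunneth.not_splitsNaturally_unitMod _ h2⟩⟩
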